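/- Let $X := H^1(\mathbb{R}) \times L^2(\mathbb{R})$ (real-valued functions), with norm $\|(\eta, v)\|_X^2 := \|\eta\|_{L^2}^2 + \|\partial_x \eta\|_{L^2}^2 + \|v\|_{L^2}^2$. For $(\eta, v) \in X$ with $\max_{x \in \mathbb{R}} \eta(x) < 1$, set $$E(\eta, v) := \frac{1}{8} \int_\mathbb{R} \frac{(\partial_x \eta)^2}{1 - \eta} + \frac{1}{2} \int_\mathbb{R} (1 - \eta) v^2 + \frac{1}{4} \int_\mathbb{R} \eta^2, \qquad P(\eta, v) := \frac{1}{2} \int_\mathbb{R} \eta v.$$ For $c \in (-\sqrt{2}, \sqrt{2}) \setminus \{0\}$, let $Q_c := (\eta_c, v_c) \in X$ be given by $$\eta_c(x) := \frac{2 - c^2}{2 \cosh\big(\sqrt{2 - c^2}\, x/2\big)^2}, \qquad v_c(x) := - \frac{c\, \eta_c(x)}{2 (1 - \eta_c(x))}.$$ The functionals $E$ and $P$ are twice continuously (Fréchet) differentiable on a neighbourhood of $Q_c$ in $X$. Let $H_c := E''(Q_c) + c P''(Q_c)$, viewed as a quadratic form on $X$. For every $c \in (-\sqrt{2}, \sqrt{2})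 \setminus \{0\}$ there exists $\Lambda_c > 0$ such that $$H_c(\varepsilon) \geq \Lambda_c \|\varepsilon\|_X^2$$ for every $\varepsilon = (\varepsilon_\eta, \varepsilon_v) \in X$ satisfying $$\int_\mathbb{R} \varepsilon_\eta\, \partial_x \eta_c + \int_\mathbb{R} \varepsilon_v\, \partial_x v_c = 0 \qquad \text{and} \qquad P'(Q_c)(\varepsilon) = 0.$$ Moreover, the constants $\Lambda_c$ may be chosen so that, for every compact subset $K$ of $(-\sqrt{2}, \sqrt{2}) \setminus \{0\}$, there exists $m > 0$ with $\Lambda_c \geq m$ for all $c \in K$. -/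

import Mathlib

open MeasureTheory Set
open scoped ContDiff

namespace GrossPitaevskii

/-- The real Hilbert space `L²(ℝ)`. -/
abbrev L2 : Type := Lp ℝ 2 (volume : Measure ℝ)

/-- `g` is the weak (distributional) derivative of `f`, for `f, g ∈ L²(ℝ)`: integration by parts
holds against every smooth compactly supported function. -/
def IsWeakDeriv (f g : L2) : Prop :=
  ∀ φ : ℝ → ℝ, ContDiff ℝ ∞ φ → HasCompactSupport φ →
    ∫ x, f x * deriv φ x = - ∫ x, g x * φ x

theorem integrable_L2_mul (f : L2) {φ : ℝ → ℝ} (h1 : Continuous φ) (h2 : HasCompactSupport φ) :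
    Integrable (fun x => f x * φ x) :=
  (Lp.memLp f).integrable_mul (h1.memLp_of_hasCompactSupport (p := 2) h2)

theorem integrable_L2_mul_deriv (f : L2) {φ : ℝ → ℝ} (h1 : ContDiff ℝ ∞ φ)
    (h2 : HasCompactSupport φ) : Integrable (fun x => f x * deriv φ x) :=
  integrable_L2_mul f (h1.continuous_deriv (by simp)) h2.deriv

theorem integral_add_mul (f g : L2) {φ : ℝ → ℝ} (h1 : Continuous φ) (h2 : HasCompactSupport φ) :
    ∫ x, (f + g : L2) x * φ x = (∫ x, f x * φ x) + ∫ x, g x * φ x := by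
  rw [← integral_add (integrable_L2_mul f h1 h2) (integrable_L2_mul g h1 h2)]
  refine integral_congr_ae ?_
  filter_upwards [Lp.coeFn_add f g] with x hx
  rw [hx, Pi.add_apply, add_mul]

theorem integral_smul_mul (a : ℝ) (f : L2) (φ : ℝ → ℝ) :
    ∫ x, (a • f : L2) x * φ x = a * ∫ x, f x * φ x := by
  rw [← integral_const_mul]
  refine integral_congr_ae ?_
  filter_upwards [Lp.coeFn_smul a f] with x hx
  rw [hx, Pi.smul_apply, smul_eq_mul, mul_assoc]

/-- The Sobolev space `H¹(ℝ)`: the functions of `L²(ℝ)` that have a weak derivative in `L²(ℝ)`.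
An element is recorded together with its (unique) weak derivative, so that the norm inherited from
the `ℓ²`-product is `‖η‖²_{H¹} = ‖η‖²_{L²} + ‖∂ₓη‖²_{L²}`. -/
def H1 : Submodule ℝ (WithLp 2 (L2 × L2)) where
  carrier := {p | IsWeakDeriv p.fst p.snd}
  add_mem' := by
    intro p q hp hq φ h1 h2
    rw [WithLp.add_fst, WithLp.add_snd,
      integral_add_mul _ _ (h1.continuous_deriv (by simp)) h2.deriv,
      integral_add_mul _ _ h1.continuous h2, hp φ h1 h2, hq φ h1 h2]
    ring
  zero_mem' := by
    intro φ _ _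
    have h0 : ∀ ψ : ℝ → ℝ, ∫ x, (0 : L2) x * ψ x = 0 := fun ψ => by
      have h := integral_smul_mul 0 0 ψ
      rwa [zero_smul, zero_mul] at h
    rw [WithLp.zero_fst, WithLp.zero_snd, h0, h0, neg_zero]
  smul_mem' := by
    intro a p hp φ h1 h2
    rw [WithLp.smul_fst, WithLp.smul_snd, integral_smul_mul, integral_smul_mul, hp φ h1 h2]
    ring

/-- `X(ℝ) = H¹(ℝ) × L²(ℝ)`, with `‖(η, v)‖²_X = ‖η‖²_{H¹} + ‖v‖²_{L²}`. -/
abbrev X : Type := WithLp 2 (H1 × L2)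

/-- The first component `η` of `(η, v) ∈ X(ℝ)`. -/
def X.eta (u : X) : L2 := u.fst.1.fst

/-- The weak derivative `∂ₓη` of the first component of `(η, v) ∈ X(ℝ)`. -/
def X.dEta (u : X) : L2 := u.fst.1.snd

/-- The second component `v` of `(η, v) ∈ X(ℝ)`. -/
def X.vel (u : X) : L2 := u.snd

/-- The Ginzburg-Landau energy
`E(η, v) = ⅛ ∫ (∂ₓη)² / (1 - η) + ½ ∫ (1 - η) v² + ¼ ∫ η²`. It is meaningful on the open set of
the `(η, v) ∈ X(ℝ)` with `max η < 1`, and takes unspecified values elsewhere. -/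
noncomputable def energy (u : X) : ℝ :=
  1 / 8 * (∫ x, u.dEta x ^ 2 / (1 - u.eta x)) + 1 / 2 * (∫ x, (1 - u.eta x) * u.vel x ^ 2)
    + 1 / 4 * ∫ x, u.eta x ^ 2

/-- The momentum `P(η, v) = ½ ∫ η v`. -/
noncomputable def momentum (u : X) : ℝ := 1 / 2 * ∫ x, u.eta x * u.vel x

/-- The admissible speeds `(-√2, √2) \ {0}`. -/
def speeds : Set ℝ := Ioo (-√2) (√2) \ {0}

/-- `η_c(x) = (2 - c²) / (2 ch(√(2 - c²) x / 2)²)`. -/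
noncomputable def etaC (c x : ℝ) : ℝ := (2 - c ^ 2) / (2 * Real.cosh (√(2 - c ^ 2) * x / 2) ^ 2)

/-- `v_c(x) = - c η_c(x) / (2 (1 - η_c(x)))`. -/
noncomputable def velC (c x : ℝ) : ℝ := -(c * etaC c x) / (2 * (1 - etaC c x))

theorem sq_lt_two {c : ℝ} (hc : c ∈ speeds) : c ^ 2 < 2 := by
  obtain ⟨⟨h1, h2⟩, -⟩ := hc
  have h := sq_lt_sq' h1 h2
  rwa [Real.sq_sqrt (by norm_num)] at h

theorem sq_pos_of_speed {c : ℝ} (hc : c ∈ speeds) : 0 < c ^ 2 := by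
  have h : c ≠ 0 := hc.2
  positivity

theorem contDiff_etaC (c : ℝ) : ContDiff ℝ ∞ (etaC c) := by
  unfold etaC
  refine contDiff_const.div ?_ ?_
  · exact contDiff_const.mul
      ((Real.contDiff_cosh.comp ((contDiff_const.mul contDiff_id).div_const 2)).pow 2)
  · intro x
    have := Real.cosh_pos (√(2 - c ^ 2) * x / 2)
    positivity

theorem etaC_pos {c : ℝ} (hc : c ∈ speeds) (x : ℝ) : 0 < etaC c x := by
  have h := sq_lt_two hc
  have := Real.cosh_pos (√(2 - c ^ 2) * x / 2)
  have h2 : 0 < 2 - c ^ 2 := by linarith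
  unfold etaC
  positivity

theorem etaC_le {c : ℝ} (hc : c ∈ speeds) (x : ℝ) : etaC c x ≤ (2 - c ^ 2) / 2 := by
  have h := sq_lt_two hc
  have h1 := Real.one_le_cosh (√(2 - c ^ 2) * x / 2)
  unfold etaC
  apply div_le_div_of_nonneg_left (by linarith) (by norm_num)
  nlinarith

theorem one_sub_etaC_pos {c : ℝ} (hc : c ∈ speeds) (x : ℝ) : 0 < 1 - etaC c x := by
  have h := etaC_le hc x
  have := sq_pos_of_speed hc
  linarith

theorem integrable_etaC {c : ℝ} (hc : c ∈ speeds) : Integrable (etaC c) := by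
  have h := sq_lt_two hc
  have hk : 0 < √(2 - c ^ 2) / 2 := by
    have : 0 < √(2 - c ^ 2) := Real.sqrt_pos.2 (by linarith)
    positivity
  have hi : Integrable (fun x : ℝ => (2 - c ^ 2) / 2 * (1 + (√(2 - c ^ 2) / 2 * x) ^ 2)⁻¹) :=
    (integrable_inv_one_add_sq.comp_mul_left' hk.ne').const_mul _
  refine hi.mono' (contDiff_etaC c).continuous.aestronglyMeasurable (.of_forall fun x => ?_)
  rw [Real.norm_of_nonneg (etaC_pos hc x).le]
  set y := √(2 - c ^ 2) / 2 * x with hy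
  have hy' : √(2 - c ^ 2) * x / 2 = y := by rw [hy]; ring
  have hs : y ^ 2 ≤ Real.sinh y ^ 2 := by
    rw [sq_le_sq]
    rcases le_total 0 y with h0 | h0
    · rw [abs_of_nonneg h0, abs_of_nonneg (Real.sinh_nonneg_iff.2 h0)]
      exact Real.self_le_sinh_iff.2 h0
    · rw [abs_of_nonpos h0, abs_of_nonpos (Real.sinh_nonpos_iff.2 h0), ← Real.sinh_neg]
      exact Real.self_le_sinh_iff.2 (by linarith)
  have hcosh : 1 + y ^ 2 ≤ Real.cosh y ^ 2 := by rw [Real.cosh_sq']; linarith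
  unfold etaC
  rw [hy', ← div_eq_mul_inv, div_div]
  apply div_le_div_of_nonneg_left (by linarith) (by positivity)
  linarith

theorem memLp_etaC {c : ℝ} (hc : c ∈ speeds) : MemLp (etaC c) 2 volume := by
  rw [memLp_two_iff_integrable_sq (contDiff_etaC c).continuous.aestronglyMeasurable]
  refine ((integrable_etaC hc).const_mul 1).mono'
    ((contDiff_etaC c).continuous.pow 2).aestronglyMeasurable (.of_forall fun x => ?_)
  have h1 := etaC_pos hc x
  have h2 := one_sub_etaC_pos hc x
  rw [Real.norm_of_nonneg (by positivity)]
  nlinarith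

theorem hasDerivAt_etaC {c : ℝ} (x : ℝ) :
    HasDerivAt (etaC c) (-(√(2 - c ^ 2) * (Real.sinh (√(2 - c ^ 2) * x / 2)
      / Real.cosh (√(2 - c ^ 2) * x / 2)) * etaC c x)) x := by
  have hpos := Real.cosh_pos (√(2 - c ^ 2) * x / 2)
  have h0 : HasDerivAt (fun y : ℝ => √(2 - c ^ 2) * y / 2) (√(2 - c ^ 2) / 2) x := by
    simpa using ((hasDerivAt_id x).const_mul (√(2 - c ^ 2))).div_const 2
  have h := ((hasDerivAt_const x (2 - c ^ 2)).fun_div ((h0.cosh.fun_pow 2).const_mul 2)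
    (by positivity))
  convert! h using 1
  unfold etaC
  field_simp
  ring

theorem memLp_deriv_etaC {c : ℝ} (hc : c ∈ speeds) : MemLp (deriv (etaC c)) 2 volume := by
  refine (memLp_etaC hc).of_le_mul (c := √(2 - c ^ 2))
    ((contDiff_etaC c).continuous_deriv (by simp)).aestronglyMeasurable (.of_forall fun x => ?_)
  rw [(hasDerivAt_etaC x).deriv, norm_neg, norm_mul, norm_mul,
    Real.norm_of_nonneg (Real.sqrt_nonneg _)]
  refine mul_le_mul_of_nonneg_right ?_ (norm_nonneg _)
  refine mul_le_of_le_one_right (Real.sqrt_nonneg _) ?_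
  have hpos := Real.cosh_pos (√(2 - c ^ 2) * x / 2)
  rw [Real.norm_eq_abs, abs_div, abs_of_pos hpos, div_le_one hpos]
  refine abs_le_of_sq_le_sq ?_ hpos.le
  rw [Real.cosh_sq]
  linarith

theorem memLp_velC {c : ℝ} (hc : c ∈ speeds) : MemLp (velC c) 2 volume := by
  have hcont := (contDiff_etaC c).continuous
  refine (memLp_etaC hc).of_le_mul (c := |c| / c ^ 2) (Continuous.aestronglyMeasurable ?_)
    (.of_forall fun x => ?_)
  · unfold velC
    refine (continuous_const.mul hcont).neg.div₀
      (continuous_const.mul (continuous_const.sub hcont)) fun x => ?_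
    have := one_sub_etaC_pos hc x
    positivity
  · have h1 := etaC_le hc x
    have h2 := sq_pos_of_speed hc
    have h3 : c ^ 2 ≤ 2 * (1 - etaC c x) := by linarith
    unfold velC
    rw [Real.norm_eq_abs, Real.norm_eq_abs, abs_div, abs_neg, abs_mul,
      abs_of_pos (lt_of_lt_of_le h2 h3), div_mul_eq_mul_div]
    exact div_le_div_of_nonneg_left (by positivity) h2 h3

theorem isWeakDeriv_etaC {c : ℝ} (hc : c ∈ speeds) :
    IsWeakDeriv ((memLp_etaC hc).toLp _) ((memLp_deriv_etaC hc).toLp _) := by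
  intro φ h1 h2
  have e1 : ∫ x, ((memLp_etaC hc).toLp _ : L2) x * deriv φ x = ∫ x, etaC c x * deriv φ x := by
    refine integral_congr_ae ?_
    filter_upwards [(memLp_etaC hc).coeFn_toLp] with x hx
    rw [hx]
  have e2 : ∫ x, ((memLp_deriv_etaC hc).toLp _ : L2) x * φ x
      = ∫ x, deriv (etaC c) x * φ x := by
    refine integral_congr_ae ?_
    filter_upwards [(memLp_deriv_etaC hc).coeFn_toLp] with x hx
    rw [hx]
  have hφ' : Continuous (deriv φ) := h1.continuous_deriv (by simp)
  rw [e1, e2]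
  refine integral_mul_deriv_eq_deriv_mul_of_integrable
    (fun x _ => ((contDiff_etaC c).differentiable (by simp) x).hasDerivAt)
    (fun x _ => (h1.differentiable (by simp) x).hasDerivAt) ?_ ?_ ?_
  · exact (memLp_etaC hc).integrable_mul (hφ'.memLp_of_hasCompactSupport (p := 2) h2.deriv)
  · exact (memLp_deriv_etaC hc).integrable_mul (h1.continuous.memLp_of_hasCompactSupport (p := 2) h2)
  · exact (memLp_etaC hc).integrable_mul (h1.continuous.memLp_of_hasCompactSupport (p := 2) h2)

/-- The soliton `Q_c = (η_c, v_c) ∈ X(ℝ)`, for `c ∈ (-√2, √2) \ {0}`. -/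
noncomputable def soliton (c : ℝ) (hc : c ∈ speeds) : X :=
  WithLp.toLp 2
    (⟨WithLp.toLp 2 ((memLp_etaC hc).toLp _, (memLp_deriv_etaC hc).toLp _), isWeakDeriv_etaC hc⟩,
      (memLp_velC hc).toLp _)

/-- The scalar product `⟨ε, ∂ₓQ_c⟩` in `L²(ℝ) × L²(ℝ)`. -/
noncomputable def innerDerivSoliton (c : ℝ) (ε : X) : ℝ :=
  (∫ x, ε.eta x * deriv (etaC c) x) + ∫ x, ε.vel x * deriv (velC c) x

/-- The quadratic form `H_c = E''(Q_c) + c P''(Q_c)` on `X(ℝ)`, where the second derivatives are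
second Fréchet derivatives. -/
noncomputable def quadForm (c : ℝ) (hc : c ∈ speeds) (ε : X) : ℝ :=
  fderiv ℝ (fderiv ℝ energy) (soliton c hc) ε ε
    + c * fderiv ℝ (fderiv ℝ momentum) (soliton c hc) ε ε

end GrossPitaevskii

namespace GrossPitaevskii

open Filter Topology

/-! Put k = √(2 - c²)/2, so that η = η_c = 2k²(1 - tanh²(kx)), and write ε = (e, w). Completing the
square in w and integrating the mixed term by parts turns H_c(ε) into the integral of e'²/(4(1-η)) +
V e² (`linDensity`) plus that of (1-η)(w + c e/(2(1-η)²))². The translation mode η' solves the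
Sturm-Liouville equation of the first form and vanishes only at 0. Hence that form is nonnegative on
functions vanishing at 0, although it has a negative direction on H¹.

The momentum constraint removes the negative direction without spectral theory. Differentiating
E'(Q_c) + c P'(Q_c) = 0 in c gives H_c ∂_cQ_c = -P'(Q_c). The first component of S = -∂_cQ_c/c is
`scal`, which equals 1 at 0. Write ε = e(0) S + ε̃; the first component u of ε̃ (`modPart`) vanishes
at 0. Since P'(Q_c)(ε) = 0, the cross term is explicit, and H_c(ε) = H_c(ε̃) + e(0)² c⁻² d/dc
P(Q_c), where d/dc P(Q_c) = 2k > 0. This is `Admissible.integral_hessDensity`: three nonnegative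
terms.

For a quantitative bound, the condition u(0) = 0 decouples the two half-lines. On each of them a
multiple of η' is subtracted so that the remainder vanishes also at ±log 2/k; this does not change
the form. Perturbing the Riccati solution η''/(4(1-η)η') on either side of that point gives the
lower bound k²/225 for the remainder in L². What is left are the coefficients r₁, r₂ of η' on the
right and on the left. The momentum constraint pairs u with an even weight and controls r₁ - r₂;
orthogonality to ∂ₓQ_c pairs u with an odd weight and controls r₁ + r₂ (`kernel_coefficients_le`).
This bounds e in L²; e' and w are then recovered pointwise. All constants are powers of a number M
that bounds 1, 1/k and 1/c² (`Admissible.coercive`), which gives uniformity on compact sets of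
speeds.

The link with the Fréchet derivatives goes through the Sobolev embedding: weak differentiability
provides a bounded continuous representative of η, and 1/(1-η) becomes inversion in the Banach
algebra of bounded continuous functions, which is smooth at units. -/

/-- Bounded continuous coefficients. -/
def BddCont (m : ℝ → ℝ) : Prop := Continuous m ∧ ∃ C, ∀ x, |m x| ≤ C

namespace BddCont
variable {m n : ℝ → ℝ}

theorem const (r : ℝ) : BddCont fun _ => r := ⟨continuous_const, |r|, fun _ => le_rfl⟩

theorem add (hm : BddCont m) (hn : BddCont n) : BddCont fun x => m x + n x := by
  obtain ⟨h1, C, hC⟩ := hm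
  obtain ⟨h2, D, hD⟩ := hn
  exact ⟨h1.add h2, C + D, fun x => (abs_add_le _ _).trans (add_le_add (hC x) (hD x))⟩

theorem mul (hm : BddCont m) (hn : BddCont n) : BddCont fun x => m x * n x := by
  obtain ⟨h1, C, hC⟩ := hm
  obtain ⟨h2, D, hD⟩ := hn
  refine ⟨h1.mul h2, C * D, fun x => ?_⟩
  rw [abs_mul]
  exact mul_le_mul (hC x) (hD x) (abs_nonneg _) ((abs_nonneg _).trans (hC x))

theorem neg (hm : BddCont m) : BddCont fun x => -m x := by
  simpa using (const (-1)).mul hm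

theorem sub (hm : BddCont m) (hn : BddCont n) : BddCont fun x => m x - n x := by
  simpa [sub_eq_add_neg] using hm.add hn.neg

theorem const_mul (hm : BddCont m) (r : ℝ) : BddCont fun x => r * m x := (const r).mul hm

theorem pow (hm : BddCont m) (j : ℕ) : BddCont fun x => m x ^ j := by
  induction j with
  | zero => simpa using const 1
  | succ j ih => simpa [pow_succ] using ih.mul hm

theorem inv (hm : Continuous m) {δ : ℝ} (hδ : 0 < δ) (h : ∀ x, δ ≤ m x) :
    BddCont fun x => (m x)⁻¹ := by
  refine ⟨hm.inv₀ fun x => (hδ.trans_le (h x)).ne', δ⁻¹, fun x => ?_⟩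
  rw [abs_of_pos (inv_pos.2 (hδ.trans_le (h x)))]
  exact inv_anti₀ hδ (h x)

theorem integrable_mul_mul (hm : BddCont m) {f g : ℝ → ℝ} (hf : MemLp f 2 volume)
    (hg : MemLp g 2 volume) : Integrable fun x => m x * (f x * g x) := by
  obtain ⟨h1, C, hC⟩ := hm
  exact (hf.integrable_mul hg).bdd_mul h1.aestronglyMeasurable (.of_forall hC)

theorem memLp_mul (hm : BddCont m) {f : ℝ → ℝ} (hf : MemLp f 2 volume) :
    MemLp (fun x => m x * f x) 2 volume := by
  obtain ⟨h1, C, hC⟩ := hm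
  refine hf.of_le_mul (c := C) (h1.aestronglyMeasurable.mul hf.1) (.of_forall fun x => ?_)
  rw [norm_mul]
  exact mul_le_mul_of_nonneg_right (hC x) (norm_nonneg _)

end BddCont

theorem integrable_of_memLp_mul {f g : ℝ → ℝ} (hf : MemLp f 2 volume) (hg : MemLp g 2 volume) :
    Integrable fun x => f x * g x := hf.integrable_mul hg

/-! ### Calculus for functions of H¹(ℝ): integration by parts, decay, sup bound. -/

/-- A bounded `C¹` coefficient with bounded derivative. -/
structure BddContDiff (φ dφ : ℝ → ℝ) : Prop where
  hasDerivAt : ∀ x, HasDerivAt φ (dφ x) x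
  bddCont : BddCont φ
  bddCont_deriv : BddCont dφ

theorem BddContDiff.contDiff {φ dφ : ℝ → ℝ} (hφ : BddContDiff φ dφ) :
    ContDiff ℝ 1 φ := by
  rw [contDiff_one_iff_deriv]
  refine ⟨fun x => (hφ.hasDerivAt x).differentiableAt, ?_⟩
  rw [show deriv φ = dφ from funext fun x => (hφ.hasDerivAt x).deriv]
  exact hφ.bddCont_deriv.1

theorem BddContDiff.one : BddContDiff (fun _ => 1) fun _ => 0 :=
  ⟨fun x => hasDerivAt_const x 1, .const 1, .const 0⟩

/-- `u` is the absolutely continuous representative of an element of `H¹(ℝ)`, with weak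
derivative `du`. -/
structure SobolevPair (u du : ℝ → ℝ) : Prop where
  memLp : MemLp u 2 volume
  memLp_deriv : MemLp du 2 volume
  integral_eq : ∀ a b, ∫ x in a..b, du x = u b - u a

namespace SobolevPair
variable {u du w dw : ℝ → ℝ}

theorem locallyIntegrable (h : SobolevPair u du) : LocallyIntegrable du :=
  h.memLp_deriv.locallyIntegrable (by norm_num)

theorem intervalIntegrable (h : SobolevPair u du) (a b : ℝ) :
    IntervalIntegrable du volume a b :=
  intervalIntegrable_iff.2 <|
    (h.locallyIntegrable.integrableOn_isCompact isCompact_uIcc).mono_set uIoc_subset_uIcc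

theorem eq_add_integral (h : SobolevPair u du) (a : ℝ) :
    u = fun x => u a + ∫ y in a..x, du y := by
  funext x; rw [h.integral_eq]; ring

theorem continuous (h : SobolevPair u du) : Continuous u := by
  rw [h.eq_add_integral 0]
  exact continuous_const.add (intervalIntegral.continuous_primitive h.intervalIntegrable 0)

theorem ae_hasDerivAt (h : SobolevPair u du) : ∀ᵐ x, HasDerivAt u (du x) x := by
  filter_upwards [_root_.LocallyIntegrable.ae_hasDerivAt_integral h.locallyIntegrable] with x hx
  have := (hx 0).const_add (u 0)
  rwa [← h.eq_add_integral 0] at this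

theorem absolutelyContinuous (h : SobolevPair u du) (a b : ℝ) :
    AbsolutelyContinuousOnInterval u a b := by
  rw [h.eq_add_integral a]
  exact (contDiffOn_const (c := u a) (n := 1)).absolutelyContinuousOnInterval.fun_add
    ((h.intervalIntegrable a b).absolutelyContinuousOnInterval_intervalIntegral left_mem_uIcc)

theorem add (h : SobolevPair u du) (h' : SobolevPair w dw) :
    SobolevPair (fun x => u x + w x) fun x => du x + dw x where
  memLp := h.memLp.add h'.memLp
  memLp_deriv := h.memLp_deriv.add h'.memLp_deriv
  integral_eq a b := by
    rw [intervalIntegral.integral_add (h.intervalIntegrable a b) (h'.intervalIntegrable a b),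
      h.integral_eq, h'.integral_eq]
    ring

theorem const_mul (h : SobolevPair u du) (r : ℝ) :
    SobolevPair (fun x => r * u x) fun x => r * du x where
  memLp := h.memLp.const_mul r
  memLp_deriv := h.memLp_deriv.const_mul r
  integral_eq a b := by
    rw [intervalIntegral.integral_const_mul, h.integral_eq]
    ring

theorem sub_const_mul (h : SobolevPair u du) (h' : SobolevPair w dw) (r : ℝ) :
    SobolevPair (fun x => u x - r * w x) fun x => du x - r * dw x := by
  convert! h.add (h'.const_mul (-r)) using 2 <;> ring

theorem comp_neg (h : SobolevPair u du) : SobolevPair (fun x => u (-x)) fun x => -du (-x) where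
  memLp := h.memLp.comp_measurePreserving (Measure.measurePreserving_neg volume)
  memLp_deriv := (h.memLp_deriv.comp_measurePreserving (Measure.measurePreserving_neg volume)).neg
  integral_eq a b := by
    rw [intervalIntegral.integral_neg, intervalIntegral.integral_comp_neg (fun x => du x),
      h.integral_eq]
    ring

theorem of_hasDerivAt (h : ∀ x, HasDerivAt u (du x) x) (hc : Continuous du)
    (h1 : MemLp u 2 volume) (h2 : MemLp du 2 volume) : SobolevPair u du where
  memLp := h1
  memLp_deriv := h2
  integral_eq a b :=
    intervalIntegral.integral_eq_sub_of_hasDerivAt (fun x _ => h x) (hc.intervalIntegrable a b)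

/-- Integration of the derivative of `φ u w`. -/
theorem integral_deriv_mul_mul (h : SobolevPair u du) (h' : SobolevPair w dw) {φ dφ : ℝ → ℝ}
    {a b : ℝ} (hφ : ContDiffOn ℝ 1 φ (uIcc a b)) (hd : ∀ x ∈ uIcc a b, HasDerivAt φ (dφ x) x) :
    ∫ x in a..b, (dφ x * (u x * w x) + φ x * (du x * w x + u x * dw x))
      = φ b * (u b * w b) - φ a * (u a * w a) := by
  have hac := hφ.absolutelyContinuousOnInterval.fun_mul
    ((h.absolutelyContinuous a b).fun_mul (h'.absolutelyContinuous a b))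
  rw [← hac.integral_deriv_eq_sub]
  refine intervalIntegral.integral_congr_ae ?_
  filter_upwards [h.ae_hasDerivAt, h'.ae_hasDerivAt] with x h1 h2 h3
  exact ((hd x (uIoc_subset_uIcc h3)).mul (h1.mul h2)).deriv.symm

theorem sq_sub_le (h : SobolevPair u du) {x y : ℝ} (hxy : x < y) :
    (u y - u x) ^ 2 ≤ (y - x) * ∫ z in Ioc x y, du z ^ 2 := by
  have h1 := h.integral_eq x y
  rw [intervalIntegral.integral_of_le hxy.le] at h1
  have hi : IntegrableOn (fun z => du z ^ 2) (Ioc x y) := h.memLp_deriv.integrable_sq.integrableOn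
  have hdu : IntegrableOn du (Ioc x y) := by
    simpa [intervalIntegrable_iff, uIoc_of_le hxy.le] using h.intervalIntegrable x y
  have h0 : ∀ r : ℝ, 0 ≤ (∫ z in Ioc x y, du z ^ 2) - 2 * r * (u y - u x) + (y - x) * r ^ 2 := by
    intro r
    have h0 : 0 ≤ ∫ z in Ioc x y, (du z - r) ^ 2 := integral_nonneg fun z => sq_nonneg _
    have e : ∀ z, (du z - r) ^ 2 = du z ^ 2 - 2 * r * du z + r ^ 2 := fun z => by ring
    simp_rw [e] at h0
    have hc : IntegrableOn (fun _ : ℝ => r ^ 2) (Ioc x y) := integrableOn_const (by simp)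
    have hs : IntegrableOn (fun z => du z ^ 2 - 2 * r * du z) (Ioc x y) :=
      hi.sub (hdu.const_mul _)
    rw [integral_add hs hc, integral_sub hi (hdu.const_mul _), integral_const_mul,
      setIntegral_const, h1] at h0
    simpa [measureReal_def, hxy.le] using h0
  -- The mean slope minimizes the quadratic polynomial in `r`.
  have h2 := h0 ((u y - u x) / (y - x))
  have h3 : 0 < y - x := sub_pos.2 hxy
  field_simp at h2
  nlinarith

/-- Average u(x)² ≤ 2u(y)² + 2(u(y) - u(x))² over y in (x, x + 1). Integrating over the tail `Ioi x`
only is what makes the same bound yield decay at infinity. -/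
theorem sq_le (h : SobolevPair u du) (x : ℝ) :
    u x ^ 2 ≤ 2 * ∫ y in Ioi x, (u y ^ 2 + du y ^ 2) := by
  have hint : Integrable fun y => u y ^ 2 + du y ^ 2 :=
    h.memLp.integrable_sq.add h.memLp_deriv.integrable_sq
  have key : ∀ y ∈ Ioc x (x + 1), u x ^ 2 ≤ 2 * u y ^ 2 + 2 * ∫ z in Ioc x (x + 1), du z ^ 2 := by
    intro y hy
    have hmono : ∫ z in Ioc x y, du z ^ 2 ≤ ∫ z in Ioc x (x + 1), du z ^ 2 :=
      setIntegral_mono_set h.memLp_deriv.integrable_sq.integrableOn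
        (.of_forall fun z => sq_nonneg _) (Ioc_subset_Ioc_right hy.2).eventuallyLE
    have h0 : 0 ≤ ∫ z in Ioc x y, du z ^ 2 := integral_nonneg fun z => sq_nonneg _
    have h1 := h.sq_sub_le hy.1
    have h2 : (y - x) * ∫ z in Ioc x y, du z ^ 2 ≤ 1 * ∫ z in Ioc x y, du z ^ 2 :=
      mul_le_mul_of_nonneg_right (by linarith [hy.2]) h0
    nlinarith [sq_nonneg (2 * u y - u x)]
  have hvol : ∫ _ in Ioc x (x + 1), u x ^ 2 = u x ^ 2 := by simp [measureReal_def]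
  have hvol' : ∀ r : ℝ, ∫ _ in Ioc x (x + 1), r = r := fun r => by simp [measureReal_def]
  calc u x ^ 2 = ∫ _ in Ioc x (x + 1), u x ^ 2 := hvol.symm
    _ ≤ ∫ y in Ioc x (x + 1), (2 * u y ^ 2 + 2 * ∫ z in Ioc x (x + 1), du z ^ 2) := by
        refine setIntegral_mono_on (integrableOn_const (by simp)) ?_ measurableSet_Ioc key
        exact (h.memLp.integrable_sq.integrableOn.const_mul 2).add (integrableOn_const (by simp))
    _ = 2 * ∫ y in Ioc x (x + 1), (u y ^ 2 + du y ^ 2) := by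
        rw [integral_add (h.memLp.integrable_sq.integrableOn.const_mul 2)
          (integrableOn_const (by simp)), hvol', integral_const_mul,
          integral_add h.memLp.integrable_sq.integrableOn h.memLp_deriv.integrable_sq.integrableOn]
        ring
    _ ≤ 2 * ∫ y in Ioi x, (u y ^ 2 + du y ^ 2) := by
        refine mul_le_mul_of_nonneg_left ?_ (by norm_num)
        exact setIntegral_mono_set hint.integrableOn (.of_forall fun z => by positivity)
          Ioc_subset_Ioi_self.eventuallyLE

theorem sq_le_integral (h : SobolevPair u du) (x : ℝ) :
    u x ^ 2 ≤ 2 * ∫ y, (u y ^ 2 + du y ^ 2) := by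
  refine (h.sq_le x).trans (mul_le_mul_of_nonneg_left ?_ (by norm_num))
  exact setIntegral_le_integral (h.memLp.integrable_sq.add h.memLp_deriv.integrable_sq)
    (.of_forall fun z => by positivity)

theorem tendsto_atTop (h : SobolevPair u du) : Tendsto u atTop (𝓝 0) := by
  have hint : Integrable fun y => u y ^ 2 + du y ^ 2 :=
    h.memLp.integrable_sq.add h.memLp_deriv.integrable_sq
  have h1 : Tendsto (fun x : ℝ => 2 * ∫ y in Ioi x, (u y ^ 2 + du y ^ 2)) atTop (𝓝 0) := by
    have h2 : Tendsto (fun x : ℝ => ∫ y in (0)..x, (u y ^ 2 + du y ^ 2)) atTop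
        (𝓝 (∫ y in Ioi 0, (u y ^ 2 + du y ^ 2))) :=
      intervalIntegral_tendsto_integral_Ioi 0 hint.integrableOn tendsto_id
    have h3 : (fun x : ℝ => 2 * ∫ y in Ioi x, (u y ^ 2 + du y ^ 2)) = fun x =>
        2 * ((∫ y in Ioi 0, (u y ^ 2 + du y ^ 2)) - ∫ y in (0)..x, (u y ^ 2 + du y ^ 2)) := by
      funext x
      rw [← intervalIntegral.integral_Ioi_sub_Ioi' hint.integrableOn hint.integrableOn]
      ring
    rw [h3]
    have h4 := (h2.const_sub (∫ y in Ioi 0, (u y ^ 2 + du y ^ 2))).const_mul 2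
    rwa [sub_self, mul_zero] at h4
  have h4 : Tendsto (fun x => u x ^ 2) atTop (𝓝 0) :=
    squeeze_zero (fun x => sq_nonneg _) h.sq_le h1
  have h5 := h4.sqrt
  simp only [Real.sqrt_sq_eq_abs, Real.sqrt_zero] at h5
  exact (tendsto_zero_iff_abs_tendsto_zero u).2 h5

theorem tendsto_atBot (h : SobolevPair u du) : Tendsto u atBot (𝓝 0) := by
  simpa [Function.comp_def] using h.comp_neg.tendsto_atTop.comp tendsto_neg_atBot_atTop

theorem integrable_deriv_mul_mul (h : SobolevPair u du) (h' : SobolevPair w dw) {φ dφ : ℝ → ℝ}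
    (hφ : BddContDiff φ dφ) :
    Integrable fun x => dφ x * (u x * w x) + φ x * (du x * w x + u x * dw x) := by
  have h1 := hφ.bddCont_deriv.integrable_mul_mul h.memLp h'.memLp
  have h2 := hφ.bddCont.integrable_mul_mul h.memLp_deriv h'.memLp
  have h3 := hφ.bddCont.integrable_mul_mul h.memLp h'.memLp_deriv
  refine (h1.add (h2.add h3)).congr (.of_forall fun x => ?_)
  simp only [Pi.add_apply]
  ring

theorem tendsto_mul_mul {l : Filter ℝ} (h : Tendsto u l (𝓝 0)) (h' : Tendsto w l (𝓝 0))
    {φ : ℝ → ℝ} (hφ : BddCont φ) : Tendsto (fun x => φ x * (u x * w x)) l (𝓝 0) := by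
  obtain ⟨-, C, hC⟩ := hφ
  have h1 : Tendsto (fun x => C * |u x * w x|) l (𝓝 0) := by
    simpa using (h.mul h').abs.const_mul C
  refine squeeze_zero_norm (fun x => ?_) h1
  rw [norm_mul]
  exact mul_le_mul_of_nonneg_right (hC x) (abs_nonneg _)

theorem integral_Ioi_deriv_mul_mul (h : SobolevPair u du) (h' : SobolevPair w dw) {φ dφ : ℝ → ℝ}
    (hφ : BddContDiff φ dφ) (a : ℝ) :
    ∫ x in Ioi a, (dφ x * (u x * w x) + φ x * (du x * w x + u x * dw x))
      = -(φ a * (u a * w a)) := by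
  refine tendsto_nhds_unique (intervalIntegral_tendsto_integral_Ioi a
    (h.integrable_deriv_mul_mul h' hφ).integrableOn tendsto_id) ?_
  simp_rw [h.integral_deriv_mul_mul h' hφ.contDiff.contDiffOn (fun x _ => hφ.hasDerivAt x)]
  simpa using ((tendsto_mul_mul h.tendsto_atTop h'.tendsto_atTop hφ.bddCont).comp
    tendsto_id).sub_const (φ a * (u a * w a))

theorem integral_deriv_mul_mul_eq_zero (h : SobolevPair u du) (h' : SobolevPair w dw)
    {φ dφ : ℝ → ℝ} (hφ : BddContDiff φ dφ) :
    ∫ x, (dφ x * (u x * w x) + φ x * (du x * w x + u x * dw x)) = 0 := by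
  refine tendsto_nhds_unique (intervalIntegral_tendsto_integral
    (h.integrable_deriv_mul_mul h' hφ) tendsto_neg_atTop_atBot tendsto_id) ?_
  simp_rw [h.integral_deriv_mul_mul h' hφ.contDiff.contDiffOn (fun x _ => hφ.hasDerivAt x)]
  simpa using ((tendsto_mul_mul h.tendsto_atTop h'.tendsto_atTop hφ.bddCont).comp
    tendsto_id).sub ((tendsto_mul_mul h.tendsto_atBot h'.tendsto_atBot hφ.bddCont).comp
    tendsto_neg_atTop_atBot)

theorem integrable_deriv_mul (h : SobolevPair u du) (h' : SobolevPair w dw) :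
    Integrable fun x => du x * w x + u x * dw x :=
  (integrable_of_memLp_mul h.memLp_deriv h'.memLp).add
    (integrable_of_memLp_mul h.memLp h'.memLp_deriv)

theorem integral_Ioi_deriv_mul (h : SobolevPair u du) (h' : SobolevPair w dw) (a : ℝ) :
    ∫ x in Ioi a, (du x * w x + u x * dw x) = -(u a * w a) := by
  simpa using h.integral_Ioi_deriv_mul_mul h' .one a

theorem integral_deriv_mul_eq_zero (h : SobolevPair u du) (h' : SobolevPair w dw) :
    ∫ x, (du x * w x + u x * dw x) = 0 := by
  simpa using h.integral_deriv_mul_mul_eq_zero h' .one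

end SobolevPair

theorem BddCont.congr {m n : ℝ → ℝ} (hm : BddCont m) (h : ∀ x, n x = m x) : BddCont n := by
  rwa [funext h]

theorem BddCont.div {m n : ℝ → ℝ} (hm : BddCont m) (hn : Continuous n) {δ : ℝ} (hδ : 0 < δ)
    (h : ∀ x, δ ≤ n x) : BddCont fun x => m x / n x := by
  simpa only [div_eq_mul_inv] using hm.mul (BddCont.inv hn hδ h)

/-! ### The kink `tanh (k x)` -/

/-- The function `x ↦ tanh (k x)`. -/
noncomputable def kink (k x : ℝ) : ℝ := Real.tanh (k * x)

theorem hasDerivAt_kink (k x : ℝ) : HasDerivAt (kink k) (k * (1 - kink k x ^ 2)) x := by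
  have h0 : HasDerivAt (fun y : ℝ => k * y) k x := by simpa using (hasDerivAt_id x).const_mul k
  have hpos := Real.cosh_pos (k * x)
  have h := h0.sinh.fun_div h0.cosh hpos.ne'
  have e : kink k = fun y => Real.sinh (k * y) / Real.cosh (k * y) := by
    funext y; exact Real.tanh_eq_sinh_div_cosh _
  rw [e]
  convert! h using 1
  field_simp

theorem continuous_kink (k : ℝ) : Continuous (kink k) :=
  continuous_iff_continuousAt.2 fun x => (hasDerivAt_kink k x).continuousAt

theorem kink_sq_lt_one (k x : ℝ) : kink k x ^ 2 < 1 := Real.tanh_sq_lt_one _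

theorem kink_lt_one (k x : ℝ) : kink k x < 1 := Real.tanh_lt_one _

theorem abs_kink_le (k x : ℝ) : |kink k x| ≤ 1 := (Real.abs_tanh_lt_one _).le

theorem kink_neg (k x : ℝ) : kink k (-x) = -kink k x := by simp [kink]

theorem kink_zero (k : ℝ) : kink k 0 = 0 := by simp [kink]

theorem bddCont_kink (k : ℝ) : BddCont (kink k) := ⟨continuous_kink k, 1, abs_kink_le k⟩

theorem one_sub_kink_sq (k x : ℝ) : 1 - kink k x ^ 2 = 1 / Real.cosh (k * x) ^ 2 := by
  have hpos := Real.cosh_pos (k * x)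
  unfold kink
  rw [Real.tanh_eq_sinh_div_cosh, div_pow, Real.sinh_sq]
  field_simp
  ring

/-- cosh² y = 1 + sinh² y ≥ 1 + y². This algebraic decay suffices for integrability and absorbs the
factor `k * x` of the scaling mode. -/
theorem one_sub_kink_sq_mul_le (k x : ℝ) : (1 - kink k x ^ 2) * (1 + (k * x) ^ 2) ≤ 1 := by
  have hpos := Real.cosh_pos (k * x)
  rw [one_sub_kink_sq, one_div, inv_mul_le_iff₀ (by positivity), mul_one, Real.cosh_sq']
  have : (k * x) ^ 2 ≤ Real.sinh (k * x) ^ 2 := by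
    rw [sq_le_sq]
    rcases le_total 0 (k * x) with h0 | h0
    · rw [abs_of_nonneg h0, abs_of_nonneg (Real.sinh_nonneg_iff.2 h0)]
      exact Real.self_le_sinh_iff.2 h0
    · rw [abs_of_nonpos h0, abs_of_nonpos (Real.sinh_nonpos_iff.2 h0), ← Real.sinh_neg]
      exact Real.self_le_sinh_iff.2 (by linarith)
  linarith

section
variable {k : ℝ} (hk : 0 < k)
include hk

theorem kink_strictMono : StrictMono (kink k) := fun x y hxy => by
  refine strictMono_of_hasDerivAt_pos (fun z => hasDerivAt_kink k z) (fun z => ?_) hxy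
  have := kink_sq_lt_one k z
  exact mul_pos hk (by linarith)

theorem kink_nonneg {x : ℝ} (hx : 0 ≤ x) : 0 ≤ kink k x := by
  simpa [kink_zero] using (kink_strictMono hk).monotone hx

theorem kink_pos {x : ℝ} (hx : 0 < x) : 0 < kink k x := by
  simpa [kink_zero] using kink_strictMono hk hx

theorem kink_log_two_div : kink k (Real.log 2 / k) = 3 / 5 := by
  unfold kink
  rw [mul_div_cancel₀ _ hk.ne', Real.tanh_eq, Real.exp_neg, Real.exp_log (by norm_num)]
  norm_num

theorem tendsto_kink_atTop : Tendsto (kink k) atTop (𝓝 1) := by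
  have h1 : Tendsto (fun x : ℝ => 1 - (1 + (k * x) ^ 2)⁻¹) atTop (𝓝 1) := by
    have : Tendsto (fun x : ℝ => 1 + (k * x) ^ 2) atTop atTop :=
      tendsto_atTop_add_const_left _ _
        ((tendsto_pow_atTop two_ne_zero).comp (tendsto_id.const_mul_atTop hk))
    simpa using (tendsto_inv_atTop_zero.comp this).const_sub 1
  refine tendsto_of_tendsto_of_tendsto_of_le_of_le' h1 tendsto_const_nhds ?_
    (.of_forall fun x => (kink_lt_one k x).le)
  filter_upwards [eventually_ge_atTop 0] with x hx
  have h2 := kink_nonneg hk hx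
  have h3 := kink_lt_one k x
  have h4 : 1 - kink k x ^ 2 ≤ (1 + (k * x) ^ 2)⁻¹ := by
    rw [← one_div, le_div_iff₀ (by positivity)]
    exact one_sub_kink_sq_mul_le k x
  nlinarith

theorem tendsto_kink_atBot : Tendsto (kink k) atBot (𝓝 (-1)) := by
  have := ((tendsto_kink_atTop hk).comp tendsto_neg_atBot_atTop).neg
  simpa [Function.comp_def, kink_neg] using this

theorem integrable_one_sub_kink_sq : Integrable fun x => 1 - kink k x ^ 2 := by
  have hi := integrable_inv_one_add_sq.comp_mul_left' hk.ne'
  refine hi.mono' ((continuous_const.sub ((continuous_kink k).pow 2)).aestronglyMeasurable)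
    (.of_forall fun x => ?_)
  have := kink_sq_lt_one k x
  rw [Real.norm_of_nonneg (by linarith), ← one_div, le_div_iff₀ (by positivity)]
  exact one_sub_kink_sq_mul_le k x

theorem integral_one_sub_kink_sq : ∫ x, (1 - kink k x ^ 2) = 2 / k := by
  have := integral_of_hasDerivAt_of_tendsto (hasDerivAt_kink k)
    ((integrable_one_sub_kink_sq hk).const_mul k) (tendsto_kink_atBot hk) (tendsto_kink_atTop hk)
  rw [integral_const_mul] at this
  field_simp
  linarith

/-- The profile, its derivative and the weights are compared with `1 - kink k x ^ 2`, whose integral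
is 2/k; this keeps the dependence of the L² bounds on `k` explicit. -/
theorem memLp_of_sq_le {f : ℝ → ℝ} (hf : Continuous f) {C : ℝ}
    (h : ∀ x, f x ^ 2 ≤ C * (1 - kink k x ^ 2)) : MemLp f 2 volume := by
  rw [memLp_two_iff_integrable_sq hf.aestronglyMeasurable]
  refine ((integrable_one_sub_kink_sq hk).const_mul C).mono' (hf.pow 2).aestronglyMeasurable
    (.of_forall fun x => ?_)
  rw [Real.norm_of_nonneg (sq_nonneg _)]
  exact h x

theorem integral_sq_le {f : ℝ → ℝ} (hf : Continuous f) {C : ℝ}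
    (h : ∀ x, f x ^ 2 ≤ C * (1 - kink k x ^ 2)) : ∫ x, f x ^ 2 ≤ C * (2 / k) := by
  rw [← integral_one_sub_kink_sq hk, ← integral_const_mul]
  exact integral_mono (memLp_of_sq_le hk hf h).integrable_sq
    ((integrable_one_sub_kink_sq hk).const_mul C) h

end

/-! ### The soliton profile -/

/-- `η_c` in terms of `k = √(2 - c²) / 2`. -/
noncomputable def prof (k x : ℝ) : ℝ := 2 * k ^ 2 * (1 - kink k x ^ 2)

/-- The derivative of `prof k`. -/
noncomputable def profDeriv (k x : ℝ) : ℝ := -2 * k * kink k x * prof k x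

/-- The second derivative of `prof k`. -/
noncomputable def profDeriv₂ (k x : ℝ) : ℝ := 4 * k ^ 2 * prof k x - 3 * prof k x ^ 2

/-- The density `1 - η_c`. -/
noncomputable def dens (k x : ℝ) : ℝ := 1 - prof k x

/-- The potential of the linearized operator `ε ↦ -(ε' / (4 (1 - η)))' + V ε`. -/
noncomputable def pot (k x : ℝ) : ℝ :=
  (4 * k ^ 2 - 6 * prof k x + 3 * prof k x ^ 2) / (4 * dens k x ^ 2)

/-- `(1 - η)⁻² - 1`. -/
noncomputable def excess (k x : ℝ) : ℝ := prof k x * (2 - prof k x) / dens k x ^ 2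

/-- The derivative of `η` with respect to the parameter `2 k²`. -/
noncomputable def scal (k x : ℝ) : ℝ := (1 - kink k x ^ 2) * (1 - k * x * kink k x)

/-- The derivative of `scal k`. -/
noncomputable def scalDeriv (k x : ℝ) : ℝ :=
  k * (1 - kink k x ^ 2) * (-3 * kink k x + k * x * (3 * kink k x ^ 2 - 1))

theorem prof_zero (k : ℝ) : prof k 0 = 2 * k ^ 2 := by simp [prof, kink_zero]
theorem profDeriv_zero (k : ℝ) : profDeriv k 0 = 0 := by simp [profDeriv, kink_zero]
theorem scal_zero (k : ℝ) : scal k 0 = 1 := by simp [scal, kink_zero]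
theorem prof_neg (k x : ℝ) : prof k (-x) = prof k x := by simp [prof, kink_neg]
theorem dens_neg (k x : ℝ) : dens k (-x) = dens k x := by simp [dens, prof_neg]
theorem pot_neg (k x : ℝ) : pot k (-x) = pot k x := by simp [pot, prof_neg, dens_neg]
theorem excess_neg (k x : ℝ) : excess k (-x) = excess k x := by simp [excess, prof_neg, dens_neg]
theorem profDeriv_neg (k x : ℝ) : profDeriv k (-x) = -profDeriv k x := by
  simp [profDeriv, prof_neg, kink_neg]
theorem hasDerivAt_prof (k x : ℝ) : HasDerivAt (prof k) (profDeriv k x) x := by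
  have h := (((hasDerivAt_kink k x).fun_pow 2).const_sub 1).const_mul (2 * k ^ 2)
  convert! h using 1
  unfold profDeriv prof
  push_cast
  ring

theorem hasDerivAt_profDeriv (k x : ℝ) : HasDerivAt (profDeriv k) (profDeriv₂ k x) x := by
  have h := ((hasDerivAt_kink k x).const_mul (-2 * k)).fun_mul (hasDerivAt_prof k x)
  convert! h using 1
  unfold profDeriv₂ profDeriv prof
  ring

theorem hasDerivAt_profDeriv₂ (k x : ℝ) :
    HasDerivAt (profDeriv₂ k) (4 * k ^ 2 * profDeriv k x - 6 * prof k x * profDeriv k x) x := by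
  have h := ((hasDerivAt_prof k x).const_mul (4 * k ^ 2)).fun_sub
    (((hasDerivAt_prof k x).fun_pow 2).const_mul 3)
  convert! h using 1
  push_cast
  ring

theorem hasDerivAt_dens (k x : ℝ) : HasDerivAt (dens k) (-profDeriv k x) x := by
  exact (hasDerivAt_prof k x).const_sub 1

theorem hasDerivAt_const_mul_self (k x : ℝ) : HasDerivAt (fun y : ℝ => k * y) k x := by
  simpa using (hasDerivAt_id x).const_mul k

theorem hasDerivAt_scal (k x : ℝ) : HasDerivAt (scal k) (scalDeriv k x) x := by
  have h := (((hasDerivAt_kink k x).fun_pow 2).const_sub 1).fun_mul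
    (((hasDerivAt_const_mul_self k x).fun_mul (hasDerivAt_kink k x)).const_sub 1)
  convert! h using 1
  unfold scalDeriv
  push_cast
  ring

theorem continuous_prof (k : ℝ) : Continuous (prof k) :=
  continuous_iff_continuousAt.2 fun x => (hasDerivAt_prof k x).continuousAt

theorem continuous_dens (k : ℝ) : Continuous (dens k) := continuous_const.sub (continuous_prof k)

theorem bddCont_prof (k : ℝ) : BddCont (prof k) :=
  ((BddCont.const 1).sub ((bddCont_kink k).pow 2)).const_mul (2 * k ^ 2)

theorem bddCont_profDeriv (k : ℝ) : BddCont (profDeriv k) :=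
  ((bddCont_kink k).const_mul (-2 * k)).mul (bddCont_prof k)

theorem bddCont_profDeriv₂ (k : ℝ) : BddCont (profDeriv₂ k) :=
  ((bddCont_prof k).const_mul (4 * k ^ 2)).sub (((bddCont_prof k).pow 2).const_mul 3)

theorem bddCont_dens (k : ℝ) : BddCont (dens k) := (BddCont.const 1).sub (bddCont_prof k)

theorem scal_sq_le (k x : ℝ) : scal k x ^ 2 ≤ 2 * (1 - kink k x ^ 2) := by
  have h1 := one_sub_kink_sq_mul_le k x
  have h2 := kink_sq_lt_one k x
  unfold scal
  set T := kink k x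
  set y := k * x
  have h3 : (1 - y * T) ^ 2 ≤ 2 * (1 + y ^ 2) := by
    have : y ^ 2 * T ^ 2 ≤ y ^ 2 * 1 := mul_le_mul_of_nonneg_left h2.le (sq_nonneg y)
    nlinarith [sq_nonneg (1 + y * T)]
  calc ((1 - T ^ 2) * (1 - y * T)) ^ 2 = (1 - T ^ 2) * ((1 - T ^ 2) * (1 - y * T) ^ 2) := by ring
    _ ≤ (1 - T ^ 2) * ((1 - T ^ 2) * (2 * (1 + y ^ 2))) := by gcongr
    _ = (1 - T ^ 2) * (2 * ((1 - T ^ 2) * (1 + y ^ 2))) := by ring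
    _ ≤ (1 - T ^ 2) * (2 * 1) := by gcongr
    _ = _ := by ring

theorem scalDeriv_sq_le (k x : ℝ) : scalDeriv k x ^ 2 ≤ 18 * k ^ 2 * (1 - kink k x ^ 2) := by
  have h1 := one_sub_kink_sq_mul_le k x
  have h2 := kink_sq_lt_one k x
  unfold scalDeriv
  set T := kink k x
  set y := k * x
  have h3 : (-3 * T + y * (3 * T ^ 2 - 1)) ^ 2 ≤ 18 * (1 + y ^ 2) := by
    have h4 : (3 * T ^ 2 - 1) ^ 2 ≤ 4 := by nlinarith [sq_nonneg T]
    have : y ^ 2 * (3 * T ^ 2 - 1) ^ 2 ≤ y ^ 2 * 4 := mul_le_mul_of_nonneg_left h4 (sq_nonneg y)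
    nlinarith [sq_nonneg (3 * T + y * (3 * T ^ 2 - 1)), sq_nonneg y]
  calc (k * (1 - T ^ 2) * (-3 * T + y * (3 * T ^ 2 - 1))) ^ 2
      = k ^ 2 * (1 - T ^ 2) * ((1 - T ^ 2) * (-3 * T + y * (3 * T ^ 2 - 1)) ^ 2) := by ring
    _ ≤ k ^ 2 * (1 - T ^ 2) * ((1 - T ^ 2) * (18 * (1 + y ^ 2))) := by
        gcongr
    _ = k ^ 2 * (1 - T ^ 2) * (18 * ((1 - T ^ 2) * (1 + y ^ 2))) := by ring
    _ ≤ k ^ 2 * (1 - T ^ 2) * (18 * 1) := by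
        gcongr
    _ = _ := by ring

theorem bddCont_of_sq_le {f : ℝ → ℝ} (hf : Continuous f) {k C : ℝ} (hC : 0 ≤ C)
    (h : ∀ x, f x ^ 2 ≤ C * (1 - kink k x ^ 2)) : BddCont f := by
  refine ⟨hf, √C, fun x => Real.abs_le_sqrt ((h x).trans ?_)⟩
  nlinarith [sq_nonneg (kink k x)]

theorem continuous_scal (k : ℝ) : Continuous (scal k) :=
  continuous_iff_continuousAt.2 fun x => (hasDerivAt_scal k x).continuousAt

theorem continuous_scalDeriv (k : ℝ) : Continuous (scalDeriv k) := by
  have := continuous_kink k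
  unfold scalDeriv
  fun_prop

theorem bddCont_scal (k : ℝ) : BddCont (scal k) :=
  bddCont_of_sq_le (continuous_scal k) (by norm_num) (scal_sq_le k)

theorem bddCont_scalDeriv (k : ℝ) : BddCont (scalDeriv k) :=
  bddCont_of_sq_le (continuous_scalDeriv k) (by positivity) (scalDeriv_sq_le k)

theorem sobolevPair_scal {k : ℝ} (hk : 0 < k) : SobolevPair (scal k) (scalDeriv k) :=
  .of_hasDerivAt (hasDerivAt_scal k) (continuous_scalDeriv k)
    (memLp_of_sq_le hk (continuous_scal k) (scal_sq_le k))
    (memLp_of_sq_le hk (continuous_scalDeriv k) (scalDeriv_sq_le k))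

theorem prof_nonneg (k x : ℝ) : 0 ≤ prof k x := by
  have := kink_sq_lt_one k x
  unfold prof
  exact mul_nonneg (by positivity) (by linarith)

theorem prof_le (k x : ℝ) : prof k x ≤ 2 * k ^ 2 := by
  unfold prof
  nlinarith [mul_nonneg (sq_nonneg k) (sq_nonneg (kink k x))]

theorem dens_le_one (k x : ℝ) : dens k x ≤ 1 := by
  have := prof_nonneg k x
  unfold dens
  linarith

/-! ### The linearized operator: translation mode, scaling mode, explicit integrals. -/

/-- `k` and `c` are related by `k = √(2 - c²) / 2`. -/
structure Admissible (k c : ℝ) : Prop where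
  pos : 0 < k
  ne_zero : c ≠ 0
  sq_eq : c ^ 2 = 2 - 4 * k ^ 2

namespace Admissible
variable {k c : ℝ} (h : Admissible k c)
include h

theorem sq_pos : 0 < c ^ 2 := by have := h.ne_zero; positivity

theorem two_mul_sq_lt : 2 * k ^ 2 < 1 := by
  have := h.sq_pos
  rw [h.sq_eq] at this
  linarith

theorem le_dens (x : ℝ) : c ^ 2 / 2 ≤ dens k x := by
  have := prof_le k x
  rw [h.sq_eq]
  unfold dens
  linarith

theorem dens_pos (x : ℝ) : 0 < dens k x :=
  (half_pos h.sq_pos).trans_le (h.le_dens x)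

theorem prof_lt_one (x : ℝ) : prof k x < 1 := by
  have := h.dens_pos x
  unfold dens at this
  linarith

theorem bddCont_div_dens {m : ℝ → ℝ} (hm : BddCont m) : BddCont fun x => m x / dens k x :=
  hm.div (continuous_dens k) (half_pos h.sq_pos) h.le_dens

theorem bddCont_div_dens_pow {m : ℝ → ℝ} (hm : BddCont m) (j : ℕ) :
    BddCont fun x => m x / dens k x ^ j :=
  hm.div ((continuous_dens k).pow j) (pow_pos (half_pos h.sq_pos) j)
    fun x => pow_le_pow_left₀ (half_pos h.sq_pos).le (h.le_dens x) j

theorem bddCont_pot : BddCont (pot k) := by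
  have h1 : BddCont fun x => (4 * k ^ 2 - 6 * prof k x + 3 * prof k x ^ 2) / 4 := by
    simpa [div_eq_inv_mul] using ((((BddCont.const (4 * k ^ 2)).sub
      ((bddCont_prof k).const_mul 6)).add (((bddCont_prof k).pow 2).const_mul 3)).const_mul 4⁻¹)
  refine (h.bddCont_div_dens_pow h1 2).congr fun x => ?_
  rw [pot, div_div]

theorem bddCont_excess : BddCont (excess k) :=
  h.bddCont_div_dens_pow ((bddCont_prof k).mul ((BddCont.const 2).sub (bddCont_prof k))) 2

theorem bddCont_inv_dens : BddCont fun x => 1 / (4 * dens k x) := by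
  simpa only [div_div] using h.bddCont_div_dens (BddCont.const (1 / 4))

theorem profDeriv_sq_le (x : ℝ) : profDeriv k x ^ 2 ≤ 1 * (1 - kink k x ^ 2) := by
  have h1 := kink_sq_lt_one k x
  have h2 := h.two_mul_sq_lt
  have e : profDeriv k x ^ 2
      = 2 * (2 * k ^ 2) * (2 * k ^ 2) ^ 2 * (kink k x ^ 2 * (1 - kink k x ^ 2)) * (1 - kink k x ^ 2) := by
    unfold profDeriv prof; ring
  rw [e]
  refine mul_le_mul_of_nonneg_right ?_ (by linarith)
  have h3 : kink k x ^ 2 * (1 - kink k x ^ 2) ≤ 1 / 4 := by nlinarith [sq_nonneg (kink k x ^ 2 - 1 / 2)]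
  have h4 : (2 * k ^ 2) ^ 2 ≤ 1 := by nlinarith [sq_nonneg k]
  have h5 : 2 * (2 * k ^ 2) * (2 * k ^ 2) ^ 2 ≤ 2 * 1 * 1 := by gcongr
  have h6 : 0 ≤ kink k x ^ 2 * (1 - kink k x ^ 2) := mul_nonneg (sq_nonneg _) (by linarith)
  calc _ ≤ 2 * 1 * 1 * (kink k x ^ 2 * (1 - kink k x ^ 2)) := mul_le_mul_of_nonneg_right h5 h6
    _ ≤ 1 := by linarith

theorem prof_sq_le (x : ℝ) : prof k x ^ 2 ≤ 1 * (1 - kink k x ^ 2) := by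
  have h1 := kink_sq_lt_one k x
  have h2 := h.two_mul_sq_lt
  have h3 := prof_nonneg k x
  have h4 : prof k x ≤ 1 - kink k x ^ 2 := by
    unfold prof
    nlinarith
  nlinarith [h.prof_lt_one x]

theorem memLp_prof : MemLp (prof k) 2 volume :=
  memLp_of_sq_le h.pos (continuous_prof k) h.prof_sq_le

theorem memLp_profDeriv : MemLp (profDeriv k) 2 volume :=
  memLp_of_sq_le h.pos (bddCont_profDeriv k).1 h.profDeriv_sq_le

theorem sobolevPair_profDeriv : SobolevPair (profDeriv k) (profDeriv₂ k) := by
  refine .of_hasDerivAt (hasDerivAt_profDeriv k) (bddCont_profDeriv₂ k).1 h.memLp_profDeriv ?_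
  have : profDeriv₂ k = fun x => (4 * k ^ 2 - 3 * prof k x) * prof k x := by
    funext x; unfold profDeriv₂; ring
  rw [this]
  exact ((BddCont.const _).sub ((bddCont_prof k).const_mul 3)).memLp_mul h.memLp_prof

theorem dens_ne_zero (x : ℝ) : dens k x ≠ 0 := (h.dens_pos x).ne'

/-- The translation mode solves the linearized equation. -/
theorem bddContDiff_kernel :
    BddContDiff (fun x => profDeriv₂ k x / (4 * dens k x)) fun x => pot k x * profDeriv k x where
  hasDerivAt x := by
    have ha := h.dens_ne_zero x
    have h1 := (hasDerivAt_profDeriv₂ k x).fun_div ((hasDerivAt_dens k x).const_mul 4)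
      (mul_ne_zero four_ne_zero ha)
    convert! h1 using 1
    have e1 : prof k x = 1 - dens k x := by unfold dens; ring
    unfold pot profDeriv₂
    rw [e1]
    field_simp
    ring
  bddCont := by
    refine (h.bddCont_inv_dens.mul (bddCont_profDeriv₂ k)).congr fun x => ?_
    ring
  bddCont_deriv := h.bddCont_pot.mul (bddCont_profDeriv k)

/-- The scaling mode solves the linearized equation with right-hand side `excess`. -/
theorem bddContDiff_scaling :
    BddContDiff (fun x => scalDeriv k x / (4 * dens k x))
      fun x => pot k x * scal k x + excess k x / 4 where
  hasDerivAt x := by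
    have ha := h.dens_ne_zero x
    have h0 := ((((hasDerivAt_kink k x).fun_pow 2).const_sub 1).const_mul k).fun_mul
      (((hasDerivAt_kink k x).const_mul (-3)).fun_add
        ((hasDerivAt_const_mul_self k x).fun_mul
          ((((hasDerivAt_kink k x).fun_pow 2).const_mul 3).sub_const 1)))
    have h1 := h0.fun_div ((hasDerivAt_dens k x).const_mul 4) (mul_ne_zero four_ne_zero ha)
    convert! h1 using 1
    unfold pot scal excess profDeriv
    rw [eq_div_iff (by positivity), add_mul]
    field_simp
    unfold dens prof
    push_cast
    ring
  bddCont := by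
    refine (h.bddCont_inv_dens.mul (bddCont_scalDeriv k)).congr fun x => ?_
    ring
  bddCont_deriv := by
    have h1 := (h.bddCont_pot.mul (bddCont_scal k)).add (h.bddCont_excess.const_mul 4⁻¹)
    simpa only [div_eq_inv_mul] using h1

/-- The mixed term of the Hessian density is φ (e²)' with this φ; adding φ' e² makes it a total
derivative with zero integral. -/
theorem bddContDiff_cross :
    BddContDiff (fun x => profDeriv k x / (4 * dens k x ^ 2))
      fun x => profDeriv₂ k x / (4 * dens k x ^ 2) + profDeriv k x ^ 2 / (2 * dens k x ^ 3) where
  hasDerivAt x := by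
    have ha := h.dens_ne_zero x
    have h1 := (hasDerivAt_profDeriv k x).fun_div (((hasDerivAt_dens k x).fun_pow 2).const_mul 4)
      (by positivity)
    convert! h1 using 1
    push_cast
    field_simp
    ring
  bddCont := by
    refine ((h.bddCont_div_dens_pow (bddCont_profDeriv k) 2).const_mul (1 / 4)).congr fun x => ?_
    ring
  bddCont_deriv := by
    refine (((h.bddCont_div_dens_pow (bddCont_profDeriv₂ k) 2).const_mul (1 / 4)).add
      ((h.bddCont_div_dens_pow ((bddCont_profDeriv k).pow 2) 3).const_mul (1 / 2))).congr
      fun x => ?_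
    ring

theorem memLp_div_dens {f : ℝ → ℝ} (hf : MemLp f 2 volume) :
    MemLp (fun x => f x / (4 * dens k x)) 2 volume := by
  refine (funext fun x => ?_ : (fun x => f x / (4 * dens k x)) = _) ▸
    h.bddCont_inv_dens.memLp_mul hf
  ring

theorem memLp_excess : MemLp (excess k) 2 volume := by
  refine (funext fun x => ?_ : excess k = _) ▸ (h.bddCont_div_dens_pow
    ((BddCont.const 2).sub (bddCont_prof k)) 2).memLp_mul h.memLp_prof
  unfold excess
  ring

theorem sobolevPair_kernel :
    SobolevPair (fun x => profDeriv₂ k x / (4 * dens k x)) fun x => pot k x * profDeriv k x :=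
  .of_hasDerivAt h.bddContDiff_kernel.hasDerivAt h.bddContDiff_kernel.bddCont_deriv.1
    (h.memLp_div_dens h.sobolevPair_profDeriv.memLp_deriv) (h.bddCont_pot.memLp_mul h.memLp_profDeriv)

theorem sobolevPair_scaling :
    SobolevPair (fun x => scalDeriv k x / (4 * dens k x))
      fun x => pot k x * scal k x + excess k x / 4 :=
  .of_hasDerivAt h.bddContDiff_scaling.hasDerivAt h.bddContDiff_scaling.bddCont_deriv.1
    (h.memLp_div_dens (sobolevPair_scal h.pos).memLp_deriv)
    ((h.bddCont_pot.memLp_mul (sobolevPair_scal h.pos).memLp).add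
      (by simpa [div_eq_inv_mul] using h.memLp_excess.const_mul 4⁻¹))

/-- As a function of η, (1-η)⁻² - 1 has the primitive (1-η)⁻¹ - 1 - η = η²/(1-η). -/
theorem hasDerivAt_prof_sq_div (x : ℝ) :
    HasDerivAt (fun x => prof k x ^ 2 / dens k x) (profDeriv k x * excess k x) x := by
  have ha := h.dens_ne_zero x
  have h1 := ((hasDerivAt_prof k x).fun_pow 2).fun_div (hasDerivAt_dens k x) ha
  convert! h1 using 1
  unfold excess
  push_cast
  field_simp
  unfold dens
  ring

theorem tendsto_prof_atTop : Tendsto (prof k) atTop (𝓝 0) := by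
  have := (((tendsto_kink_atTop h.pos).pow 2).const_sub 1).const_mul (2 * k ^ 2)
  norm_num at this
  exact this

theorem tendsto_prof_atBot : Tendsto (prof k) atBot (𝓝 0) := by
  have := (((tendsto_kink_atBot h.pos).pow 2).const_sub 1).const_mul (2 * k ^ 2)
  norm_num at this
  exact this

theorem integrable_profDeriv_mul_excess : Integrable fun x => profDeriv k x * excess k x :=
  integrable_of_memLp_mul h.memLp_profDeriv h.memLp_excess

theorem integral_Ioi_profDeriv_mul_excess :
    ∫ x in Ioi 0, profDeriv k x * excess k x = -(8 * k ^ 4 / c ^ 2) := by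
  have h1 : Tendsto (fun x => prof k x ^ 2 / dens k x) atTop (𝓝 0) := by
    have := (h.tendsto_prof_atTop.pow 2).div (h.tendsto_prof_atTop.const_sub 1) (by norm_num)
    norm_num at this
    exact this
  rw [integral_Ioi_of_hasDerivAt_of_tendsto' (fun x _ => h.hasDerivAt_prof_sq_div x)
    h.integrable_profDeriv_mul_excess.integrableOn h1]
  have h2 : dens k 0 = c ^ 2 / 2 := by rw [dens, prof_zero, h.sq_eq]; ring
  have := h.ne_zero
  rw [h2, prof_zero]
  field_simp
  ring

theorem integral_Ioi_profDeriv_sq : ∫ x in Ioi 0, profDeriv k x ^ 2 = 32 * k ^ 5 / 15 := by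
  have h1 : ∀ x, HasDerivAt (fun x => 16 * k ^ 5 * (kink k x ^ 3 / 3 - kink k x ^ 5 / 5))
      (profDeriv k x ^ 2) x := by
    intro x
    have h0 := hasDerivAt_kink k x
    have h2 := (((h0.fun_pow 3).div_const 3).fun_sub ((h0.fun_pow 5).div_const 5)).const_mul (16 * k ^ 5)
    convert! h2 using 1
    unfold profDeriv prof
    push_cast
    ring
  have hT := tendsto_kink_atTop h.pos
  have h2 : Tendsto (fun x => 16 * k ^ 5 * (kink k x ^ 3 / 3 - kink k x ^ 5 / 5)) atTop
      (𝓝 (16 * k ^ 5 * (1 ^ 3 / 3 - 1 ^ 5 / 5))) :=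
    (((hT.pow 3).div_const 3).sub ((hT.pow 5).div_const 5)).const_mul _
  rw [integral_Ioi_of_hasDerivAt_of_tendsto' (fun x _ => h1 x)
    h.memLp_profDeriv.integrable_sq.integrableOn h2, kink_zero]
  ring

theorem integrable_excess_mul_scal : Integrable fun x => excess k x * scal k x :=
  integrable_of_memLp_mul h.memLp_excess (sobolevPair_scal h.pos).memLp

theorem integrable_prof_sq_div : Integrable fun x => prof k x ^ 2 / dens k x := by
  refine ((h.bddCont_div_dens (BddCont.const 1)).integrable_mul_mul h.memLp_prof
    h.memLp_prof).congr (.of_forall fun x => ?_)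
  simp only
  ring

/-- The positivity of `d/dc P(Q_c)`. -/
theorem integral_excess_mul_scal_sub :
    ∫ x, (c ^ 2 * (excess k x * scal k x) - prof k x ^ 2 / dens k x) = 8 * k := by
  have hk := h.pos
  -- Since `scal` is (η + xη'/2)/(2k²) and η' · `excess` = (η²/(1-η))', integrating the part with
  -- the factor x by parts gives the first term of the primitive. What remains integrates to a
  -- rational function of `kink`, whose limits ±4k at ±∞ give the value 8k.
  have hd : ∀ x, HasDerivAt (fun x => c ^ 2 / (4 * k ^ 2) * (x * (prof k x ^ 2 / dens k x))
      + (kink k x / dens k x - (1 - 4 * k ^ 2) * kink k x) / k)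
      (c ^ 2 * (excess k x * scal k x) - prof k x ^ 2 / dens k x) x := by
    intro x
    have ha := h.dens_ne_zero x
    have h0 := hasDerivAt_kink k x
    have h1 := (((hasDerivAt_id' x).fun_mul (h.hasDerivAt_prof_sq_div x)).const_mul
      (c ^ 2 / (4 * k ^ 2))).fun_add
      (((h0.fun_div (hasDerivAt_dens k x) ha).fun_sub (h0.const_mul (1 - 4 * k ^ 2))).div_const k)
    convert! h1 using 1
    rw [h.sq_eq]
    unfold excess profDeriv scal
    field_simp
    unfold dens prof
    ring
  have hx : BddCont fun x => x * (1 - kink k x ^ 2) := by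
    refine bddCont_of_sq_le (k := k) (C := 1 / k ^ 2) ?_ (by positivity) fun x => ?_
    · exact continuous_id.mul (continuous_const.sub ((continuous_kink k).pow 2))
    · have h1 := one_sub_kink_sq_mul_le k x
      have h2 := kink_sq_lt_one k x
      rw [div_mul_eq_mul_div, le_div_iff₀ (by positivity)]
      have h3 : (1 - kink k x ^ 2) * (k * x) ^ 2 ≤ 1 := by nlinarith
      nlinarith
  have hlim : ∀ {l : Filter ℝ} {s : ℝ}, Tendsto (prof k) l (𝓝 0) → Tendsto (kink k) l (𝓝 s) →
      Tendsto (fun x => c ^ 2 / (4 * k ^ 2) * (x * (prof k x ^ 2 / dens k x))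
        + (kink k x / dens k x - (1 - 4 * k ^ 2) * kink k x) / k) l (𝓝 (4 * k * s)) := by
    intro l s hl hs
    have hdens : Tendsto (dens k) l (𝓝 1) := by
      have := hl.const_sub 1
      rwa [sub_zero] at this
    have h1 : Tendsto (fun x => x * (prof k x ^ 2 / dens k x)) l (𝓝 0) := by
      obtain ⟨-, C, hC⟩ := h.bddCont_div_dens (hx.const_mul (2 * k ^ 2))
      have h2 : Tendsto (fun x => C * |prof k x|) l (𝓝 0) := by simpa using hl.abs.const_mul C
      refine squeeze_zero_norm (fun x => ?_) h2
      have e : x * (prof k x ^ 2 / dens k x)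
          = 2 * k ^ 2 * (x * (1 - kink k x ^ 2)) / dens k x * prof k x := by
        unfold prof; ring
      rw [e, norm_mul]
      exact mul_le_mul_of_nonneg_right (hC x) (abs_nonneg _)
    have h2 := (h1.const_mul (c ^ 2 / (4 * k ^ 2))).add
      (((hs.div hdens one_ne_zero).sub (hs.const_mul (1 - 4 * k ^ 2))).div_const k)
    convert! h2 using 2
    field_simp
    ring
  rw [integral_of_hasDerivAt_of_tendsto hd
    ((h.integrable_excess_mul_scal.const_mul _).sub h.integrable_prof_sq_div)
    (hlim h.tendsto_prof_atBot (tendsto_kink_atBot hk))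
    (hlim h.tendsto_prof_atTop (tendsto_kink_atTop hk))]
  ring

end Admissible

/-! ### Coercivity on half-lines by Riccati functions. -/

/-- A regular solution on `x ≠ 0` of the Riccati equation associated with the translation mode. -/
noncomputable def ricc (k x : ℝ) : ℝ := k * (1 / kink k x - 3 * kink k x) / (4 * dens k x)

theorem contDiff_kink (k : ℝ) : ContDiff ℝ 1 (kink k) := by
  rw [contDiff_one_iff_deriv]
  refine ⟨fun x => (hasDerivAt_kink k x).differentiableAt, ?_⟩
  rw [show deriv (kink k) = _ from funext fun x => (hasDerivAt_kink k x).deriv]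
  exact continuous_const.mul (continuous_const.sub ((continuous_kink k).pow 2))

theorem contDiff_dens (k : ℝ) : ContDiff ℝ 1 (dens k) :=
  contDiff_const.sub (contDiff_const.mul (contDiff_const.sub ((contDiff_kink k).pow 2)))

/-- The energy density of the linearized operator. -/
noncomputable def linDensity (k : ℝ) (u du : ℝ → ℝ) (x : ℝ) : ℝ :=
  du x ^ 2 / (4 * dens k x) + pot k x * u x ^ 2

namespace Admissible
variable {k c : ℝ} (h : Admissible k c)
include h

/-- `ricc` is p/η' with p = η''/(4(1-η)). The translation mode equation reads p' = Vη', and dividing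
by η' gives φ' = V - 4(1-η)φ². The only singularity is the zero of η' at the origin. -/
theorem hasDerivAt_ricc {x : ℝ} (hx : kink k x ≠ 0) :
    HasDerivAt (ricc k) (pot k x - 4 * dens k x * ricc k x ^ 2) x := by
  have ha := h.dens_ne_zero x
  have h0 := hasDerivAt_kink k x
  have h1 := ((((hasDerivAt_const x (1 : ℝ)).fun_div h0 hx).fun_sub (h0.const_mul 3)).const_mul
    k).fun_div ((hasDerivAt_dens k x).const_mul 4) (mul_ne_zero four_ne_zero ha)
  convert! h1 using 1
  unfold pot ricc profDeriv
  field_simp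
  unfold dens prof
  ring

theorem contDiffOn_ricc {s : Set ℝ} (hs : ∀ x ∈ s, kink k x ≠ 0) : ContDiffOn ℝ 1 (ricc k) s :=
  (contDiffOn_const.mul ((contDiffOn_const.div (contDiff_kink k).contDiffOn hs).sub
    (contDiffOn_const.mul (contDiff_kink k).contDiffOn))).div
    (contDiffOn_const.mul (contDiff_dens k).contDiffOn)
    fun x _ => mul_ne_zero four_ne_zero (h.dens_ne_zero x)

theorem integrable_linDensity {u du : ℝ → ℝ} (hu : SobolevPair u du) :
    Integrable (linDensity k u du) := by
  refine ((h.bddCont_inv_dens.integrable_mul_mul hu.memLp_deriv hu.memLp_deriv).add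
    (h.bddCont_pot.integrable_mul_mul hu.memLp hu.memLp)).congr (.of_forall fun x => ?_)
  simp only [linDensity, Pi.add_apply]
  ring

/-- Completing the square with a function `φ` that satisfies a Riccati inequality. -/
theorem le_intervalIntegral_linDensity {u du : ℝ → ℝ} (hu : SobolevPair u du) {φ dφ : ℝ → ℝ}
    {a b m : ℝ} (hab : a ≤ b) (hφ : ContDiffOn ℝ 1 φ (uIcc a b))
    (hd : ∀ x ∈ uIcc a b, HasDerivAt φ (dφ x) x)
    (hm : ∀ x ∈ Icc a b, m ≤ pot k x - dφ x - 4 * dens k x * φ x ^ 2) :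
    φ b * u b ^ 2 - φ a * u a ^ 2 ≤ ∫ x in a..b, (linDensity k u du x - m * u x ^ 2) := by
  have h1 := hu.integral_deriv_mul_mul hu hφ hd
  have hac := hφ.absolutelyContinuousOnInterval.fun_mul
    ((hu.absolutelyContinuous a b).fun_mul (hu.absolutelyContinuous a b))
  -- `φ` is controlled on `[a, b]` only, because `ricc` has a pole at 0; integrability comes from
  -- absolute continuity of φu² there.
  have hint : IntervalIntegrable
      (fun x => dφ x * (u x * u x) + φ x * (du x * u x + u x * du x)) volume a b := by
    refine hac.intervalIntegrable_deriv.congr_ae ?_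
    rw [EventuallyEq, ae_restrict_iff' measurableSet_uIoc]
    filter_upwards [hu.ae_hasDerivAt] with x h1 h3
    exact ((hd x (uIoc_subset_uIcc h3)).mul (h1.mul h1)).deriv
  rw [show φ b * u b ^ 2 - φ a * u a ^ 2 = φ b * (u b * u b) - φ a * (u a * u a) by ring, ← h1]
  refine intervalIntegral.integral_mono_on hab hint
    ((h.integrable_linDensity hu).sub (hu.memLp.integrable_sq.const_mul m)).intervalIntegrable
    fun x hx => ?_
  have ha := h.dens_pos x
  have h2 := mul_le_mul_of_nonneg_right (hm x hx) (sq_nonneg (u x))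
  -- The density minus m u² and minus (φu²)' is this square plus the term made nonnegative by `hm`.
  have h3 : 0 ≤ (du x - 4 * dens k x * φ x * u x) ^ 2 / (4 * dens k x) := by positivity
  have h4 : (du x - 4 * dens k x * φ x * u x) ^ 2 / (4 * dens k x)
      = du x ^ 2 / (4 * dens k x) - 2 * φ x * u x * du x + 4 * dens k x * φ x ^ 2 * u x ^ 2 := by
    field_simp
    ring
  unfold linDensity
  nlinarith

/-- At log 2/k one has T = tanh = 3/5, a rational value just beyond the zero T = 1/√3 of η''. From
there on 4(1-η) · `ricc` = k(1/T - 3T) ≤ -2k/15, so raising `ricc` by δ = k/30 leaves the surplus 2δ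
· 2k/15 - 4δ² = k²/225. -/
theorem coercive_outer {u du : ℝ → ℝ} (hu : SobolevPair u du)
    (h0 : u (Real.log 2 / k) = 0) :
    0 ≤ ∫ x in Ioi (Real.log 2 / k), (linDensity k u du x - k ^ 2 / 225 * u x ^ 2) := by
  set x₀ := Real.log 2 / k with hx₀
  have hk := h.pos
  have hT : ∀ x, x₀ ≤ x → 3 / 5 ≤ kink k x := fun x hx => by
    rw [← kink_log_two_div hk]
    exact (kink_strictMono hk).monotone hx
  have hint := (h.integrable_linDensity hu).sub (hu.memLp.integrable_sq.const_mul (k ^ 2 / 225))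
  have hlim : Tendsto (fun x => (ricc k x + k / 30) * u x ^ 2) atTop (𝓝 0) := by
    have h1 : Tendsto (fun x => ricc k x + k / 30) atTop
        (𝓝 (k * (1 / 1 - 3 * 1) / (4 * (1 - 0)) + k / 30)) := by
      have hT := tendsto_kink_atTop hk
      exact ((((tendsto_const_nhds.div hT one_ne_zero).sub (hT.const_mul 3)).const_mul k).div
        ((h.tendsto_prof_atTop.const_sub 1).const_mul 4) (by norm_num)).add_const _
    simpa using h1.mul (hu.tendsto_atTop.pow 2)
  refine le_of_tendsto_of_tendsto hlim
    (intervalIntegral_tendsto_integral_Ioi x₀ hint.integrableOn tendsto_id) ?_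
  filter_upwards [eventually_ge_atTop x₀] with b hb
  have hne : ∀ x ∈ uIcc x₀ b, kink k x ≠ 0 := fun x hx => by
    rw [uIcc_of_le hb] at hx
    have := hT x hx.1
    positivity
  have key := h.le_intervalIntegral_linDensity hu (φ := fun x => ricc k x + k / 30)
    (m := k ^ 2 / 225) hb ((h.contDiffOn_ricc hne).add contDiffOn_const)
    (fun x hx => (h.hasDerivAt_ricc (hne x hx)).add_const _) ?_
  · simpa [h0] using key
  intro x hx
  have ht := hT x hx.1
  have ha := h.dens_pos x
  have ha' := dens_le_one k x
  have e : 4 * dens k x * ricc k x = k * (1 / kink k x - 3 * kink k x) := by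
    unfold ricc; field_simp
  have e2 : pot k x - (pot k x - 4 * dens k x * ricc k x ^ 2)
      - 4 * dens k x * (ricc k x + k / 30) ^ 2
      = -2 * (k / 30) * (4 * dens k x * ricc k x) - 4 * dens k x * (k / 30) ^ 2 := by ring
  rw [e2, e]
  have h3 : 1 / kink k x - 3 * kink k x ≤ -(2 / 15) := by
    have : 1 / kink k x ≤ 1 / (3 / 5) := one_div_le_one_div_of_le (by norm_num) ht
    linarith
  have h4 := mul_le_mul_of_nonneg_left h3 (sq_nonneg k)
  have h5 := mul_le_mul_of_nonneg_left ha' (sq_nonneg k)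
  nlinarith

/-- Here `ricc` is lowered by kT/30: the factor T compensates the pole of `ricc` at 0. The
derivative of the correction contributes k²(1 - T²)/30, which for T ≤ 3/5 outweighs the possibly
negative term k²(1 - 3T²)/15 and the quadratic one. -/
theorem coercive_inner {u du : ℝ → ℝ} (hu : SobolevPair u du) (h00 : u 0 = 0)
    (h0 : u (Real.log 2 / k) = 0) :
    0 ≤ ∫ x in (0)..(Real.log 2 / k), (linDensity k u du x - k ^ 2 / 225 * u x ^ 2) := by
  have hk := h.pos
  have hx₀ : 0 < Real.log 2 / k := div_pos (Real.log_pos (by norm_num)) hk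
  have hx₁ := kink_log_two_div hk
  set x₀ := Real.log 2 / k
  have hint := (h.integrable_linDensity hu).sub (hu.memLp.integrable_sq.const_mul (k ^ 2 / 225))
  have hlim1 : Tendsto (fun a => ∫ x in a..x₀, (linDensity k u du x - k ^ 2 / 225 * u x ^ 2))
      (𝓝[>] 0) (𝓝 (∫ x in (0)..x₀, (linDensity k u du x - k ^ 2 / 225 * u x ^ 2))) := by
    have hc := (intervalIntegral.continuous_primitive (fun a b => hint.intervalIntegrable (a := a) (b := b)) x₀).neg
    have := (hc.tendsto 0).mono_left (nhdsWithin_le_nhds (s := Ioi 0))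
    simp_rw [fun a => intervalIntegral.integral_symm (μ := volume) (f := fun x =>
      linDensity k u du x - k ^ 2 / 225 * u x ^ 2) x₀ a]
    exact this
  -- A bound for the boundary term at a → 0⁺: `ricc k a` is of order 1/T(a), while u(0) = 0 gives
  -- u(a)² ≤ a ∫₀ᵃ u'². As a/T(a) → 1/k, the term vanishes in the limit.
  have hlim2 : Tendsto (fun a => -(k / (2 * c ^ 2)) * ((∫ x in (0)..a, du x ^ 2) * (a / kink k a)))
      (𝓝[>] 0) (𝓝 0) := by
    have hc := intervalIntegral.continuous_primitive
      (fun a b => hu.memLp_deriv.integrable_sq.intervalIntegrable (a := a) (b := b)) 0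
    have h1 := (hc.tendsto 0).mono_left (nhdsWithin_le_nhds (s := Ioi 0))
    have h2 : Tendsto (fun a => a / kink k a) (𝓝[>] 0) (𝓝 k⁻¹) := by
      have h3 := (hasDerivAt_kink k 0).tendsto_slope_zero_right
      simp only [zero_add, kink_zero, sub_zero, smul_eq_mul, ne_eq, OfNat.ofNat_ne_zero,
        not_false_eq_true, zero_pow, mul_one] at h3
      refine (h3.inv₀ hk.ne').congr fun a => ?_
      rw [mul_inv, inv_inv, div_eq_mul_inv]
    rw [intervalIntegral.integral_same] at h1
    simpa using (h1.mul h2).const_mul (-(k / (2 * c ^ 2)))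
  refine le_of_tendsto_of_tendsto hlim2 hlim1 ?_
  filter_upwards [Ioo_mem_nhdsGT hx₀] with a ha
  have hpos : ∀ x ∈ uIcc a x₀, 0 < kink k x := fun x hx => by
    rw [uIcc_of_le ha.2.le] at hx
    exact kink_pos hk (ha.1.trans_le hx.1)
  have key := h.le_intervalIntegral_linDensity hu (φ := fun x => ricc k x - k / 30 * kink k x)
    (m := k ^ 2 / 225) ha.2.le ((h.contDiffOn_ricc fun x hx => (hpos x hx).ne').sub
      (contDiffOn_const.mul (contDiff_kink k).contDiffOn))
    (fun x hx => (h.hasDerivAt_ricc (hpos x hx).ne').sub ((hasDerivAt_kink k x).const_mul _)) ?_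
  · refine le_trans ?_ key
    rw [h0]
    have hTa := hpos a left_mem_uIcc
    have hda := h.le_dens a
    have hdp := h.dens_pos a
    have hc := h.sq_pos
    have h1 : ricc k a - k / 30 * kink k a ≤ k / (2 * c ^ 2) / kink k a := by
      have h2 : ricc k a ≤ k * (1 / kink k a) / (4 * dens k a) := by
        unfold ricc
        gcongr
        linarith
      have h3 : k * (1 / kink k a) / (4 * dens k a) ≤ k * (1 / kink k a) / (2 * c ^ 2) := by
        refine div_le_div_of_nonneg_left (by positivity) (by positivity) (by linarith)
      have h4 : 0 ≤ k / 30 * kink k a := by positivity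
      have e : k * (1 / kink k a) / (2 * c ^ 2) = k / (2 * c ^ 2) / kink k a := by ring
      linarith
    have h2 : u a ^ 2 ≤ a * ∫ x in (0)..a, du x ^ 2 := by
      have := hu.sq_sub_le ha.1
      rwa [h00, sub_zero, sub_zero, ← intervalIntegral.integral_of_le ha.1.le] at this
    have h3 : (ricc k a - k / 30 * kink k a) * u a ^ 2
        ≤ k / (2 * c ^ 2) / kink k a * (a * ∫ x in (0)..a, du x ^ 2) :=
      (mul_le_mul_of_nonneg_right h1 (sq_nonneg _)).trans
        (mul_le_mul_of_nonneg_left h2 (by positivity))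
    have e : k / (2 * c ^ 2) / kink k a * (a * ∫ x in (0)..a, du x ^ 2)
        = k / (2 * c ^ 2) * ((∫ x in (0)..a, du x ^ 2) * (a / kink k a)) := by ring
    linarith
  intro x hx
  have hTx := hpos x (by rwa [uIcc_of_le ha.2.le])
  have ht : kink k x ≤ 3 / 5 := by
    rw [← hx₁]
    exact (kink_strictMono hk).monotone hx.2
  have ha := h.dens_pos x
  have ha' := dens_le_one k x
  have e : 4 * dens k x * ricc k x * kink k x = k * (1 - 3 * kink k x ^ 2) := by
    unfold ricc; field_simp
  have e2 : pot k x - (pot k x - 4 * dens k x * ricc k x ^ 2 - k / 30 * (k * (1 - kink k x ^ 2)))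
      - 4 * dens k x * (ricc k x - k / 30 * kink k x) ^ 2
      = k / 30 * (k * (1 - kink k x ^ 2)) + 2 * (k / 30) * (4 * dens k x * ricc k x * kink k x)
        - 4 * dens k x * (k / 30) ^ 2 * kink k x ^ 2 := by ring
  rw [e2, e]
  have h3 : kink k x ^ 2 ≤ 9 / 25 := by nlinarith
  have h5 : dens k x * kink k x ^ 2 ≤ 1 * (9 / 25) := by gcongr
  have h6 := mul_le_mul_of_nonneg_left h5 (sq_nonneg k)
  have h7 := mul_le_mul_of_nonneg_left h3 (sq_nonneg k)
  nlinarith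

theorem coercive_of_two_zeros {u du : ℝ → ℝ} (hu : SobolevPair u du) (h00 : u 0 = 0)
    (h0 : u (Real.log 2 / k) = 0) :
    k ^ 2 / 225 * ∫ x in Ioi 0, u x ^ 2 ≤ ∫ x in Ioi 0, linDensity k u du x := by
  have hx₀ : 0 < Real.log 2 / k := div_pos (Real.log_pos (by norm_num)) h.pos
  have hsq := hu.memLp.integrable_sq.const_mul (k ^ 2 / 225)
  have hint := (h.integrable_linDensity hu).sub hsq
  have h1 := h.coercive_outer hu h0
  have h2 := h.coercive_inner hu h00 h0
  have h3 : _ = ∫ x in Ioi 0, (linDensity k u du x - k ^ 2 / 225 * u x ^ 2) :=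
    intervalIntegral.integral_interval_add_Ioi (a := 0) (b := Real.log 2 / k)
      hint.integrableOn hint.integrableOn
  have h4 : ∫ x in Ioi 0, (linDensity k u du x - k ^ 2 / 225 * u x ^ 2) = _ :=
    integral_sub (h.integrable_linDensity hu).integrableOn hsq.integrableOn
  rw [integral_const_mul] at h4
  linarith

/-- Testing the equation of η' against u and against η' leaves boundary terms at 0 only; these
vanish because u(0) = η'(0) = 0. -/
theorem integral_Ioi_linDensity_add_kernel {u du : ℝ → ℝ} (hu : SobolevPair u du) (h00 : u 0 = 0)
    (r : ℝ) :
    ∫ x in Ioi 0, linDensity k (fun y => u y - r * profDeriv k y) (fun y => du y - r * profDeriv₂ k y) x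
      = ∫ x in Ioi 0, linDensity k u du x := by
  have h1 := h.sobolevPair_kernel.integral_Ioi_deriv_mul hu 0
  have h2 := h.sobolevPair_kernel.integral_Ioi_deriv_mul h.sobolevPair_profDeriv 0
  rw [h00, mul_zero, neg_zero] at h1
  rw [profDeriv_zero, mul_zero, neg_zero] at h2
  have i1 := (h.sobolevPair_kernel.integrable_deriv_mul hu).integrableOn (s := Ioi 0)
  have i2 := (h.sobolevPair_kernel.integrable_deriv_mul h.sobolevPair_profDeriv).integrableOn
    (s := Ioi 0)
  have i0 := (h.integrable_linDensity hu).integrableOn (s := Ioi 0)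
  have e : ∀ x, linDensity k (fun y => u y - r * profDeriv k y) (fun y => du y - r * profDeriv₂ k y) x
      = linDensity k u du x - 2 * r * (pot k x * profDeriv k x * u x
        + profDeriv₂ k x / (4 * dens k x) * du x) + r ^ 2 * (pot k x * profDeriv k x * profDeriv k x
        + profDeriv₂ k x / (4 * dens k x) * profDeriv₂ k x) := by
    intro x
    unfold linDensity
    ring
  simp_rw [e]
  have i3 : IntegrableOn (fun x => linDensity k u du x - 2 * r * (pot k x * profDeriv k x * u x
        + profDeriv₂ k x / (4 * dens k x) * du x)) (Ioi 0) := i0.sub (i1.const_mul _)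
  rw [integral_add i3 (i2.const_mul _), integral_sub i0 (i1.const_mul _), integral_const_mul,
    integral_const_mul, h1, h2]
  ring

/-- Coercivity of the linearized operator on a half-line, up to the translation mode, for functions
that vanish at the origin. -/
theorem exists_coercive_Ioi {u du : ℝ → ℝ} (hu : SobolevPair u du) (h00 : u 0 = 0) :
    ∃ r, k ^ 2 / 225 * ∫ x in Ioi 0, (u x - r * profDeriv k x) ^ 2
      ≤ ∫ x in Ioi 0, linDensity k u du x := by
  refine ⟨u (Real.log 2 / k) / profDeriv k (Real.log 2 / k), ?_⟩
  rw [← h.integral_Ioi_linDensity_add_kernel hu h00]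
  refine h.coercive_of_two_zeros (hu.sub_const_mul h.sobolevPair_profDeriv _) ?_ ?_
  · rw [h00, profDeriv_zero, mul_zero, sub_zero]
  · have : profDeriv k (Real.log 2 / k) ≠ 0 := by
      have := h.pos
      unfold profDeriv prof
      rw [kink_log_two_div h.pos]
      norm_num
      exact this.ne'
    rw [div_mul_cancel₀ _ this, sub_self]

theorem exists_coercive_Iic {u du : ℝ → ℝ} (hu : SobolevPair u du) (h00 : u 0 = 0) :
    ∃ r, k ^ 2 / 225 * ∫ x in Iic 0, (u x - r * profDeriv k x) ^ 2
      ≤ ∫ x in Iic 0, linDensity k u du x := by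
  obtain ⟨r, hr⟩ := h.exists_coercive_Ioi hu.comp_neg (by simpa using h00)
  -- Reflection reverses the sign of the odd mode η'.
  refine ⟨-r, ?_⟩
  have e1 := integral_comp_neg_Ioi 0 fun x => (u x - -r * profDeriv k x) ^ 2
  have e2 := integral_comp_neg_Ioi 0 (linDensity k u du)
  rw [neg_zero] at e1 e2
  rw [← e1, ← e2]
  simp only [profDeriv_neg, linDensity, dens_neg, pot_neg, neg_sq] at hr ⊢
  simpa using hr

end Admissible

/-! ### Splitting off the scaling mode; the two orthogonality conditions. -/

/-- The Cauchy-Schwarz inequality for integrals. -/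
theorem sq_integral_mul_le {μ : Measure ℝ} {f g : ℝ → ℝ} (hf : MemLp f 2 μ) (hg : MemLp g 2 μ) :
    (∫ x, f x * g x ∂μ) ^ 2 ≤ (∫ x, f x ^ 2 ∂μ) * ∫ x, g x ^ 2 ∂μ := by
  have i1 : Integrable (fun x => f x * g x) μ := hf.integrable_mul hg
  have key : ∀ t : ℝ, 0 ≤ (∫ x, g x ^ 2 ∂μ) * (t * t) + (2 * ∫ x, f x * g x ∂μ) * t
      + ∫ x, f x ^ 2 ∂μ := by
    intro t
    have h0 : 0 ≤ ∫ x, (t ^ 2 * g x ^ 2 + 2 * t * (f x * g x) + f x ^ 2) ∂μ :=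
      integral_nonneg fun x => by
        have : t ^ 2 * g x ^ 2 + 2 * t * (f x * g x) + f x ^ 2 = (t * g x + f x) ^ 2 := by ring
        simp only [this]
        positivity
    have i2 : Integrable (fun x => t ^ 2 * g x ^ 2 + 2 * t * (f x * g x)) μ :=
      (hg.integrable_sq.const_mul _).add (i1.const_mul _)
    rw [integral_add i2 hf.integrable_sq, integral_add (hg.integrable_sq.const_mul _)
      (i1.const_mul _), integral_const_mul, integral_const_mul] at h0
    linarith
  have := discrim_le_zero key
  unfold discrim at this
  nlinarith

theorem setIntegral_sq_le {f : ℝ → ℝ} (hf : MemLp f 2 volume) (s : Set ℝ) :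
    ∫ x in s, f x ^ 2 ≤ ∫ x, f x ^ 2 :=
  setIntegral_le_integral hf.integrable_sq (.of_forall fun _ => sq_nonneg _)

theorem integral_Iic_add_Ioi_zero {f : ℝ → ℝ} (hf : Integrable f) :
    (∫ x in Iic 0, f x) + ∫ x in Ioi 0, f x = ∫ x, f x :=
  intervalIntegral.integral_Iic_add_Ioi hf.integrableOn hf.integrableOn

theorem integral_eq_zero_of_odd {f : ℝ → ℝ} (hf : ∀ x, f (-x) = -f x) : ∫ x, f x = 0 := by
  have h1 := integral_neg_eq_self f volume
  simp_rw [hf, integral_neg] at h1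
  linarith

/-- The velocity of the soliton in terms of `k = √(2 - c²) / 2`. -/
noncomputable def velProf (k c x : ℝ) : ℝ := -(c * prof k x) / (2 * dens k x)

/-- The density of the quadratic form `E''(Q_c) + c P''(Q_c)`. -/
noncomputable def hessDensity (k c : ℝ) (e de w : ℝ → ℝ) (x : ℝ) : ℝ :=
  de x ^ 2 / (4 * dens k x) + profDeriv k x * (de x * e x) / (2 * dens k x ^ 2)
    + profDeriv k x ^ 2 * e x ^ 2 / (4 * dens k x ^ 3) + e x ^ 2 / 2
    + dens k x * w x ^ 2 - 2 * velProf k c x * (e x * w x) + c * (e x * w x)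

/-- The part of `e` that remains after subtraction of the scaling mode, normalized at the origin. -/
noncomputable def modPart (k : ℝ) (e : ℝ → ℝ) (x : ℝ) : ℝ := e x - e 0 * scal k x

/-- The derivative of `modPart k e`. -/
noncomputable def modPartDeriv (k : ℝ) (e de : ℝ → ℝ) (x : ℝ) : ℝ := de x - e 0 * scalDeriv k x

/-- The square completed velocity after subtraction of the scaling mode. -/
noncomputable def modVel (k c : ℝ) (e w : ℝ → ℝ) (x : ℝ) : ℝ :=
  w x + c * e x / (2 * dens k x ^ 2) - e 0 * prof k x / (2 * c * dens k x)

/-- The weight of the orthogonality condition. -/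
noncomputable def orthWeight (k c x : ℝ) : ℝ := profDeriv k x * (1 + c ^ 2 / (4 * dens k x ^ 4))

theorem modPart_zero (k : ℝ) (e : ℝ → ℝ) : modPart k e 0 = 0 := by
  simp [modPart, scal_zero]

namespace Admissible
variable {k c : ℝ} (h : Admissible k c)
include h

/-- The right-hand side is the coefficient of e² produced by completing the square in the velocity
and integrating the mixed term by parts. The explicit formulas for η' and η'' reduce it to `pot`. -/
theorem pot_eq (x : ℝ) : pot k x = 1 / 2 - c ^ 2 / (4 * dens k x ^ 3)
    - profDeriv₂ k x / (4 * dens k x ^ 2) - profDeriv k x ^ 2 / (4 * dens k x ^ 3) := by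
  have ha := h.dens_ne_zero x
  rw [h.sq_eq]
  unfold pot profDeriv₂ profDeriv
  field_simp
  unfold dens prof
  ring

theorem excess_eq (x : ℝ) : excess k x = 1 / dens k x ^ 2 - 1 := by
  have ha := h.dens_ne_zero x
  unfold excess
  field_simp
  unfold dens
  ring

theorem bddCont_velProf : BddCont (velProf k c) :=
  (h.bddCont_div_dens ((bddCont_prof k).const_mul (-c / 2))).congr fun x => by
    unfold velProf; ring

theorem memLp_velProf : MemLp (velProf k c) 2 volume := by
  refine (funext fun x => ?_ : velProf k c = _) ▸
    (h.bddCont_div_dens (BddCont.const (-c / 2))).memLp_mul h.memLp_prof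
  unfold velProf; ring

theorem bddCont_orthFactor : BddCont fun x => 1 + c ^ 2 / (4 * dens k x ^ 4) :=
  ((BddCont.const 1).add (h.bddCont_div_dens_pow (BddCont.const (c ^ 2 / 4)) 4)).congr fun x => by
    simp only [div_div]

theorem memLp_orthWeight : MemLp (orthWeight k c) 2 volume := by
  refine (funext fun x => ?_ : orthWeight k c = _) ▸
    h.bddCont_orthFactor.memLp_mul h.memLp_profDeriv
  unfold orthWeight; ring

theorem continuous_orthWeight : Continuous (orthWeight k c) :=
  (bddCont_profDeriv k).1.mul h.bddCont_orthFactor.1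

/-- Every correction to the two nonnegative densities has a known integral. The first is a total
derivative; the next two are the scaling mode equation tested against `modPart` and `scal`, so they
integrate to zero as well. The one with factor e(0)/c is the momentum constraint, and the last one
gives 2k e(0)²/c² by `integral_excess_mul_scal_sub`. -/
theorem hessDensity_eq (e de w : ℝ → ℝ) (x : ℝ) : hessDensity k c e de w x =
    linDensity k (modPart k e) (modPartDeriv k e de) x + dens k x * modVel k c e w x ^ 2
    + ((profDeriv₂ k x / (4 * dens k x ^ 2) + profDeriv k x ^ 2 / (2 * dens k x ^ 3)) * (e x * e x)
        + profDeriv k x / (4 * dens k x ^ 2) * (de x * e x + e x * de x))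
    + 2 * e 0 * ((pot k x * scal k x + excess k x / 4) * modPart k e x
        + scalDeriv k x / (4 * dens k x) * modPartDeriv k e de x)
    + e 0 ^ 2 * ((pot k x * scal k x + excess k x / 4) * scal k x
        + scalDeriv k x / (4 * dens k x) * scalDeriv k x)
    + e 0 / c * (prof k x * w x + velProf k c x * e x)
    + e 0 ^ 2 / (4 * c ^ 2) * (c ^ 2 * (excess k x * scal k x) - prof k x ^ 2 / dens k x) := by
  have ha := h.dens_ne_zero x
  have hc := h.ne_zero
  have e1 : prof k x = 1 - dens k x := by unfold dens; ring
  unfold hessDensity linDensity modPart modPartDeriv modVel velProf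
  rw [h.pot_eq, h.excess_eq, e1]
  field_simp
  ring

section Functions

variable {e de w : ℝ → ℝ} (he : SobolevPair e de) (hw : MemLp w 2 volume)
include he

theorem sobolevPair_modPart : SobolevPair (modPart k e) (modPartDeriv k e de) :=
  he.sub_const_mul (sobolevPair_scal h.pos) _

include hw

theorem memLp_modVel : MemLp (modVel k c e w) 2 volume := by
  have h1 := (h.bddCont_div_dens_pow (BddCont.const (c / 2)) 2).memLp_mul he.memLp
  have h2 := (h.bddCont_div_dens (BddCont.const (e 0 / (2 * c)))).memLp_mul h.memLp_prof
  refine (funext fun x => ?_ : modVel k c e w = _) ▸ (hw.add h1).sub h2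
  simp only [modVel, Pi.sub_apply, Pi.add_apply]
  ring

theorem integrable_hessDensity : Integrable (hessDensity k c e de w) := by
  have i1 := h.bddCont_inv_dens.integrable_mul_mul he.memLp_deriv he.memLp_deriv
  have i2 := (h.bddCont_div_dens_pow ((bddCont_profDeriv k).const_mul (1 / 2)) 2).integrable_mul_mul
    he.memLp_deriv he.memLp
  have i3 := (h.bddCont_div_dens_pow (((bddCont_profDeriv k).pow 2).const_mul (1 / 4))
    3).integrable_mul_mul he.memLp he.memLp
  have i4 := (BddCont.const (1 / 2)).integrable_mul_mul he.memLp he.memLp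
  have i5 := (bddCont_dens k).integrable_mul_mul hw hw
  have i6 := ((h.bddCont_velProf.const_mul (-2)).add (BddCont.const c)).integrable_mul_mul
    he.memLp hw
  refine (((((i1.add i2).add i3).add i4).add i5).add i6).congr (.of_forall fun x => ?_)
  simp only [Pi.add_apply, hessDensity]
  ring

/-- The quadratic form as a sum of nonnegative terms. -/
theorem integral_hessDensity (hP : ∫ x, (prof k x * w x + velProf k c x * e x) = 0) :
    ∫ x, hessDensity k c e de w x =
      (∫ x, linDensity k (modPart k e) (modPartDeriv k e de) x)
        + (∫ x, dens k x * modVel k c e w x ^ 2) + 2 * k * e 0 ^ 2 / c ^ 2 := by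
  have hu := h.sobolevPair_modPart he
  have hy := h.memLp_modVel he hw
  have hs := sobolevPair_scal h.pos
  have i1 := h.integrable_linDensity hu
  have i2 : Integrable fun x => dens k x * modVel k c e w x ^ 2 :=
    ((bddCont_dens k).integrable_mul_mul hy hy).congr (.of_forall fun x => by ring)
  have i3 := he.integrable_deriv_mul_mul he h.bddContDiff_cross
  have i4 := h.sobolevPair_scaling.integrable_deriv_mul hu
  have i5 := h.sobolevPair_scaling.integrable_deriv_mul hs
  have i6 : Integrable fun x => prof k x * w x + velProf k c x * e x :=
    (integrable_of_memLp_mul h.memLp_prof hw).add (integrable_of_memLp_mul h.memLp_velProf he.memLp)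
  have i7 : Integrable fun x => c ^ 2 * (excess k x * scal k x) - prof k x ^ 2 / dens k x :=
    (h.integrable_excess_mul_scal.const_mul _).sub h.integrable_prof_sq_div
  simp_rw [h.hessDensity_eq e de w]
  have j2 := i1.add i2
  have j3 := j2.add i3
  have j4 := j3.add (i4.const_mul (2 * e 0))
  have j5 := j4.add (i5.const_mul (e 0 ^ 2))
  have j6 := j5.add (i6.const_mul (e 0 / c))
  refine (integral_add j6 (i7.const_mul _)).trans ?_
  rw [integral_add' j5 (i6.const_mul _), integral_add' j4 (i5.const_mul _),
    integral_add' j3 (i4.const_mul _), integral_add' j2 i3, integral_add' i1 i2]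
  simp only [integral_const_mul]
  rw [hP, h.integral_excess_mul_scal_sub, he.integral_deriv_mul_mul_eq_zero he h.bddContDiff_cross,
    h.sobolevPair_scaling.integral_deriv_mul_eq_zero hu,
    h.sobolevPair_scaling.integral_deriv_mul_eq_zero hs]
  have := h.ne_zero
  field_simp
  ring

/-- The momentum constraint in the variables (`modPart`, `modVel`). The weight `excess` is even, so
it detects the part of `modPart` proportional to |η'|. -/
theorem integral_modPart_mul_excess (hP : ∫ x, (prof k x * w x + velProf k c x * e x) = 0) :
    c ^ 2 * ∫ x, modPart k e x * excess k x
      = 2 * c * (∫ x, prof k x * modVel k c e w x) - 8 * k * e 0 := by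
  have hc := h.ne_zero
  have i1 := integrable_of_memLp_mul h.memLp_prof (h.memLp_modVel he hw)
  have i2 := integrable_of_memLp_mul (h.sobolevPair_modPart he).memLp h.memLp_excess
  have i7 : Integrable fun x => c ^ 2 * (excess k x * scal k x) - prof k x ^ 2 / dens k x :=
    (h.integrable_excess_mul_scal.const_mul _).sub h.integrable_prof_sq_div
  have e1 : ∀ x, prof k x * w x + velProf k c x * e x
      = prof k x * modVel k c e w x - c / 2 * (modPart k e x * excess k x)
        - e 0 / (2 * c) * (c ^ 2 * (excess k x * scal k x) - prof k x ^ 2 / dens k x) := by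
    intro x
    have ha := h.dens_ne_zero x
    have e1 : prof k x = 1 - dens k x := by unfold dens; ring
    unfold modVel velProf modPart
    rw [h.excess_eq, e1]
    field_simp
    ring
  simp_rw [e1] at hP
  have j : Integrable fun x => prof k x * modVel k c e w x - c / 2 * (modPart k e x * excess k x) :=
    i1.sub (i2.const_mul _)
  rw [integral_sub j (i7.const_mul _), integral_sub i1 (i2.const_mul _), integral_const_mul,
    integral_const_mul, h.integral_excess_mul_scal_sub] at hP
  field_simp at hP
  linarith

/-- Orthogonality to ∂ₓQ_c in the same variables. The contribution of e(0) drops out because the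
scaling mode is even and ∂ₓQ_c is odd. -/
theorem integral_modPart_mul_orthWeight
    (hO : ∫ x, (e x * profDeriv k x - c / 2 * (profDeriv k x / dens k x ^ 2 * w x)) = 0) :
    ∫ x, modPart k e x * orthWeight k c x
      = c / 2 * ∫ x, profDeriv k x / dens k x ^ 2 * modVel k c e w x := by
  have hc := h.ne_zero
  have hm : MemLp (fun x => profDeriv k x / dens k x ^ 2) 2 volume := by
    refine (funext fun x => ?_ : (fun x => profDeriv k x / dens k x ^ 2) = _) ▸
      (h.bddCont_div_dens_pow (BddCont.const 1) 2).memLp_mul h.memLp_profDeriv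
    ring
  have i1 := integrable_of_memLp_mul (h.sobolevPair_modPart he).memLp h.memLp_orthWeight
  have i2 := integrable_of_memLp_mul hm (h.memLp_modVel he hw)
  have i3 : Integrable fun x => scal k x * orthWeight k c x
      - profDeriv k x / dens k x ^ 2 * (prof k x / (4 * dens k x)) :=
    (integrable_of_memLp_mul (sobolevPair_scal h.pos).memLp h.memLp_orthWeight).sub
      (integrable_of_memLp_mul hm (h.memLp_div_dens h.memLp_prof))
  have h3 : ∫ x, (scal k x * orthWeight k c x
      - profDeriv k x / dens k x ^ 2 * (prof k x / (4 * dens k x))) = 0 := by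
    refine integral_eq_zero_of_odd fun x => ?_
    simp only [scal, orthWeight, kink_neg, profDeriv_neg, dens_neg, prof_neg]
    ring
  have e1 : ∀ x, e x * profDeriv k x - c / 2 * (profDeriv k x / dens k x ^ 2 * w x)
      = modPart k e x * orthWeight k c x - c / 2 * (profDeriv k x / dens k x ^ 2 * modVel k c e w x)
        + e 0 * (scal k x * orthWeight k c x
          - profDeriv k x / dens k x ^ 2 * (prof k x / (4 * dens k x))) := by
    intro x
    have ha := h.dens_ne_zero x
    unfold modVel modPart orthWeight
    field_simp
    ring
  simp_rw [e1] at hO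
  have j : Integrable fun x => modPart k e x * orthWeight k c x
      - c / 2 * (profDeriv k x / dens k x ^ 2 * modVel k c e w x) := i1.sub (i2.const_mul _)
  rw [integral_add j (i3.const_mul _), integral_sub i1 (i2.const_mul _), integral_const_mul,
    integral_const_mul, h3] at hO
  linarith

end Functions

end Admissible

/-! ### Quantitative coercivity with explicit constants. -/

theorem add_three_sq_le (a b c : ℝ) : (a + b + c) ^ 2 ≤ 3 * (a ^ 2 + b ^ 2 + c ^ 2) := by
  nlinarith [sq_nonneg (a - b), sq_nonneg (a - c), sq_nonneg (b - c)]

theorem add_four_sq_le (a b c d : ℝ) :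
    (a + b + c + d) ^ 2 ≤ 4 * (a ^ 2 + b ^ 2 + c ^ 2 + d ^ 2) := by
  nlinarith [sq_nonneg (a - b), sq_nonneg (a - c), sq_nonneg (a - d), sq_nonneg (b - c),
    sq_nonneg (b - d), sq_nonneg (c - d)]

/-- `h1` (momentum) determines r₁ - r₂ and `h2` (orthogonality) determines r₁ + r₂ up to the
pairings `sᵢ`, whose squares are at most B²H. Removing the factors k⁸ and k¹⁰ from the squares costs
B⁸ and B¹⁰ by 1 ≤ Bk, whence the powers B¹⁰ and B¹². -/
theorem kernel_coefficients_le {k c B H α r₁ r₂ N s₁ s₂ s₃ s₄ s₅ s₆ : ℝ} (hB : 1 ≤ B) (hk : 0 < k)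
    (hk1 : k ≤ 1) (hBk : 1 ≤ B * k) (hc2 : c ^ 2 ≤ 2) (hH : 0 ≤ H) (hN : 2 * k ^ 5 ≤ N)
    (h1 : c ^ 2 * (s₁ + s₂) - 8 * k ^ 4 * (r₁ - r₂) = 2 * c * s₃ - 8 * k * α)
    (h2 : s₅ + s₆ + (r₁ + r₂) * N = c / 2 * s₄)
    (hs₁ : s₁ ^ 2 ≤ B ^ 2 * H) (hs₂ : s₂ ^ 2 ≤ B ^ 2 * H) (hs₃ : s₃ ^ 2 ≤ B ^ 2 * H)
    (hs₄ : s₄ ^ 2 ≤ B ^ 2 * H) (hs₅ : s₅ ^ 2 ≤ B ^ 2 * H) (hs₆ : s₆ ^ 2 ≤ B ^ 2 * H)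
    (hα : α ^ 2 ≤ B * H) : r₁ ^ 2 ≤ 4 * B ^ 12 * H ∧ r₂ ^ 2 ≤ 4 * B ^ 12 * H := by
  have hB2 : B * H ≤ B ^ 2 * H := by nlinarith [mul_nonneg (sub_nonneg.2 hB) hH]
  have hQ : 0 ≤ B ^ 2 * H := by positivity
  set Q := B ^ 2 * H with hQd
  have hc0 := sq_nonneg c
  have hk2 : k ^ 2 ≤ 1 := by nlinarith
  have hBk0 : 0 ≤ B * k := by linarith
  have ha : (r₁ - r₂) ^ 2 ≤ 5 * B ^ 10 * H := by
    have e : 8 * k ^ 4 * (r₁ - r₂) = c ^ 2 * s₁ + c ^ 2 * s₂ - 2 * c * s₃ + 8 * k * α := by linarith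
    have h3 := add_four_sq_le (c ^ 2 * s₁) (c ^ 2 * s₂) (-(2 * c * s₃)) (8 * k * α)
    rw [← sub_eq_add_neg, ← e, neg_sq] at h3
    have hc4 : (c ^ 2) ^ 2 ≤ 4 := by nlinarith
    have t1 : (c ^ 2 * s₁) ^ 2 ≤ 4 * Q := by
      rw [mul_pow]; exact mul_le_mul hc4 hs₁ (sq_nonneg _) (by norm_num)
    have t2 : (c ^ 2 * s₂) ^ 2 ≤ 4 * Q := by
      rw [mul_pow]; exact mul_le_mul hc4 hs₂ (sq_nonneg _) (by norm_num)
    have t3 : (2 * c * s₃) ^ 2 ≤ 8 * Q := by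
      rw [mul_pow]; exact mul_le_mul (by rw [mul_pow]; linarith) hs₃ (sq_nonneg _) (by norm_num)
    have t4 : (8 * k * α) ^ 2 ≤ 64 * Q := by
      rw [mul_pow]; exact mul_le_mul (by rw [mul_pow]; linarith) (hα.trans hB2) (sq_nonneg _) (by norm_num)
    have h4 : k ^ 8 * (r₁ - r₂) ^ 2 ≤ 5 * Q := by
      have e' : (8 * k ^ 4 * (r₁ - r₂)) ^ 2 = 64 * (k ^ 8 * (r₁ - r₂) ^ 2) := by ring
      linarith
    have h5 : (r₁ - r₂) ^ 2 ≤ (B * k) ^ 8 * (r₁ - r₂) ^ 2 :=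
      le_mul_of_one_le_left (sq_nonneg _) (one_le_pow₀ hBk)
    calc (r₁ - r₂) ^ 2 ≤ B ^ 8 * (k ^ 8 * (r₁ - r₂) ^ 2) := by rw [mul_pow] at h5; linarith
      _ ≤ B ^ 8 * (5 * Q) := by gcongr
      _ = _ := by rw [hQd]; ring
  have hb : (r₁ + r₂) ^ 2 ≤ 2 * B ^ 12 * H := by
    have e : (r₁ + r₂) * N = c / 2 * s₄ - s₅ - s₆ := by linarith
    have h3 := add_three_sq_le (c / 2 * s₄) (-s₅) (-s₆)
    rw [← sub_eq_add_neg, ← sub_eq_add_neg, ← e, neg_sq, neg_sq] at h3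
    have t1 : (c / 2 * s₄) ^ 2 ≤ 1 / 2 * Q := by
      rw [mul_pow]; exact mul_le_mul (by rw [div_pow]; linarith) hs₄ (sq_nonneg _) (by norm_num)
    have hN2 : (2 * k ^ 5) ^ 2 ≤ N ^ 2 := by gcongr
    have h4 : k ^ 10 * (r₁ + r₂) ^ 2 ≤ 2 * Q := by
      have h6 := mul_le_mul_of_nonneg_left hN2 (sq_nonneg (r₁ + r₂))
      rw [← mul_pow _ N] at h6
      have e' : (r₁ + r₂) ^ 2 * (2 * k ^ 5) ^ 2 = 4 * (k ^ 10 * (r₁ + r₂) ^ 2) := by ring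
      linarith
    have h5 : (r₁ + r₂) ^ 2 ≤ (B * k) ^ 10 * (r₁ + r₂) ^ 2 :=
      le_mul_of_one_le_left (sq_nonneg _) (one_le_pow₀ hBk)
    calc (r₁ + r₂) ^ 2 ≤ B ^ 10 * (k ^ 10 * (r₁ + r₂) ^ 2) := by rw [mul_pow] at h5; linarith
      _ ≤ B ^ 10 * (2 * Q) := by gcongr
      _ = _ := by rw [hQd]; ring
  have hc : 5 * B ^ 10 * H ≤ 5 * B ^ 12 * H := by
    gcongr
    norm_num
  have hd : 0 ≤ B ^ 12 * H := by positivity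
  have he : (r₁ - r₂) ^ 2 + (r₁ + r₂) ^ 2 = 2 * r₁ ^ 2 + 2 * r₂ ^ 2 := by ring
  constructor <;> linarith [sq_nonneg r₁, sq_nonneg r₂]

namespace Admissible
variable {k c : ℝ} (h : Admissible k c)
include h

theorem le_one : k ≤ 1 := by
  have := h.two_mul_sq_lt
  nlinarith

theorem sq_le_two : c ^ 2 ≤ 2 := by
  rw [h.sq_eq]
  nlinarith [sq_nonneg k]

section Bounds
variable {M : ℝ} (hM : 1 ≤ M) (hk : 1 ≤ M * k) (hc : 1 ≤ M * c ^ 2)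

include hc in
theorem inv_dens_le (hM : 1 ≤ M) (x : ℝ) : 1 / dens k x ≤ 2 * M := by
  rw [div_le_iff₀ (h.dens_pos x)]
  have := mul_le_mul_of_nonneg_left (h.le_dens x) (by linarith : 0 ≤ 2 * M)
  linarith

include hk in
theorem integral_sq_le_of_weight {f : ℝ → ℝ} (hf : Continuous f) {C : ℝ} (hC : 0 ≤ C)
    (hfC : ∀ x, f x ^ 2 ≤ C * (1 - kink k x ^ 2)) : ∫ x, f x ^ 2 ≤ 2 * C * M := by
  refine (integral_sq_le h.pos hf hfC).trans ?_
  have : 2 / k ≤ 2 * M := by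
    rw [div_le_iff₀ h.pos]
    linarith
  nlinarith

include hM hk hc

theorem integral_excess_sq_le : ∫ x, excess k x ^ 2 ≤ 128 * M ^ 5 := by
  have := h.integral_sq_le_of_weight hk (f := excess k) (C := 64 * M ^ 4) h.bddCont_excess.1
    (by positivity) fun x => ?_
  · linarith
  have h1 := h.prof_sq_le x
  have h2 := h.inv_dens_le hc hM x
  have h3 := h.dens_pos x
  have h4 := prof_nonneg k x
  have h5 := h.prof_lt_one x
  have e : excess k x ^ 2 = (2 - prof k x) ^ 2 * (1 / dens k x) ^ 4 * prof k x ^ 2 := by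
    unfold excess; field_simp
  rw [e]
  have h6 : (2 - prof k x) ^ 2 ≤ 2 ^ 2 := by gcongr; linarith; linarith
  calc _ ≤ 2 ^ 2 * (2 * M) ^ 4 * (1 * (1 - kink k x ^ 2)) := by gcongr
    _ = _ := by ring

theorem integral_profDeriv_div_sq_le : ∫ x, (profDeriv k x / dens k x ^ 2) ^ 2 ≤ 32 * M ^ 5 := by
  have := h.integral_sq_le_of_weight hk (f := fun x => profDeriv k x / dens k x ^ 2)
    (C := 16 * M ^ 4) (h.bddCont_div_dens_pow (bddCont_profDeriv k) 2).1 (by positivity) fun x => ?_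
  · linarith
  have h1 := h.profDeriv_sq_le x
  have h2 := h.inv_dens_le hc hM x
  have h3 := h.dens_pos x
  have e : (profDeriv k x / dens k x ^ 2) ^ 2 = (1 / dens k x) ^ 4 * profDeriv k x ^ 2 := by
    field_simp
  simp only [e]
  calc _ ≤ (2 * M) ^ 4 * (1 * (1 - kink k x ^ 2)) := by gcongr
    _ = _ := by ring

theorem integral_orthWeight_sq_le : ∫ x, orthWeight k c x ^ 2 ≤ 162 * M ^ 9 := by
  have := h.integral_sq_le_of_weight hk (f := orthWeight k c)
    (C := 81 * M ^ 8) h.continuous_orthWeight (by positivity) fun x => ?_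
  · linarith
  have h1 := h.profDeriv_sq_le x
  have h2 := h.inv_dens_le hc hM x
  have h3 := h.dens_pos x
  have h4 := h.sq_le_two
  have e : orthWeight k c x ^ 2
      = (1 + c ^ 2 / 4 * (1 / dens k x) ^ 4) ^ 2 * profDeriv k x ^ 2 := by
    unfold orthWeight; field_simp
  rw [e]
  have h5 : c ^ 2 / 4 * (1 / dens k x) ^ 4 ≤ 2 / 4 * (2 * M) ^ 4 := by gcongr
  have h6 : 1 ≤ M ^ 4 := one_le_pow₀ hM
  have h7 : 1 + c ^ 2 / 4 * (1 / dens k x) ^ 4 ≤ 9 * M ^ 4 := by linarith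
  calc _ ≤ (9 * M ^ 4) ^ 2 * (1 * (1 - kink k x ^ 2)) := by gcongr
    _ = _ := by ring

end Bounds

/-- Before any integration by parts, the Hessian density is a sum of two squares plus a bounded
multiple of e². This recovers the derivative, which the half-line estimates do not control. -/
theorem deriv_sq_le_hessDensity {M B : ℝ} (hM : 1 ≤ M) (hc : 1 ≤ M * c ^ 2) (hB3 : 4 * M ^ 3 ≤ B)
  (hBM : 4 * M ^ 2 ≤ B) (e de w : ℝ → ℝ) (x : ℝ) :
  de x ^ 2 ≤ 8 * hessDensity k c e de w x + 10 * B * e x ^ 2 := by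
  have hc2 := h.sq_le_two
  have ha := h.dens_pos x
  have ha1 := dens_le_one k x
  have hinv := h.inv_dens_le hc hM x
  have e1 : hessDensity k c e de w x = (de x + profDeriv k x / dens k x * e x) ^ 2 / (4 * dens k x)
      + e x ^ 2 / 2 - c ^ 2 / 4 * (1 / dens k x) ^ 3 * e x ^ 2
      + dens k x * (w x + c * e x / (2 * dens k x ^ 2)) ^ 2 := by
    have e1 : prof k x = 1 - dens k x := by unfold dens; ring
    unfold hessDensity velProf
    rw [e1]
    field_simp
    ring
  have h1 : (de x + profDeriv k x / dens k x * e x) ^ 2 / 4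
      ≤ (de x + profDeriv k x / dens k x * e x) ^ 2 / (4 * dens k x) :=
    div_le_div_of_nonneg_left (sq_nonneg _) (by positivity) (by linarith)
  have h2 : c ^ 2 / 4 * (1 / dens k x) ^ 3 ≤ B := by
    calc _ ≤ 2 / 4 * (2 * M) ^ 3 := by gcongr
      _ = 4 * M ^ 3 := by ring
      _ ≤ B := hB3
  have h3 : (profDeriv k x / dens k x) ^ 2 ≤ B := by
    have : profDeriv k x ^ 2 ≤ 1 := by
      have := h.profDeriv_sq_le x
      nlinarith [sq_nonneg (kink k x)]
    calc (profDeriv k x / dens k x) ^ 2 = profDeriv k x ^ 2 * (1 / dens k x) ^ 2 := by ring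
      _ ≤ 1 * (2 * M) ^ 2 := by gcongr
      _ = 4 * M ^ 2 := by ring
      _ ≤ B := hBM
  have h4 : 0 ≤ dens k x * (w x + c * e x / (2 * dens k x ^ 2)) ^ 2 := by positivity
  have h5 := mul_le_mul_of_nonneg_right h2 (sq_nonneg (e x))
  have h6 := mul_le_mul_of_nonneg_right h3 (sq_nonneg (e x))
  rw [e1]
  rw [← mul_pow] at h6
  have h7 : 0 ≤ e x ^ 2 := sq_nonneg _
  generalize profDeriv k x / dens k x * e x = z at *
  generalize (de x + z) ^ 2 / (4 * dens k x) = s at *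
  have h8 : de x ^ 2 ≤ 8 * ((de x + z) ^ 2 / 4) + 2 * z ^ 2 := by
    nlinarith [sq_nonneg (de x + 2 * z)]
  linarith

theorem vel_sq_le {M B : ℝ} (hM : 1 ≤ M) (hc : 1 ≤ M * c ^ 2) (hB4 : 8 * M ^ 4 ≤ B)
  (hB3 : M ^ 3 ≤ B) (e w : ℝ → ℝ) (x : ℝ) :
  w x ^ 2 ≤ 3 * modVel k c e w x ^ 2 + 3 * e 0 ^ 2 * B * prof k x ^ 2 + 3 * B * e x ^ 2 := by
  have hc2 := h.sq_le_two
  have hc0 := h.sq_pos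
  have hcne := h.ne_zero
  have ha := h.dens_pos x
  have hinv := h.inv_dens_le hc hM x
  have e1 : w x = modVel k c e w x + e 0 * (prof k x / (2 * c * dens k x))
      - c / (2 * dens k x ^ 2) * e x := by
    unfold modVel; ring
  have hci : 1 / c ^ 2 ≤ M := by rw [div_le_iff₀ hc0]; exact hc
  have h1 : (prof k x / (2 * c * dens k x)) ^ 2 ≤ B * prof k x ^ 2 := by
    calc (prof k x / (2 * c * dens k x)) ^ 2
        = 1 / 4 * (1 / c ^ 2) * (1 / dens k x) ^ 2 * prof k x ^ 2 := by field_simp; ring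
      _ ≤ 1 / 4 * M * (2 * M) ^ 2 * prof k x ^ 2 := by gcongr
      _ = M ^ 3 * prof k x ^ 2 := by ring
      _ ≤ B * prof k x ^ 2 := by gcongr
  have h2 : (c / (2 * dens k x ^ 2)) ^ 2 ≤ B := by
    calc (c / (2 * dens k x ^ 2)) ^ 2 = c ^ 2 / 4 * (1 / dens k x) ^ 4 := by field_simp; ring
      _ ≤ 2 / 4 * (2 * M) ^ 4 := by gcongr
      _ = 8 * M ^ 4 := by ring
      _ ≤ B := hB4
  have h3 := mul_le_mul_of_nonneg_left h1 (sq_nonneg (e 0))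
  have h4 := mul_le_mul_of_nonneg_right h2 (sq_nonneg (e x))
  set y := modVel k c e w x
  set p := prof k x / (2 * c * dens k x)
  set q := c / (2 * dens k x ^ 2)
  have h5 := add_three_sq_le y (e 0 * p) (-(q * e x))
  rw [← sub_eq_add_neg, ← e1, neg_sq, mul_pow, mul_pow] at h5
  linarith

/-- Coercivity of the quadratic form, with a constant that depends only on lower bounds for `k` and
`c ^ 2`. -/
theorem coercive {M : ℝ} (hM : 1 ≤ M) (hk : 1 ≤ M * k) (hc : 1 ≤ M * c ^ 2) {e de w : ℝ → ℝ}
    (he : SobolevPair e de) (hw : MemLp w 2 volume)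
    (hP : ∫ x, (prof k x * w x + velProf k c x * e x) = 0)
    (hO : ∫ x, (e x * profDeriv k x - c / 2 * (profDeriv k x / dens k x ^ 2 * w x)) = 0) :
    (∫ x, e x ^ 2) + (∫ x, de x ^ 2) + ∫ x, w x ^ 2
      ≤ 600 * (1000 * M ^ 9) ^ 14 * ∫ x, hessDensity k c e de w x := by
  set H := ∫ x, hessDensity k c e de w x with hH
  -- The worst weight is `orthWeight`, with squared norm at most 162 M⁹; the factor 1000 covers the
  -- other numerical constants.
  set B := 1000 * M ^ 9 with hBd
  have hM9 : 1 ≤ M ^ 9 := one_le_pow₀ hM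
  have hpow : ∀ j ≤ 9, M ^ j ≤ M ^ 9 := fun j hj => pow_le_pow_right₀ hM hj
  have hMB : M ≤ M ^ 9 := le_self_pow₀ hM (by norm_num)
  have hB : 1 ≤ B := by linarith
  have hk0 := h.pos
  have hc0 := h.sq_pos
  have hcne := h.ne_zero
  have hc2 := h.sq_le_two
  have hu := h.sobolevPair_modPart he
  have hy := h.memLp_modVel he hw
  have hs := sobolevPair_scal hk0
  obtain ⟨r₁, hr₁⟩ := h.exists_coercive_Ioi hu (modPart_zero k e)
  obtain ⟨r₂, hr₂⟩ := h.exists_coercive_Iic hu (modPart_zero k e)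
  have hρ₁ := (hu.sub_const_mul h.sobolevPair_profDeriv r₁).memLp
  have hρ₂ := (hu.sub_const_mul h.sobolevPair_profDeriv r₂).memLp
  set ρ₁ := fun x => modPart k e x - r₁ * profDeriv k x with hρ₁d
  set ρ₂ := fun x => modPart k e x - r₂ * profDeriv k x with hρ₂d
  have hL := integral_Iic_add_Ioi_zero (h.integrable_linDensity hu)
  have hHeq := h.integral_hessDensity he hw hP
  rw [← hH] at hHeq
  have n₁ : 0 ≤ ∫ x in Ioi 0, ρ₁ x ^ 2 := integral_nonneg fun _ => sq_nonneg _
  have n₂ : 0 ≤ ∫ x in Iic 0, ρ₂ x ^ 2 := integral_nonneg fun _ => sq_nonneg _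
  have n₃ : 0 ≤ ∫ x, modVel k c e w x ^ 2 := integral_nonneg fun _ => sq_nonneg _
  have n₄ : 0 ≤ 2 * k * e 0 ^ 2 / c ^ 2 := by positivity
  have hvel : c ^ 2 / 2 * (∫ x, modVel k c e w x ^ 2) ≤ ∫ x, dens k x * modVel k c e w x ^ 2 := by
    rw [← integral_const_mul]
    refine integral_mono (hy.integrable_sq.const_mul _)
      (((bddCont_dens k).integrable_mul_mul hy hy).congr (.of_forall fun x => by ring)) fun x => ?_
    exact mul_le_mul_of_nonneg_right (h.le_dens x) (sq_nonneg _)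
  have n₅ : 0 ≤ c ^ 2 / 2 * (∫ x, modVel k c e w x ^ 2) := by positivity
  have n₆ : 0 ≤ k ^ 2 / 225 * ∫ x in Ioi 0, ρ₁ x ^ 2 := by positivity
  have n₇ : 0 ≤ k ^ 2 / 225 * ∫ x in Iic 0, ρ₂ x ^ 2 := by positivity
  have hH0 : 0 ≤ H := by linarith
  have hM2 : M ^ 2 ≤ M ^ 9 := hpow 2 (by norm_num)
  have hk2 : 1 ≤ M ^ 2 * k ^ 2 := by rw [← mul_pow]; exact one_le_pow₀ hk
  have big : ∀ {X : ℝ}, 0 ≤ X → k ^ 2 / 225 * X ≤ H → X ≤ B * H := by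
    intro X hX hXH
    calc X ≤ M ^ 2 * k ^ 2 * X := le_mul_of_one_le_left hX hk2
      _ = 225 * M ^ 2 * (k ^ 2 / 225 * X) := by ring
      _ ≤ 225 * M ^ 2 * H := by gcongr
      _ ≤ B * H := by gcongr; linarith
  have b₁ : ∫ x in Ioi 0, ρ₁ x ^ 2 ≤ B * H := big n₁ (by linarith)
  have b₂ : ∫ x in Iic 0, ρ₂ x ^ 2 ≤ B * H := big n₂ (by linarith)
  have b₃ : ∫ x, modVel k c e w x ^ 2 ≤ B * H := by
    calc _ ≤ M * c ^ 2 * ∫ x, modVel k c e w x ^ 2 := le_mul_of_one_le_left n₃ hc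
      _ = 2 * M * (c ^ 2 / 2 * ∫ x, modVel k c e w x ^ 2) := by ring
      _ ≤ 2 * M * H := by gcongr; linarith
      _ ≤ B * H := by gcongr; linarith
  have b₄ : e 0 ^ 2 ≤ B * H := by
    have h1 : 2 * k * e 0 ^ 2 / c ^ 2 ≤ H := by linarith
    rw [div_le_iff₀ hc0] at h1
    have h1' : 2 * k * e 0 ^ 2 ≤ H * 2 := h1.trans (by gcongr)
    calc e 0 ^ 2 ≤ M * k * e 0 ^ 2 := le_mul_of_one_le_left (sq_nonneg _) hk
      _ = M * (k * e 0 ^ 2) := by ring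
      _ ≤ M * H := by gcongr; linarith
      _ ≤ B * H := by gcongr; linarith
  have w₁ : ∫ x, excess k x ^ 2 ≤ B :=
    (h.integral_excess_sq_le hM hk hc).trans (by have := hpow 5 (by norm_num); linarith)
  have w₂ : ∫ x, (profDeriv k x / dens k x ^ 2) ^ 2 ≤ B :=
    (h.integral_profDeriv_div_sq_le hM hk hc).trans (by have := hpow 5 (by norm_num); linarith)
  have w₃ : ∫ x, orthWeight k c x ^ 2 ≤ B :=
    (h.integral_orthWeight_sq_le hM hk hc).trans (by linarith)
  have w₄ : ∫ x, prof k x ^ 2 ≤ B :=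
    (h.integral_sq_le_of_weight hk (continuous_prof k) zero_le_one h.prof_sq_le).trans (by linarith)
  have w₅ : ∫ x, profDeriv k x ^ 2 ≤ B :=
    (h.integral_sq_le_of_weight hk (bddCont_profDeriv k).1 zero_le_one h.profDeriv_sq_le).trans
      (by linarith)
  have w₆ : ∫ x, scal k x ^ 2 ≤ B :=
    (h.integral_sq_le_of_weight hk (continuous_scal k) zero_le_two (scal_sq_le k)).trans
      (by linarith)
  have hm : MemLp (fun x => profDeriv k x / dens k x ^ 2) 2 volume := by
    refine (funext fun x => ?_ : (fun x => profDeriv k x / dens k x ^ 2) = _) ▸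
      (h.bddCont_div_dens_pow (BddCont.const 1) 2).memLp_mul h.memLp_profDeriv
    ring
  have cs : ∀ {f g : ℝ → ℝ} (s : Set ℝ), MemLp f 2 volume → MemLp g 2 volume →
      ∫ x in s, f x ^ 2 ≤ B * H → ∫ x, g x ^ 2 ≤ B → (∫ x in s, f x * g x) ^ 2 ≤ B ^ 2 * H := by
    intro f g s hf hg h1 h2
    refine (sq_integral_mul_le (hf.restrict s) (hg.restrict s)).trans ?_
    calc _ ≤ B * H * B := mul_le_mul h1 ((setIntegral_sq_le hg s).trans h2)
          (integral_nonneg fun _ => sq_nonneg _) (by positivity)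
      _ = _ := by ring
  have cs' : ∀ {f g : ℝ → ℝ}, MemLp f 2 volume → MemLp g 2 volume →
      ∫ x, f x ^ 2 ≤ B * H → ∫ x, g x ^ 2 ≤ B → (∫ x, g x * f x) ^ 2 ≤ B ^ 2 * H := by
    intro f g hf hg h1 h2
    have := cs univ hf hg (by rwa [setIntegral_univ]) h2
    simpa only [setIntegral_univ, mul_comm] using this
  have split : ∀ {g : ℝ → ℝ}, MemLp g 2 volume → ∫ x, modPart k e x * g x =
      (∫ x in Ioi 0, ρ₁ x * g x) + (∫ x in Iic 0, ρ₂ x * g x)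
        + r₁ * (∫ x in Ioi 0, profDeriv k x * g x) + r₂ * ∫ x in Iic 0, profDeriv k x * g x := by
    intro g hg
    have i1 := integrable_of_memLp_mul hρ₁ hg
    have i2 := integrable_of_memLp_mul hρ₂ hg
    have i3 := integrable_of_memLp_mul h.memLp_profDeriv hg
    rw [← integral_Iic_add_Ioi_zero (integrable_of_memLp_mul hu.memLp hg)]
    have e1 : ∫ x in Ioi 0, modPart k e x * g x
        = (∫ x in Ioi 0, ρ₁ x * g x) + r₁ * ∫ x in Ioi 0, profDeriv k x * g x := by
      rw [← integral_const_mul, ← integral_add i1.integrableOn (i3.const_mul _).integrableOn]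
      refine integral_congr_ae (.of_forall fun x => ?_)
      simp only [hρ₁d]
      ring
    have e2 : ∫ x in Iic 0, modPart k e x * g x
        = (∫ x in Iic 0, ρ₂ x * g x) + r₂ * ∫ x in Iic 0, profDeriv k x * g x := by
      rw [← integral_const_mul, ← integral_add i2.integrableOn (i3.const_mul _).integrableOn]
      refine integral_congr_ae (.of_forall fun x => ?_)
      simp only [hρ₂d]
      ring
    rw [e1, e2]
    ring
  have refl : ∀ f : ℝ → ℝ, ∫ x in Iic 0, f x = ∫ x in Ioi 0, f (-x) := fun f => by
    rw [integral_comp_neg_Ioi, neg_zero]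
  have hγ := h.integral_Ioi_profDeriv_mul_excess
  have hγ' : ∫ x in Iic 0, profDeriv k x * excess k x = 8 * k ^ 4 / c ^ 2 := by
    rw [refl]
    simp_rw [profDeriv_neg, excess_neg, neg_mul]
    rw [integral_neg, hγ, neg_neg]
  have hN' : ∫ x in Iic 0, profDeriv k x * orthWeight k c x
      = ∫ x in Ioi 0, profDeriv k x * orthWeight k c x := by
    rw [refl]
    simp [orthWeight, profDeriv_neg, dens_neg]
  -- `orthWeight` is η' times a factor at least 1, and ∫ η'² over x > 0 is 32k⁵/15.
  have hN : 2 * k ^ 5 ≤ ∫ x in Ioi 0, profDeriv k x * orthWeight k c x := by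
    have h1 : 2 * k ^ 5 ≤ ∫ x in Ioi 0, profDeriv k x ^ 2 := by
      rw [h.integral_Ioi_profDeriv_sq]
      have : 0 < k ^ 5 := by positivity
      linarith
    refine h1.trans (integral_mono h.memLp_profDeriv.integrable_sq.integrableOn
      (integrable_of_memLp_mul h.memLp_profDeriv h.memLp_orthWeight).integrableOn fun x => ?_)
    have : 0 ≤ c ^ 2 / (4 * dens k x ^ 4) * profDeriv k x ^ 2 := by
      have := h.dens_pos x
      positivity
    simp only [orthWeight]
    linarith
  -- By parity r₁ and r₂ enter `E₁` with opposite signs and `E₂` with the same sign.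
  have E₁ := h.integral_modPart_mul_excess he hw hP
  rw [split h.memLp_excess, hγ, hγ'] at E₁
  have E₂ := h.integral_modPart_mul_orthWeight he hw hO
  rw [split h.memLp_orthWeight, hN'] at E₂
  have hr := kernel_coefficients_le hB hk0 h.le_one (hk.trans (by gcongr; linarith)) hc2 hH0 hN
    (α := e 0) (r₁ := r₁) (r₂ := r₂) (by rw [← E₁]; field_simp; ring) (by rw [← E₂]; ring)
    (cs (Ioi 0) hρ₁ h.memLp_excess b₁ w₁) (cs (Iic 0) hρ₂ h.memLp_excess b₂ w₁)
    (cs' hy h.memLp_prof b₃ w₄) (cs' hy hm b₃ w₂) (cs (Ioi 0) hρ₁ h.memLp_orthWeight b₁ w₃)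
    (cs (Iic 0) hρ₂ h.memLp_orthWeight b₂ w₃) b₄
  have half : ∀ {ρ : ℝ → ℝ} {r : ℝ} (s : Set ℝ), MemLp ρ 2 volume →
      (∀ x, e x = ρ x + r * profDeriv k x + e 0 * scal k x) → r ^ 2 ≤ 4 * B ^ 12 * H →
      ∫ x in s, ρ x ^ 2 ≤ B * H → ∫ x in s, e x ^ 2 ≤ 18 * B ^ 13 * H := by
    intro ρ r s hρ hex hr hρs
    have i1 := hρ.integrable_sq.integrableOn (s := s)
    have i2 := h.memLp_profDeriv.integrable_sq.integrableOn (s := s)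
    have i3 := hs.memLp.integrable_sq.integrableOn (s := s)
    have h1 : ∫ x in s, e x ^ 2 ≤ ∫ x in s,
        (3 * ρ x ^ 2 + 3 * r ^ 2 * profDeriv k x ^ 2 + 3 * e 0 ^ 2 * scal k x ^ 2) := by
      refine integral_mono he.memLp.integrable_sq.integrableOn
        (((i1.const_mul _).add (i2.const_mul _)).add (i3.const_mul _)) fun x => ?_
      have h1 := add_three_sq_le (ρ x) (r * profDeriv k x) (e 0 * scal k x)
      rw [← hex x, mul_pow, mul_pow] at h1
      linarith
    have i4 : IntegrableOn (fun x => 3 * ρ x ^ 2 + 3 * r ^ 2 * profDeriv k x ^ 2) s :=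
      (i1.const_mul _).add (i2.const_mul _)
    rw [integral_add i4 (i3.const_mul _), integral_add (i1.const_mul _)
      (i2.const_mul _), integral_const_mul, integral_const_mul, integral_const_mul] at h1
    have h2 : r ^ 2 * ∫ x in s, profDeriv k x ^ 2 ≤ 4 * B ^ 12 * H * B :=
      mul_le_mul hr ((setIntegral_sq_le h.memLp_profDeriv s).trans w₅)
        (integral_nonneg fun _ => sq_nonneg _) (by positivity)
    have h3 : e 0 ^ 2 * ∫ x in s, scal k x ^ 2 ≤ B * H * B :=
      mul_le_mul b₄ ((setIntegral_sq_le hs.memLp s).trans w₆)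
        (integral_nonneg fun _ => sq_nonneg _) (by positivity)
    have h4 : B * H ≤ B ^ 13 * H := by gcongr; exact le_self_pow₀ hB (by norm_num)
    have h5 : B ^ 2 * H ≤ B ^ 13 * H := by gcongr; norm_num
    linarith
  have f₁ : ∫ x, e x ^ 2 ≤ 36 * B ^ 13 * H := by
    have g₁ := half (Ioi 0) hρ₁ (fun x => by simp only [hρ₁d, modPart]; ring) hr.1 b₁
    have g₂ := half (Iic 0) hρ₂ (fun x => by simp only [hρ₂d, modPart]; ring) hr.2 b₂
    rw [← integral_Iic_add_Ioi_zero he.memLp.integrable_sq]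
    linarith
  have hB4 : 8 * M ^ 4 ≤ B := by have := hpow 4 (by norm_num); linarith
  have hB3 : 4 * M ^ 3 ≤ B := by have := hpow 3 (by norm_num); linarith
  have hB3' : M ^ 3 ≤ B := by have := hpow 3 (by norm_num); linarith
  have hBM : 4 * M ^ 2 ≤ B := by linarith
  have f₂ : ∫ x, de x ^ 2 ≤ 8 * H + 10 * B * ∫ x, e x ^ 2 := by
    have i1 := h.integrable_hessDensity he hw
    rw [hH, ← integral_const_mul, ← integral_const_mul, ← integral_add (i1.const_mul _)
      (he.memLp.integrable_sq.const_mul _)]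
    refine integral_mono he.memLp_deriv.integrable_sq
      ((i1.const_mul _).add (he.memLp.integrable_sq.const_mul _)) fun x => ?_
    simpa using h.deriv_sq_le_hessDensity hM hc hB3 hBM e de w x
  have f₃ : ∫ x, w x ^ 2 ≤ 3 * (∫ x, modVel k c e w x ^ 2)
      + 3 * e 0 ^ 2 * B * (∫ x, prof k x ^ 2) + 3 * B * ∫ x, e x ^ 2 := by
    have i1 := hy.integrable_sq
    have i2 := h.memLp_prof.integrable_sq
    have i3 := he.memLp.integrable_sq
    have i4 : Integrable fun x => 3 * modVel k c e w x ^ 2 + 3 * e 0 ^ 2 * B * prof k x ^ 2 :=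
      (i1.const_mul _).add (i2.const_mul _)
    rw [← integral_const_mul, ← integral_const_mul, ← integral_const_mul,
      ← integral_add (i1.const_mul _) (i2.const_mul _), ← integral_add i4 (i3.const_mul _)]
    refine integral_mono hw.integrable_sq (i4.add (i3.const_mul _)) fun x => ?_
    simpa using h.vel_sq_le hM hc hB4 hB3' e w x
  have f₄ : e 0 ^ 2 * B * (∫ x, prof k x ^ 2) ≤ B * H * B * B := by
    refine mul_le_mul ?_ w₄ (integral_nonneg fun _ => sq_nonneg _) (by positivity)
    exact mul_le_mul_of_nonneg_right b₄ (by linarith)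
  have f₅ : B * ∫ x, e x ^ 2 ≤ B * (36 * B ^ 13 * H) :=
    mul_le_mul_of_nonneg_left f₁ (by linarith)
  have p : ∀ j ≤ 14, B ^ j * H ≤ B ^ 14 * H := fun j hj => by gcongr
  have p0 := p 0 (by norm_num)
  have p1 := p 1 (by norm_num)
  have p3 := p 3 (by norm_num)
  have p13 := p 13 (by norm_num)
  simp only [pow_zero, one_mul, pow_one] at p0 p1
  have e₁ : B * (36 * B ^ 13 * H) = 36 * (B ^ 14 * H) := by ring
  have e₂ : B * H * B * B = B ^ 3 * H := by ring
  -- In units of B¹⁴H: 36 + (8 + 360) + (3 + 3 + 108) = 518 ≤ 600.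
  linarith

end Admissible

/-! ### The Sobolev embedding -/

theorem exists_interval_of_hasCompactSupport {φ : ℝ → ℝ} (h : HasCompactSupport φ) :
    ∃ R : ℝ, 0 < R ∧ ∀ x, R ≤ |x| → φ x = 0 := by
  obtain ⟨R, hR0, hR⟩ := h.isCompact.isBounded.exists_pos_norm_lt
  refine ⟨R, hR0, fun x hx => ?_⟩
  by_contra hne
  exact absurd (hR x (subset_tsupport φ hne)) (not_lt.2 hx)

theorem support_subset_Ioc {φ : ℝ → ℝ} {R : ℝ} (h : ∀ x, R ≤ |x| → φ x = 0) :
    Function.support φ ⊆ Ioc (-R) R := fun x hx => by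
  have : |x| < R := by
    by_contra hne
    exact hx (h x (not_lt.1 hne))
  exact ⟨(abs_lt.1 this).1, (abs_lt.1 this).2.le⟩

/-- Integration by parts against the primitive of a locally integrable function. -/
theorem integral_primitive_mul_deriv {g : ℝ → ℝ} (hg : LocallyIntegrable g) {φ : ℝ → ℝ}
    (h1 : ContDiff ℝ ∞ φ) (h2 : HasCompactSupport φ) :
    ∫ x, (∫ y in (0)..x, g y) * deriv φ x = -∫ x, g x * φ x := by
  obtain ⟨R, hR0, hR⟩ := exists_interval_of_hasCompactSupport h2
  obtain ⟨R', -, hR'⟩ := exists_interval_of_hasCompactSupport h2.deriv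
  set S := max R R'
  have hS : ∀ x, S ≤ |x| → φ x = 0 := fun x hx => hR x ((le_max_left _ _).trans hx)
  have hS' : ∀ x, S ≤ |x| → deriv φ x = 0 := fun x hx => hR' x ((le_max_right _ _).trans hx)
  have hS0 : 0 < S := hR0.trans_le (le_max_left _ _)
  have hint : IntervalIntegrable g volume (-S) S := intervalIntegrable_iff.2 <|
    (hg.integrableOn_isCompact isCompact_uIcc).mono_set uIoc_subset_uIcc
  have h0 : (0 : ℝ) ∈ uIcc (-S) S := by
    rw [uIcc_of_le (by linarith)]; exact ⟨by linarith, hS0.le⟩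
  have ac1 := hint.absolutelyContinuousOnInterval_intervalIntegral h0
  have ac2 : AbsolutelyContinuousOnInterval φ (-S) S :=
    (h1.of_le (by simp)).contDiffOn.absolutelyContinuousOnInterval
  have key := ac1.integral_mul_deriv_eq_deriv_mul ac2
  rw [hS S (le_abs_self S), hS (-S) (by rw [abs_neg]; exact le_abs_self S), mul_zero, mul_zero,
    sub_zero, zero_sub] at key
  rw [← intervalIntegral.integral_eq_integral_of_support_subset
      (support_subset_Ioc (R := S) fun x hx => by rw [hS' x hx, mul_zero]),
    ← intervalIntegral.integral_eq_integral_of_support_subset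
      (support_subset_Ioc (R := S) fun x hx => by rw [hS x hx, mul_zero]), key, neg_inj]
  refine intervalIntegral.integral_congr_ae ?_
  filter_upwards [_root_.LocallyIntegrable.ae_hasDerivAt_integral hg] with x hx _
  rw [(hx 0).deriv]

/-- The primitive starting to the left of the support vanishes to the right of it because the total
integral is zero. -/
theorem exists_primitive_compactSupport {χ : ℝ → ℝ} (h1 : ContDiff ℝ ∞ χ)
    (h2 : HasCompactSupport χ) (h3 : ∫ x, χ x = 0) :
    ∃ φ : ℝ → ℝ, ContDiff ℝ ∞ φ ∧ HasCompactSupport φ ∧ deriv φ = χ := by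
  obtain ⟨R, hR0, hR⟩ := exists_interval_of_hasCompactSupport h2
  have hd : ∀ x, HasDerivAt (fun x => ∫ y in (-R)..x, χ y) (χ x) x := fun x =>
    intervalIntegral.integral_hasDerivAt_right (h1.continuous.intervalIntegrable _ _)
      (h1.continuous.stronglyMeasurableAtFilter _ _) h1.continuous.continuousAt
  have he : deriv (fun x => ∫ y in (-R)..x, χ y) = χ := funext fun x => (hd x).deriv
  refine ⟨fun x => ∫ y in (-R)..x, χ y, ?_, ?_, he⟩
  · rw [contDiff_infty_iff_deriv, he]
    exact ⟨fun x => (hd x).differentiableAt, h1⟩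
  · refine HasCompactSupport.intro (isCompact_Icc (a := -R) (b := R)) fun x hx => ?_
    rcases lt_or_ge x (-R) with hlt | hge
    · have : ∀ y ∈ uIcc (-R) x, χ y = 0 := fun y hy => by
        rw [uIcc_of_ge hlt.le] at hy
        refine hR y ?_
        rw [abs_of_neg (by linarith [hy.2])]
        linarith [hy.2]
      rw [intervalIntegral.integral_congr this]
      simp
    · have hgt : R < x := by
        by_contra hne
        exact hx ⟨hge, not_lt.1 hne⟩
      have hsub : Function.support χ ⊆ Ioc (-R) x :=
        (support_subset_Ioc hR).trans (Ioc_subset_Ioc_right hgt.le)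
      rw [intervalIntegral.integral_eq_integral_of_support_subset hsub, h3]

/-- A locally integrable function with vanishing weak derivative is constant. -/
theorem ae_eq_const_of_integral_mul_deriv_eq_zero {f : ℝ → ℝ} (hf : LocallyIntegrable f)
    (h : ∀ φ : ℝ → ℝ, ContDiff ℝ ∞ φ → HasCompactSupport φ → ∫ x, f x * deriv φ x = 0) :
    ∃ C, ∀ᵐ x, f x = C := by
  let b : ContDiffBump (0 : ℝ) := ⟨1, 2, one_pos, one_lt_two⟩
  set ρ := b.normed volume with hρ
  have hρ1 : ContDiff ℝ ∞ ρ := b.contDiff_normed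
  have hρ2 : HasCompactSupport ρ := b.hasCompactSupport_normed
  have hρ3 : ∫ x, ρ x = 1 := b.integral_normed
  have hint : ∀ {φ : ℝ → ℝ}, ContDiff ℝ ∞ φ → HasCompactSupport φ →
      Integrable fun x => φ x • f x := fun h1 h2 =>
    hf.integrable_smul_left_of_hasCompactSupport h1.continuous h2
  refine ⟨∫ x, f x * ρ x, ?_⟩
  have hz := ae_eq_zero_of_integral_contDiff_smul_eq_zero (μ := volume)
    (f := fun x => f x - ∫ x, f x * ρ x) (hf.sub (locallyIntegrable_const _)) fun ψ h1 h2 => ?_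
  · filter_upwards [hz] with x hx
    linarith
  have hψ : Integrable ψ := h1.continuous.integrable_of_hasCompactSupport h2
  have hρi : Integrable ρ := hρ1.continuous.integrable_of_hasCompactSupport hρ2
  -- Subtracting (∫ψ)ρ makes the mean zero, so the difference is an admissible derivative φ';
  -- testing f against it gives ∫ fψ = (∫ fρ)(∫ ψ).
  obtain ⟨φ, p1, p2, p3⟩ := exists_primitive_compactSupport
    (χ := fun x => ψ x - (∫ y, ψ y) * ρ x) (h1.sub (contDiff_const.mul hρ1))
    (h2.sub hρ2.mul_left) (by
      rw [integral_sub hψ (hρi.const_mul _), integral_const_mul, hρ3]; ring)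
  have key := h φ p1 p2
  rw [p3] at key
  have e1 : ∀ x, f x * (ψ x - (∫ y, ψ y) * ρ x) = ψ x • f x - (∫ y, ψ y) * (ρ x • f x) :=
    fun x => by simp only [smul_eq_mul]; ring
  simp_rw [e1] at key
  rw [integral_sub (hint h1 h2) ((hint hρ1 hρ2).const_mul _), integral_const_mul] at key
  have e2 : ∀ x, ψ x • (f x - ∫ x, f x * ρ x) = ψ x • f x - (∫ x, f x * ρ x) * ψ x :=
    fun x => by simp only [smul_eq_mul]; ring
  simp_rw [e2]
  rw [integral_sub (hint h1 h2) (hψ.const_mul _), integral_const_mul]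
  simp only [smul_eq_mul, mul_comm (ρ _)] at key ⊢
  linarith

/-- f minus the primitive of g has zero weak derivative, hence is almost everywhere constant. -/
theorem IsWeakDeriv.exists_sobolevPair {f g : L2} (h : IsWeakDeriv f g) :
    ∃ u : ℝ → ℝ, SobolevPair u g ∧ f =ᵐ[volume] u := by
  have hg : LocallyIntegrable g := (Lp.memLp g).locallyIntegrable (by norm_num)
  have hf : LocallyIntegrable f := (Lp.memLp f).locallyIntegrable (by norm_num)
  have hgi : ∀ a b, IntervalIntegrable g volume a b := fun a b => intervalIntegrable_iff.2 <|
    (hg.integrableOn_isCompact isCompact_uIcc).mono_set uIoc_subset_uIcc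
  set G := fun x => ∫ y in (0)..x, g y with hG
  have hGc : Continuous G := intervalIntegral.continuous_primitive hgi 0
  obtain ⟨C, hC⟩ := ae_eq_const_of_integral_mul_deriv_eq_zero
    (hf.sub hGc.locallyIntegrable) fun φ h1 h2 => by
      have i1 := integrable_L2_mul_deriv f h1 h2
      have i2 : Integrable fun x => G x * deriv φ x :=
        (hGc.mul (h1.continuous_deriv (by simp))).integrable_of_hasCompactSupport h2.deriv.mul_left
      simp only [Pi.sub_apply, sub_mul]
      rw [integral_sub i1 i2, h φ h1 h2, integral_primitive_mul_deriv hg h1 h2, sub_self]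
  have hae : f =ᵐ[volume] fun x => C + G x := by
    filter_upwards [hC] with x hx
    rw [← hx, Pi.sub_apply]
    ring
  refine ⟨fun x => C + G x, ⟨(memLp_congr_ae hae).1 (Lp.memLp f), Lp.memLp g, fun a b => ?_⟩, hae⟩
  rw [hG, ← intervalIntegral.integral_interval_sub_left (hgi 0 b) (hgi 0 a)]
  ring

/-- The continuous representative of an element of `H¹(ℝ)`. -/
noncomputable def contRep (p : H1) : ℝ → ℝ := (IsWeakDeriv.exists_sobolevPair p.2).choose

theorem sobolevPair_contRep (p : H1) : SobolevPair (contRep p) p.1.snd :=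
  (IsWeakDeriv.exists_sobolevPair p.2).choose_spec.1

theorem contRep_ae_eq (p : H1) : p.1.fst =ᵐ[volume] contRep p :=
  (IsWeakDeriv.exists_sobolevPair p.2).choose_spec.2

/-- Continuous functions that agree almost everywhere agree. This makes `contRep`, defined by
choice, linear. -/
theorem contRep_eq_of_ae_eq {p : H1} {u : ℝ → ℝ} (hu : Continuous u) (h : p.1.fst =ᵐ[volume] u) :
    contRep p = u :=
  ((sobolevPair_contRep p).continuous.ae_eq_iff_eq volume hu).1 ((contRep_ae_eq p).symm.trans h)

theorem norm_sq_L2 (f : L2) : ‖f‖ ^ 2 = ∫ x, f x ^ 2 := by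
  rw [← real_inner_self_eq_norm_sq, L2.inner_def]
  refine integral_congr_ae (.of_forall fun x => ?_)
  simp [sq]

theorem integral_sq_contRep (p : H1) : ∫ x, contRep p x ^ 2 = ‖p.1.fst‖ ^ 2 := by
  rw [norm_sq_L2]
  refine integral_congr_ae ?_
  filter_upwards [contRep_ae_eq p] with x hx
  rw [hx]

theorem norm_sq_H1 (p : H1) :
    ‖p‖ ^ 2 = (∫ x, contRep p x ^ 2) + ∫ x, p.1.snd x ^ 2 := by
  rw [integral_sq_contRep, ← norm_sq_L2, Submodule.coe_norm, WithLp.prod_norm_sq_eq_of_L2]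

theorem abs_contRep_le (p : H1) (x : ℝ) : |contRep p x| ≤ √2 * ‖p‖ := by
  have h := (sobolevPair_contRep p).sq_le_integral x
  rw [integral_add (sobolevPair_contRep p).memLp.integrable_sq
    (sobolevPair_contRep p).memLp_deriv.integrable_sq, ← norm_sq_H1] at h
  rw [← Real.sqrt_sq (norm_nonneg p), ← Real.sqrt_mul (by norm_num)]
  exact Real.abs_le_sqrt h

/-- The Sobolev embedding of `H¹(ℝ)` into the bounded continuous functions. -/
noncomputable def sobolevEmbedding : H1 →L[ℝ] BoundedContinuousFunction ℝ ℝ :=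
  LinearMap.mkContinuous
    { toFun := fun p => BoundedContinuousFunction.ofNormedAddCommGroup (contRep p)
        (sobolevPair_contRep p).continuous (√2 * ‖p‖) (abs_contRep_le p)
      map_add' := fun p q => by
        refine DFunLike.coe_injective (contRep_eq_of_ae_eq
          ((sobolevPair_contRep p).continuous.add (sobolevPair_contRep q).continuous) ?_)
        filter_upwards [contRep_ae_eq p, contRep_ae_eq q, Lp.coeFn_add p.1.fst q.1.fst]
          with x h1 h2 h3
        simp only [Submodule.coe_add, WithLp.add_fst]
        rw [h3, Pi.add_apply, h1, h2]
        rfl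
      map_smul' := fun r p => by
        refine DFunLike.coe_injective (contRep_eq_of_ae_eq
          (continuous_const.mul (sobolevPair_contRep p).continuous : Continuous fun x =>
            r * contRep p x) ?_)
        filter_upwards [contRep_ae_eq p, Lp.coeFn_smul r p.1.fst] with x h1 h3
        simp only [Submodule.coe_smul, WithLp.smul_fst]
        rw [h3, Pi.smul_apply, h1, smul_eq_mul]
        rfl }
    (√2) fun p => (BoundedContinuousFunction.norm_le (by positivity)).2 (abs_contRep_le p)

/-! ### Regularity of the functionals -/

theorem memLp_bounded_mul (m : BoundedContinuousFunction ℝ ℝ) (f : L2) :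
    MemLp (fun x => m x * f x) 2 volume :=
  BddCont.memLp_mul ⟨m.continuous, ‖m‖, m.norm_coe_le_norm⟩ (Lp.memLp f)

/-- Multiplication of `L²` functions by bounded continuous functions. -/
noncomputable def mulL2 : BoundedContinuousFunction ℝ ℝ →L[ℝ] L2 →L[ℝ] L2 :=
  LinearMap.mkContinuous₂
    (LinearMap.mk₂ ℝ (fun m f => (memLp_bounded_mul m f).toLp _)
      (fun m n f => by
        rw [← MemLp.toLp_add]
        exact MemLp.toLp_congr _ _ (.of_forall fun x => add_mul _ _ _))
      (fun r m f => by
        rw [← MemLp.toLp_const_smul]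
        exact MemLp.toLp_congr _ _ (.of_forall fun x => mul_assoc _ _ _))
      (fun m f g => by
        rw [← MemLp.toLp_add]
        refine MemLp.toLp_congr _ _ ?_
        filter_upwards [Lp.coeFn_add f g] with x hx
        rw [hx, Pi.add_apply, mul_add]
        rfl)
      (fun r m f => by
        rw [← MemLp.toLp_const_smul]
        refine MemLp.toLp_congr _ _ ?_
        filter_upwards [Lp.coeFn_smul r f] with x hx
        rw [hx, Pi.smul_apply, Pi.smul_apply, smul_eq_mul, smul_eq_mul]
        ring))
    1 fun m f => by
      rw [LinearMap.mk₂_apply, one_mul]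
      refine Lp.norm_le_mul_norm_of_ae_le_mul ?_
      filter_upwards [(memLp_bounded_mul m f).coeFn_toLp] with x hx
      rw [hx, norm_mul]
      exact mul_le_mul_of_nonneg_right (m.norm_coe_le_norm x) (norm_nonneg _)

/-- The trilinear form `∫ m f g`. -/
noncomputable def triL2 : BoundedContinuousFunction ℝ ℝ →L[ℝ] L2 →L[ℝ] L2 →L[ℝ] ℝ :=
  (ContinuousLinearMap.compL ℝ L2 L2 (L2 →L[ℝ] ℝ)
    (isBoundedBilinearMap_inner (𝕜 := ℝ) (E := L2)).toContinuousLinearMap) ∘L mulL2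

theorem triL2_apply (m : BoundedContinuousFunction ℝ ℝ) (f g : L2) :
    triL2 m f g = ∫ x, m x * (f x * g x) := by
  change inner ℝ ((memLp_bounded_mul m f).toLp _ : L2) g = _
  rw [L2.inner_def]
  refine integral_congr_ae ?_
  filter_upwards [(memLp_bounded_mul m f).coeFn_toLp] with x hx
  rw [hx]
  simp only [RCLike.inner_apply, conj_trivial]
  ring

theorem triL2_comm (m : BoundedContinuousFunction ℝ ℝ) (f g : L2) :
    triL2 m f g = triL2 m g f := by
  simp_rw [triL2_apply, mul_comm (f _)]

attribute [irreducible] triL2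

/-- The projection to `η ∈ H¹(ℝ)`. -/
noncomputable def etaH1 : X →L[ℝ] H1 := WithLp.fstL 2 ℝ H1 L2
/-- The projection to `η ∈ L²(ℝ)`. -/
noncomputable def etaL : X →L[ℝ] L2 := (WithLp.fstL 2 ℝ L2 L2).comp (H1.subtypeL.comp etaH1)
/-- The projection to `∂ₓη ∈ L²(ℝ)`. -/
noncomputable def dEtaL : X →L[ℝ] L2 := (WithLp.sndL 2 ℝ L2 L2).comp (H1.subtypeL.comp etaH1)
/-- The projection to `v ∈ L²(ℝ)`. -/
noncomputable def velL : X →L[ℝ] L2 := WithLp.sndL 2 ℝ H1 L2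
/-- The projection to the continuous representative of `η`. -/
noncomputable def etaCont : X →L[ℝ] BoundedContinuousFunction ℝ ℝ := sobolevEmbedding.comp etaH1

theorem etaL_apply (u : X) : etaL u = u.eta := rfl
theorem dEtaL_apply (u : X) : dEtaL u = u.dEta := rfl
theorem velL_apply (u : X) : velL u = u.vel := rfl
theorem etaCont_ae_eq (u : X) : u.eta =ᵐ[volume] etaCont u := contRep_ae_eq u.fst

theorem sobolevPair_etaCont (u : X) : SobolevPair (etaCont u) u.dEta := sobolevPair_contRep u.fst

theorem norm_sq_X (u : X) :
    ‖u‖ ^ 2 = (∫ x, etaCont u x ^ 2) + (∫ x, u.dEta x ^ 2) + ∫ x, u.vel x ^ 2 := by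
  rw [WithLp.prod_norm_sq_eq_of_L2, norm_sq_H1, norm_sq_L2]
  rfl

section Trilinear

variable {R F E : Type*} [NormedAddCommGroup R] [NormedSpace ℝ R] [NormedAddCommGroup F]
  [NormedSpace ℝ F] [NormedAddCommGroup E] [NormedSpace ℝ E]

theorem contDiffAt_trilinear (A : R →L[ℝ] F →L[ℝ] F →L[ℝ] ℝ) {n : WithTop ℕ∞} {m : E → R}
    {f g : E → F} {x : E} (hm : ContDiffAt ℝ n m x) (hf : ContDiffAt ℝ n f x)
    (hg : ContDiffAt ℝ n g x) : ContDiffAt ℝ n (fun y => A (m y) (f y) (g y)) x := by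
  fun_prop

theorem hasDerivAt_trilinear (A : R →L[ℝ] F →L[ℝ] F →L[ℝ] ℝ) {m : ℝ → R} {f g : ℝ → F}
    {m' : R} {f' g' : F} {t : ℝ} (hm : HasDerivAt m m' t) (hf : HasDerivAt f f' t)
    (hg : HasDerivAt g g' t) :
    HasDerivAt (fun s => A (m s) (f s) (g s))
      (A m' (f t) (g t) + A (m t) f' (g t) + A (m t) (f t) g') t := by
  have hA : HasFDerivAt (fun r => A r) A (m t) :=
    ContinuousLinearMap.hasFDerivAt (F := F →L[ℝ] F →L[ℝ] ℝ) A
  have h1 : HasDerivAt (fun s => A (m s)) (A m') t :=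
    HasFDerivAt.comp_hasDerivAt (l := fun r => A r) t hA hm
  have h2 : HasDerivAt (fun s => A (m s) (f s)) (A m' (f t) + A (m t) f') t := h1.clm_apply hf
  exact h2.clm_apply hg

end Trilinear

/-- A smooth extension of the energy. -/
noncomputable def regEnergy (u : X) : ℝ :=
  1 / 8 * triL2 (Ring.inverse (1 - etaCont u)) (dEtaL u) (dEtaL u)
    + 1 / 2 * triL2 (1 - etaCont u) (velL u) (velL u) + 1 / 4 * triL2 1 (etaL u) (etaL u)

theorem inverse_apply {m : BoundedContinuousFunction ℝ ℝ} (hm : IsUnit m) (x : ℝ) :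
    Ring.inverse m x = (m x)⁻¹ := by
  have h : (m * Ring.inverse m) x = 1 := by rw [Ring.mul_inverse_cancel m hm]; rfl
  rw [BoundedContinuousFunction.mul_apply] at h
  exact eq_inv_of_mul_eq_one_right h

/-- At a unit, inversion in the algebra of bounded continuous functions is pointwise division. Units
form an open set, so the two functionals have the same derivatives there. -/
theorem energy_eq_regEnergy {u : X} (hu : IsUnit (1 - etaCont u)) : energy u = regEnergy u := by
  unfold energy regEnergy
  simp only [triL2_apply, etaL_apply, dEtaL_apply, velL_apply]
  have hae := etaCont_ae_eq u
  congr 1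
  · congr 1
    · congr 1
      refine integral_congr_ae ?_
      filter_upwards [hae] with x hx
      rw [inverse_apply hu, hx, BoundedContinuousFunction.sub_apply,
        BoundedContinuousFunction.coe_one, Pi.one_apply]
      ring
    · congr 1
      refine integral_congr_ae ?_
      filter_upwards [hae] with x hx
      rw [hx, BoundedContinuousFunction.sub_apply, BoundedContinuousFunction.coe_one, Pi.one_apply]
      ring
  · congr 1
    refine integral_congr_ae (.of_forall fun x => ?_)
    simp [sq]

theorem eventually_isUnit {u : X} (hu : IsUnit (1 - etaCont u)) :
    ∀ᶠ w in 𝓝 u, IsUnit (1 - etaCont w) :=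
  (continuous_const.sub etaCont.continuous).continuousAt.eventually
    (Units.isOpen.mem_nhds hu)

theorem energy_eventuallyEq {u : X} (hu : IsUnit (1 - etaCont u)) :
    energy =ᶠ[𝓝 u] regEnergy := by
  filter_upwards [eventually_isUnit hu] with w hw using energy_eq_regEnergy hw

/-- Inversion is smooth at units of a Banach algebra; everything else is built from continuous
linear and trilinear maps. -/
theorem contDiffAt_regEnergy {u : X} (hu : IsUnit (1 - etaCont u)) :
    ContDiffAt ℝ 2 regEnergy u := by
  have h1 : ContDiffAt ℝ 2 (fun w : X => 1 - etaCont w) u :=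
    (contDiff_const.sub etaCont.contDiff).contDiffAt
  have h2 : ContDiffAt ℝ 2 (fun w : X => Ring.inverse (1 - etaCont w)) u := by
    obtain ⟨m, hm⟩ := hu
    have := contDiffAt_ringInverse ℝ (n := 2) m
    rw [hm] at this
    exact this.comp u h1
  exact ((contDiffAt_const.mul (contDiffAt_trilinear triL2 h2 dEtaL.contDiff.contDiffAt
    dEtaL.contDiff.contDiffAt)).add (contDiffAt_const.mul (contDiffAt_trilinear triL2 h1
    velL.contDiff.contDiffAt velL.contDiff.contDiffAt))).add (contDiffAt_const.mul
    (contDiffAt_trilinear triL2 contDiffAt_const etaL.contDiff.contDiffAt etaL.contDiff.contDiffAt))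

theorem contDiffAt_energy {u : X} (hu : IsUnit (1 - etaCont u)) : ContDiffAt ℝ 2 energy u :=
  (contDiffAt_regEnergy hu).congr_of_eventuallyEq (energy_eventuallyEq hu)

theorem momentum_eq (u : X) : momentum u = 1 / 2 * triL2 1 (etaL u) (velL u) := by
  rw [triL2_apply, momentum]
  simp [etaL_apply, velL_apply]

theorem contDiff_momentum : ContDiff ℝ 2 momentum := by
  rw [show momentum = _ from funext momentum_eq, contDiff_iff_contDiffAt]
  exact fun u => contDiffAt_const.mul (contDiffAt_trilinear triL2 contDiffAt_const
    etaL.contDiff.contDiffAt velL.contDiff.contDiffAt)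

/-! ### Derivatives along lines -/

theorem hasDerivAt_line {E : Type*} [NormedAddCommGroup E] [NormedSpace ℝ E] (u ε : E) (t : ℝ) :
    HasDerivAt (fun s : ℝ => u + s • ε) ε t := by
  simpa using ((hasDerivAt_id t).smul_const ε).const_add u

/-- The second Fréchet derivative is the second derivative along a line. -/
theorem fderiv_fderiv_apply_eq {E : Type*} [NormedAddCommGroup E] [NormedSpace ℝ E] {f : E → ℝ}
    {u : E} (hf : ContDiffAt ℝ 2 f u) {ε : E} {g : ℝ → ℝ} {r : ℝ}
    (h1 : ∀ᶠ t in 𝓝 (0 : ℝ), HasDerivAt (fun s : ℝ => f (u + s • ε)) (g t) t)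
    (h2 : HasDerivAt g r 0) : fderiv ℝ (fderiv ℝ f) u ε ε = r := by
  have hline : Tendsto (fun t : ℝ => u + t • ε) (𝓝 0) (𝓝 u) := by
    have := (hasDerivAt_line u ε 0).continuousAt.tendsto
    rwa [zero_smul, add_zero] at this
  have hd : DifferentiableAt ℝ (fderiv ℝ f) u :=
    (hf.fderiv_right (m := 1) (by norm_num)).differentiableAt (by norm_num)
  have he : ∀ᶠ w in 𝓝 u, DifferentiableAt ℝ f w :=
    (hf.eventually (by simp)).mono fun w hw => hw.differentiableAt (by norm_num)
  have hg : g =ᶠ[𝓝 0] fun t => fderiv ℝ f (u + t • ε) ε := by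
    filter_upwards [h1, hline.eventually he] with t ht hft
    exact ht.unique (hft.hasFDerivAt.comp_hasDerivAt t (hasDerivAt_line u ε t))
  have h3 : HasDerivAt (fun t : ℝ => fderiv ℝ f (u + t • ε) ε) (fderiv ℝ (fderiv ℝ f) u ε ε) 0 := by
    have h4 : HasFDerivAt (fderiv ℝ f) (fderiv ℝ (fderiv ℝ f) u) (u + (0 : ℝ) • ε) := by
      rw [zero_smul, add_zero]; exact hd.hasFDerivAt
    have h5 : HasDerivAt (fun t : ℝ => fderiv ℝ f (u + t • ε)) (fderiv ℝ (fderiv ℝ f) u ε) 0 :=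
      h4.comp_hasDerivAt (0 : ℝ) (hasDerivAt_line u ε 0)
    exact (ContinuousLinearMap.apply ℝ ℝ ε).hasFDerivAt.comp_hasDerivAt (0 : ℝ) h5
  exact h3.unique (h2.congr_of_eventuallyEq hg.symm)

theorem hasDerivAt_inverse {m : ℝ → BoundedContinuousFunction ℝ ℝ} {m'} {t : ℝ}
    (hm : HasDerivAt m m' t) (hu : IsUnit (m t)) :
    HasDerivAt (fun s => Ring.inverse (m s)) (-(Ring.inverse (m t) ^ 2 * m')) t := by
  obtain ⟨x, hx⟩ := hu
  have h := hasFDerivAt_ringInverse (𝕜 := ℝ) x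
  rw [hx] at h
  convert! h.comp_hasDerivAt t hm using 1
  rw [← hx, Ring.inverse_unit]
  simp only [neg_apply, ContinuousLinearMap.mulLeftRight_apply, neg_inj]
  ring

/-- Along u + tε, the inverse m = 1/(1-η) has derivative m²ε_η, which in turn has derivative
2m³ε_η²; the rest is the product rule for `triL2`, applied twice. -/
theorem fderiv_fderiv_energy {u : X} (hu : IsUnit (1 - etaCont u)) (ε : X) :
    fderiv ℝ (fderiv ℝ energy) u ε ε =
      1 / 4 * triL2 (Ring.inverse (1 - etaCont u) ^ 3 * etaCont ε ^ 2) (dEtaL u) (dEtaL u)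
      + 1 / 2 * triL2 (Ring.inverse (1 - etaCont u) ^ 2 * etaCont ε) (dEtaL u) (dEtaL ε)
      + 1 / 4 * triL2 (Ring.inverse (1 - etaCont u)) (dEtaL ε) (dEtaL ε)
      - 2 * triL2 (etaCont ε) (velL u) (velL ε) + triL2 (1 - etaCont u) (velL ε) (velL ε)
      + 1 / 2 * triL2 1 (etaL ε) (etaL ε) := by
  rw [(energy_eventuallyEq hu).fderiv.fderiv_eq]
  have hline : Tendsto (fun t : ℝ => u + t • ε) (𝓝 0) (𝓝 u) := by
    have := (hasDerivAt_line u ε 0).continuousAt.tendsto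
    rwa [zero_smul, add_zero] at this
  have hL : ∀ {F : Type} [NormedAddCommGroup F] [NormedSpace ℝ F] (A : X →L[ℝ] F) (t : ℝ),
      HasDerivAt (fun s : ℝ => A (u + s • ε)) (A ε) t := fun A t =>
    A.hasFDerivAt.comp_hasDerivAt t (hasDerivAt_line u ε t)
  have hm : ∀ t, HasDerivAt (fun s : ℝ => 1 - etaCont (u + s • ε)) (-etaCont ε) t := fun t =>
    (hL etaCont t).const_sub 1
  have hr : ∀ t, IsUnit (1 - etaCont (u + t • ε)) →
      HasDerivAt (fun s : ℝ => Ring.inverse (1 - etaCont (u + s • ε)))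
        (Ring.inverse (1 - etaCont (u + t • ε)) ^ 2 * etaCont ε) t := fun t ht => by
    convert! hasDerivAt_inverse (hm t) ht using 1
    ring
  have h0 : IsUnit (1 - etaCont (u + (0 : ℝ) • ε)) := by rwa [zero_smul, add_zero]
  have hr2 : HasDerivAt (fun s : ℝ => Ring.inverse (1 - etaCont (u + s • ε)) ^ 2 * etaCont ε)
      (2 * (Ring.inverse (1 - etaCont u) ^ 3 * etaCont ε ^ 2)) 0 := by
    have h1 := ((hr 0 h0).fun_pow 2).mul_const (etaCont ε)
    convert! h1 using 1
    rw [zero_smul, add_zero]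
    push_cast
    ring
  have key := fderiv_fderiv_apply_eq (contDiffAt_regEnergy hu) (ε := ε)
    ((hline.eventually (eventually_isUnit hu)).mono fun t ht =>
      (((hasDerivAt_trilinear triL2 (hr t ht) (hL dEtaL t) (hL dEtaL t)).const_mul (1 / 8)).fun_add
        ((hasDerivAt_trilinear triL2 (hm t) (hL velL t) (hL velL t)).const_mul (1 / 2))).fun_add
        ((hasDerivAt_trilinear triL2 (hasDerivAt_const t 1) (hL etaL t) (hL etaL t)).const_mul (1 / 4)))
    (((((hasDerivAt_trilinear triL2 hr2 (hL dEtaL 0) (hL dEtaL 0)).fun_add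
      (hasDerivAt_trilinear triL2 (hr 0 h0) (hasDerivAt_const 0 (dEtaL ε)) (hL dEtaL 0))).fun_add
      (hasDerivAt_trilinear triL2 (hr 0 h0) (hL dEtaL 0) (hasDerivAt_const 0 (dEtaL ε)))).const_mul
      (1 / 8)).fun_add (((((hasDerivAt_trilinear triL2 (hasDerivAt_const 0 (-etaCont ε)) (hL velL 0)
      (hL velL 0)).fun_add (hasDerivAt_trilinear triL2 (hm 0) (hasDerivAt_const 0 (velL ε))
      (hL velL 0))).fun_add (hasDerivAt_trilinear triL2 (hm 0) (hL velL 0)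
      (hasDerivAt_const 0 (velL ε)))).const_mul (1 / 2))) |>.fun_add
      ((((hasDerivAt_trilinear triL2 (hasDerivAt_const 0 0) (hL etaL 0) (hL etaL 0)).fun_add
      (hasDerivAt_trilinear triL2 (hasDerivAt_const 0 1) (hasDerivAt_const 0 (etaL ε)) (hL etaL 0))).fun_add
      (hasDerivAt_trilinear triL2 (hasDerivAt_const 0 1) (hL etaL 0)
      (hasDerivAt_const 0 (etaL ε)))).const_mul (1 / 4)))
  rw [key]
  simp only [zero_smul, add_zero, map_zero, zero_apply, map_neg,
    neg_apply, zero_add]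
  rw [two_mul (Ring.inverse (1 - etaCont u) ^ 3 * etaCont ε ^ 2), map_add,
    add_apply, add_apply,
    triL2_comm _ (dEtaL ε) (dEtaL u), triL2_comm _ (velL ε) (velL u)]
  ring

theorem hasDerivAt_momentum_line (u ε : X) (t : ℝ) :
    HasDerivAt (fun s : ℝ => momentum (u + s • ε))
      (1 / 2 * (triL2 1 (etaL ε) (velL (u + t • ε)) + triL2 1 (etaL (u + t • ε)) (velL ε))) t := by
  have hL : ∀ {F : Type} [NormedAddCommGroup F] [NormedSpace ℝ F] (A : X →L[ℝ] F) (t : ℝ),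
      HasDerivAt (fun s : ℝ => A (u + s • ε)) (A ε) t := fun A t =>
    A.hasFDerivAt.comp_hasDerivAt t (hasDerivAt_line u ε t)
  simp_rw [momentum_eq]
  have h := (hasDerivAt_trilinear triL2 (hasDerivAt_const t 1) (hL etaL t) (hL velL t)).const_mul (1 / 2)
  rw [map_zero, zero_apply, zero_apply, zero_add] at h
  exact h

theorem fderiv_momentum (u ε : X) :
    fderiv ℝ momentum u ε = 1 / 2 * (triL2 1 (etaL ε) (velL u) + triL2 1 (etaL u) (velL ε)) := by
  have h := hasDerivAt_momentum_line u ε 0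
  have h1 : HasFDerivAt momentum (fderiv ℝ momentum u) (u + (0 : ℝ) • ε) := by
    rw [zero_smul, add_zero]
    exact (contDiff_momentum.differentiable (by norm_num) u).hasFDerivAt
  have h2 : HasDerivAt (fun s : ℝ => momentum (u + s • ε)) (fderiv ℝ momentum u ε) 0 :=
    HasFDerivAt.comp_hasDerivAt (l := momentum) (0 : ℝ) h1 (hasDerivAt_line u ε 0)
  rw [h2.unique h, zero_smul, add_zero]

theorem fderiv_fderiv_momentum (u ε : X) :
    fderiv ℝ (fderiv ℝ momentum) u ε ε = triL2 1 (etaL ε) (velL ε) := by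
  have hL : ∀ (A : X →L[ℝ] L2) (t : ℝ),
      HasDerivAt (fun s : ℝ => A (u + s • ε)) (A ε) t := fun A t =>
    A.hasFDerivAt.comp_hasDerivAt t (hasDerivAt_line u ε t)
  rw [fderiv_fderiv_apply_eq contDiff_momentum.contDiffAt
    (.of_forall (hasDerivAt_momentum_line u ε))
    (((hasDerivAt_trilinear triL2 (hasDerivAt_const 0 1) (hasDerivAt_const 0 (etaL ε)) (hL velL 0)).fun_add
      (hasDerivAt_trilinear triL2 (hasDerivAt_const 0 1) (hL etaL 0)
        (hasDerivAt_const 0 (velL ε)))).const_mul (1 / 2))]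
  simp only [map_zero, zero_apply, zero_add, add_zero]
  ring

/-! ### The quadratic form at the soliton -/

/-- `√(2 - c²) / 2`. -/
noncomputable def waveNumber (c : ℝ) : ℝ := √(2 - c ^ 2) / 2

theorem admissible_waveNumber {c : ℝ} (hc : c ∈ speeds) : Admissible (waveNumber c) c where
  pos := half_pos (Real.sqrt_pos.2 (by linarith [sq_lt_two hc]))
  ne_zero := hc.2
  sq_eq := by
    have := sq_lt_two hc
    rw [waveNumber, div_pow, Real.sq_sqrt (by linarith)]
    ring

theorem etaC_eq {c : ℝ} (hc : c ∈ speeds) : etaC c = prof (waveNumber c) := by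
  funext x
  have h := (admissible_waveNumber hc).sq_eq
  unfold etaC prof
  rw [one_sub_kink_sq, h]
  have e : √(2 - (2 - 4 * waveNumber c ^ 2)) * x / 2 = waveNumber c * x := by
    rw [← h, waveNumber]; ring
  rw [e]
  field_simp
  ring

theorem velC_eq {c : ℝ} (hc : c ∈ speeds) : velC c = velProf (waveNumber c) c := by
  funext x
  rw [velC, etaC_eq hc]
  rfl

theorem deriv_etaC {c : ℝ} (hc : c ∈ speeds) : deriv (etaC c) = profDeriv (waveNumber c) := by
  rw [etaC_eq hc]
  exact funext fun x => (hasDerivAt_prof _ x).deriv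

theorem deriv_velC {c : ℝ} (hc : c ∈ speeds) : deriv (velC c) =
    fun x => -(c / 2 * (profDeriv (waveNumber c) x / dens (waveNumber c) x ^ 2)) := by
  rw [velC_eq hc]
  funext x
  have ha := (admissible_waveNumber hc).dens_ne_zero x
  have h := (((hasDerivAt_prof (waveNumber c) x).const_mul c).fun_neg).fun_div
    ((hasDerivAt_dens (waveNumber c) x).const_mul 2) (mul_ne_zero two_ne_zero ha)
  refine Eq.trans (HasDerivAt.deriv h) ?_
  field_simp
  unfold dens
  ring

theorem etaCont_soliton {c : ℝ} (hc : c ∈ speeds) (x : ℝ) :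
    etaCont (soliton c hc) x = prof (waveNumber c) x := by
  refine congrFun (contRep_eq_of_ae_eq (p := (soliton c hc).fst) (continuous_prof _) ?_) x
  rw [← etaC_eq hc]
  exact (memLp_etaC hc).coeFn_toLp

theorem dEta_soliton {c : ℝ} (hc : c ∈ speeds) :
    dEtaL (soliton c hc) =ᵐ[volume] profDeriv (waveNumber c) := by
  rw [← deriv_etaC hc]
  exact (memLp_deriv_etaC hc).coeFn_toLp

theorem vel_soliton {c : ℝ} (hc : c ∈ speeds) :
    velL (soliton c hc) =ᵐ[volume] velProf (waveNumber c) c := by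
  rw [← velC_eq hc]
  exact (memLp_velC hc).coeFn_toLp

theorem eta_soliton {c : ℝ} (hc : c ∈ speeds) :
    etaL (soliton c hc) =ᵐ[volume] prof (waveNumber c) := by
  rw [← etaC_eq hc]
  exact (memLp_etaC hc).coeFn_toLp

theorem one_sub_etaCont_soliton {c : ℝ} (hc : c ∈ speeds) (x : ℝ) :
    (1 - etaCont (soliton c hc)) x = dens (waveNumber c) x := by
  rw [BoundedContinuousFunction.sub_apply, BoundedContinuousFunction.coe_one, Pi.one_apply,
    etaCont_soliton]
  rfl

/-- 1 - η_c ≥ c²/2 > 0, so its pointwise inverse is bounded; this is where c ≠ 0 enters. -/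
theorem isUnit_soliton {c : ℝ} (hc : c ∈ speeds) : IsUnit (1 - etaCont (soliton c hc)) := by
  have h := admissible_waveNumber hc
  obtain ⟨h1, C, hC⟩ := h.bddCont_div_dens (BddCont.const 1)
  refine IsUnit.of_mul_eq_one (BoundedContinuousFunction.ofNormedAddCommGroup _ h1 C hC) ?_
  ext x
  rw [BoundedContinuousFunction.mul_apply, one_sub_etaCont_soliton]
  exact mul_one_div_cancel (h.dens_ne_zero x)

theorem quadForm_eq {c : ℝ} (hc : c ∈ speeds) (ε : X) : quadForm c hc ε =
    ∫ x, hessDensity (waveNumber c) c (etaCont ε) ε.dEta ε.vel x := by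
  have h := admissible_waveNumber hc
  have hu := isUnit_soliton hc
  have hinv : ∀ x, Ring.inverse (1 - etaCont (soliton c hc)) x = (dens (waveNumber c) x)⁻¹ :=
    fun x => by rw [inverse_apply hu, one_sub_etaCont_soliton]
  rw [quadForm, fderiv_fderiv_energy hu, fderiv_fderiv_momentum]
  have he := sobolevPair_etaCont ε
  have hw : MemLp ε.vel 2 volume := Lp.memLp _
  have hηe := etaCont_ae_eq ε
  have t1 : triL2 (Ring.inverse (1 - etaCont (soliton c hc)) ^ 3 * etaCont ε ^ 2)
      (dEtaL (soliton c hc)) (dEtaL (soliton c hc)) = ∫ x, profDeriv (waveNumber c) x ^ 2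
        / dens (waveNumber c) x ^ 3 * (etaCont ε x * etaCont ε x) := by
    rw [triL2_apply]
    refine integral_congr_ae ?_
    filter_upwards [dEta_soliton hc] with x hx
    rw [hx, BoundedContinuousFunction.mul_apply, BoundedContinuousFunction.pow_apply,
      BoundedContinuousFunction.pow_apply, hinv]
    ring
  have t2 : triL2 (Ring.inverse (1 - etaCont (soliton c hc)) ^ 2 * etaCont ε)
      (dEtaL (soliton c hc)) (dEtaL ε) = ∫ x, profDeriv (waveNumber c) x
        / dens (waveNumber c) x ^ 2 * (ε.dEta x * etaCont ε x) := by
    rw [triL2_apply]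
    refine integral_congr_ae ?_
    filter_upwards [dEta_soliton hc] with x hx
    rw [hx, BoundedContinuousFunction.mul_apply, BoundedContinuousFunction.pow_apply, hinv,
      dEtaL_apply]
    ring
  have t3 : triL2 (Ring.inverse (1 - etaCont (soliton c hc))) (dEtaL ε) (dEtaL ε)
      = ∫ x, 1 / dens (waveNumber c) x * (ε.dEta x * ε.dEta x) := by
    rw [triL2_apply]
    refine integral_congr_ae (.of_forall fun x => ?_)
    simp only [hinv, dEtaL_apply, one_div]
  have t4 : triL2 (etaCont ε) (velL (soliton c hc)) (velL ε)
      = ∫ x, velProf (waveNumber c) c x * (etaCont ε x * ε.vel x) := by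
    rw [triL2_apply]
    refine integral_congr_ae ?_
    filter_upwards [vel_soliton hc] with x hx
    rw [hx, velL_apply]
    ring
  have t5 : triL2 (1 - etaCont (soliton c hc)) (velL ε) (velL ε)
      = ∫ x, dens (waveNumber c) x * (ε.vel x * ε.vel x) := by
    rw [triL2_apply]
    simp only [one_sub_etaCont_soliton, velL_apply]
  have t6 : triL2 1 (etaL ε) (etaL ε) = ∫ x, 1 * (etaCont ε x * etaCont ε x) := by
    rw [triL2_apply]
    refine integral_congr_ae ?_
    filter_upwards [hηe] with x hx
    rw [etaL_apply, hx, BoundedContinuousFunction.coe_one, Pi.one_apply]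
  have t7 : triL2 1 (etaL ε) (velL ε) = ∫ x, 1 * (etaCont ε x * ε.vel x) := by
    rw [triL2_apply]
    refine integral_congr_ae ?_
    filter_upwards [hηe] with x hx
    rw [etaL_apply, hx, BoundedContinuousFunction.coe_one, Pi.one_apply, velL_apply]
  rw [t1, t2, t3, t4, t5, t6, t7]
  have i1 := ((h.bddCont_div_dens_pow ((bddCont_profDeriv (waveNumber c)).pow 2) 3).integrable_mul_mul
    he.memLp he.memLp).const_mul (1 / 4)
  have i2 := ((h.bddCont_div_dens_pow (bddCont_profDeriv (waveNumber c)) 2).integrable_mul_mul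
    he.memLp_deriv he.memLp).const_mul (1 / 2)
  have i3 := ((h.bddCont_div_dens (BddCont.const 1)).integrable_mul_mul
    he.memLp_deriv he.memLp_deriv).const_mul (1 / 4)
  have i4 := (h.bddCont_velProf.integrable_mul_mul he.memLp hw).const_mul 2
  have i5 := (bddCont_dens (waveNumber c)).integrable_mul_mul hw hw
  have i6 := ((BddCont.const 1).integrable_mul_mul he.memLp he.memLp).const_mul (1 / 2)
  have i7 := ((BddCont.const 1).integrable_mul_mul he.memLp hw).const_mul c
  have j2 := i1.add i2
  have j3 := j2.add i3
  have j4 := j3.sub i4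
  have j5 := j4.add i5
  have j6 := j5.add i6
  have key := integral_add' j6 i7
  rw [integral_add' j5 i6, integral_add' j4 i5, integral_sub' j3 i4, integral_add' j2 i3,
    integral_add' i1 i2] at key
  simp only [integral_const_mul] at key ⊢
  rw [← key]
  refine integral_congr_ae (.of_forall fun x => ?_)
  simp only [Pi.add_apply, Pi.sub_apply, hessDensity]
  ring

theorem integral_eq_zero_of_fderiv_momentum {c : ℝ} (hc : c ∈ speeds) {ε : X}
    (hε : fderiv ℝ momentum (soliton c hc) ε = 0) :
    ∫ x, (prof (waveNumber c) x * ε.vel x + velProf (waveNumber c) c x * etaCont ε x) = 0 := by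
  have h := admissible_waveNumber hc
  rw [fderiv_momentum, triL2_apply, triL2_apply] at hε
  have hw : MemLp ε.vel 2 volume := Lp.memLp _
  rw [integral_add (integrable_of_memLp_mul h.memLp_prof hw)
    (integrable_of_memLp_mul h.memLp_velProf (sobolevPair_etaCont ε).memLp)]
  have e1 : ∫ x, (1 : BoundedContinuousFunction ℝ ℝ) x * (etaL ε x * velL (soliton c hc) x)
      = ∫ x, velProf (waveNumber c) c x * etaCont ε x := by
    refine integral_congr_ae ?_
    filter_upwards [vel_soliton hc, etaCont_ae_eq ε] with x hx hx'
    rw [hx, etaL_apply, hx', BoundedContinuousFunction.coe_one, Pi.one_apply]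
    ring
  have e2 : ∫ x, (1 : BoundedContinuousFunction ℝ ℝ) x * (etaL (soliton c hc) x * velL ε x)
      = ∫ x, prof (waveNumber c) x * ε.vel x := by
    refine integral_congr_ae ?_
    filter_upwards [eta_soliton hc] with x hx
    rw [hx, velL_apply, BoundedContinuousFunction.coe_one, Pi.one_apply, one_mul]
  rw [e1, e2] at hε
  linarith

theorem integral_eq_zero_of_innerDerivSoliton {c : ℝ} (hc : c ∈ speeds) {ε : X}
    (hε : innerDerivSoliton c ε = 0) :
    ∫ x, (etaCont ε x * profDeriv (waveNumber c) x - c / 2 * (profDeriv (waveNumber c) x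
      / dens (waveNumber c) x ^ 2 * ε.vel x)) = 0 := by
  have h := admissible_waveNumber hc
  have hw : MemLp ε.vel 2 volume := Lp.memLp _
  have hm : MemLp (fun x => profDeriv (waveNumber c) x / dens (waveNumber c) x ^ 2) 2 volume := by
    refine (funext fun x => ?_ : (fun x => profDeriv (waveNumber c) x
      / dens (waveNumber c) x ^ 2) = _) ▸
      (h.bddCont_div_dens_pow (BddCont.const 1) 2).memLp_mul h.memLp_profDeriv
    ring
  rw [innerDerivSoliton, deriv_etaC hc, deriv_velC hc] at hε
  rw [integral_sub (integrable_of_memLp_mul (sobolevPair_etaCont ε).memLp h.memLp_profDeriv)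
    ((integrable_of_memLp_mul hm hw).const_mul _), integral_const_mul]
  have e1 : ∫ x, ε.eta x * profDeriv (waveNumber c) x
      = ∫ x, etaCont ε x * profDeriv (waveNumber c) x := by
    refine integral_congr_ae ?_
    filter_upwards [etaCont_ae_eq ε] with x hx
    rw [hx]
  have e2 : ∀ x, ε.vel x * -(c / 2 * (profDeriv (waveNumber c) x / dens (waveNumber c) x ^ 2))
      = -(c / 2) * (profDeriv (waveNumber c) x / dens (waveNumber c) x ^ 2 * ε.vel x) :=
    fun x => by ring
  simp_rw [e2] at hε
  rw [e1, integral_const_mul] at hε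
  linarith

/-! ### Uniform and optimal coercivity constants. -/

/-- `r` is a coercivity constant at speed `c`. -/
def IsCoercivityConst (c r : ℝ) : Prop :=
  ∀ (hc : c ∈ speeds) (ε : X), innerDerivSoliton c ε = 0 →
    fderiv ℝ momentum (soliton c hc) ε = 0 → r * ‖ε‖ ^ 2 ≤ quadForm c hc ε

theorem exists_uniform_coercivityConst {K : Set ℝ} (hK : IsCompact K) (hKs : K ⊆ speeds) :
    ∃ m : ℝ, 0 < m ∧ m ≤ 1 ∧ ∀ c ∈ K, IsCoercivityConst c m := by
  -- Compactness enters only here: both k and c² are bounded below on `K`.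
  obtain ⟨δ, hδ, hδK⟩ := hK.exists_forall_le' (f := fun c => min (waveNumber c) (c ^ 2)) (a := 0)
    (by unfold waveNumber; fun_prop) fun c hc =>
      lt_min (admissible_waveNumber (hKs hc)).pos (sq_pos_of_speed (hKs hc))
  set M := max 1 (1 / δ)
  have hM : 1 ≤ M := le_max_left _ _
  have hMδ : ∀ r, δ ≤ r → 1 ≤ M * r := fun r hr => by
    calc 1 = 1 / δ * δ := by field_simp
      _ ≤ M * r := by gcongr; exact le_max_right _ _
  set C := 600 * (1000 * M ^ 9) ^ 14
  have hC : 1 ≤ C := by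
    have h1 : 1 ≤ 1000 * M ^ 9 := by linarith [one_le_pow₀ (n := 9) hM]
    linarith [one_le_pow₀ (n := 14) h1]
  refine ⟨1 / C, by positivity, (div_le_one (by positivity)).2 hC, fun c hcK hc ε hO hP => ?_⟩
  have h := admissible_waveNumber hc
  have key := h.coercive hM (hMδ _ ((hδK c hcK).trans (min_le_left _ _)))
    (hMδ _ ((hδK c hcK).trans (min_le_right _ _))) (sobolevPair_etaCont ε) (Lp.memLp ε.vel)
    (integral_eq_zero_of_fderiv_momentum hc hP) (integral_eq_zero_of_innerDerivSoliton hc hO)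
  rw [← norm_sq_X, ← quadForm_eq hc] at key
  rw [one_div, inv_mul_le_iff₀ (by positivity)]
  exact key

/-- The optimal coercivity constant, truncated at `1`. -/
noncomputable def optimalConst (c : ℝ) : ℝ := sSup {r | r ≤ 1 ∧ IsCoercivityConst c r}

/-- The supremum is one choice of Λ_c that serves all compact sets at once. The truncation at 1
keeps the set bounded above, also for `c` outside `speeds`, where the condition is vacuous. -/
theorem le_optimalConst {c r : ℝ} (h1 : r ≤ 1) (h : IsCoercivityConst c r) :
    r ≤ optimalConst c :=
  le_csSup ⟨1, fun _ hr => hr.1⟩ ⟨h1, h⟩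

/-- For fixed ε the inequality is closed in r, so it passes to the supremum; the compact set {c}
shows that the supremum is over a nonempty set. -/
theorem isCoercivityConst_optimalConst (c : ℝ) : IsCoercivityConst c (optimalConst c) := by
  intro hc ε hO hP
  obtain ⟨m, -, hm1, hm⟩ := exists_uniform_coercivityConst (isCompact_singleton (x := c))
    (singleton_subset_iff.2 hc)
  have hmc := hm c rfl
  rcases eq_or_ne ‖ε‖ 0 with h0 | h0
  · simpa [h0] using hmc hc ε hO hP
  · have hpos : 0 < ‖ε‖ ^ 2 := by positivity
    rw [← le_div_iff₀ hpos]
    exact csSup_le ⟨m, hm1, hmc⟩ fun r hr => (le_div_iff₀ hpos).2 (hr.2 hc ε hO hP)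

end GrossPitaevskii

theorem proposition1 :
    (∀ (c : ℝ) (hc : c ∈ GrossPitaevskii.speeds),
      ContDiffAt ℝ 2 GrossPitaevskii.energy (GrossPitaevskii.soliton c hc) ∧
      ContDiffAt ℝ 2 GrossPitaevskii.momentum (GrossPitaevskii.soliton c hc)) ∧
    ∃ Λ : ℝ → ℝ,
      (∀ (c : ℝ) (hc : c ∈ GrossPitaevskii.speeds),
        0 < Λ c ∧
        ∀ ε : GrossPitaevskii.X,
          GrossPitaevskii.innerDerivSoliton c ε = 0 →
          fderiv ℝ GrossPitaevskii.momentum (GrossPitaevskii.soliton c hc) ε = 0 →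
          Λ c * ‖ε‖ ^ 2 ≤ GrossPitaevskii.quadForm c hc ε) ∧
      (∀ K : Set ℝ, IsCompact K → K ⊆ GrossPitaevskii.speeds →
        ∃ m : ℝ, 0 < m ∧ ∀ c ∈ K, m ≤ Λ c) := by
  have hΛ : ∀ K : Set ℝ, IsCompact K → K ⊆ GrossPitaevskii.speeds →
      ∃ m : ℝ, 0 < m ∧ ∀ c ∈ K, m ≤ GrossPitaevskii.optimalConst c := fun K hK hKs => by
    obtain ⟨m, hm0, hm1, hm⟩ := GrossPitaevskii.exists_uniform_coercivityConst hK hKs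
    exact ⟨m, hm0, fun c hc => GrossPitaevskii.le_optimalConst hm1 (hm c hc)⟩
  refine ⟨fun c hc => ⟨GrossPitaevskii.contDiffAt_energy (GrossPitaevskii.isUnit_soliton hc),
    GrossPitaevskii.contDiff_momentum.contDiffAt⟩, GrossPitaevskii.optimalConst,
    fun c hc => ⟨?_, GrossPitaevskii.isCoercivityConst_optimalConst c hc⟩, hΛ⟩
  obtain ⟨m, hm0, hm⟩ := hΛ {c} isCompact_singleton (singleton_subset_iff.2 hc)
  exact hm0.trans_le (hm c rfl)
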